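/- Let $\mathfrak a$ be a nonzero monomial ideal in $\mathbb C[x_1,\dots,x_n]$ and let $f_1,\dots,f_r$ be any finite system of nonzero generators of $\mathfrak a$ (not necessarily monomials). The Bernstein–Sato polynomial. For independent variables $s_1,\dots,s_r$, consider the free $\mathbb C[x][\prod_i f_i^{-1},s_1,\dots,s_r]$-module of rank one generated by the symbol $\prod_i f_i^{s_i}$. The operators $x_i$ and $\partial_{x_i}$ act on it in the natural way, and $t_j$ acts by replacing $s_j$ by $s_j+1$ (both in the coefficients and in $\prod_i f_i^{s_i}$). Put $s_{i,j}=s_it_i^{-1}t_j$. A Bernstein–Sato polynomial $b(s)\in\mathbb C[s]$ of $(f_1,\dots,f_r)$ is a monic polynomial of the lowest degree for which $$b(s_1+\dots+s_r)\prod_i f_i^{s_i}=\sum_{k=1}^r P_kt_k\prod_i f_i^{s_i}$$ for some $P_1,\dots,P_r$ in the ring of operators generated over $\mathbb C$ by the $x_i$, the $\partial_{x_i}$ and the $s_{i,j}$. The combinatorial data. Let $\Gamma_{\mathfrak a}=\{u\in\mathbb Z_{\ge0}^n: x^u\in\mathfrak a\}$, let $P_{\mathfrak a}\subseteq\mathbb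 R^n$ be its convex hull (the Newton polyhedron), and let $e=(1,\dots,1)$. For a nonempty proper face $Q$ of $P_{\mathfrak a}$ that is not contained in any coordinate hyperplane $\{x_i=0\}$, let - $M_Q=e+S_Q$, where $S_Q$ is the subsemigroup of $\mathbb Z^n$ generated by all $u-v$ with $u\in\Gamma_{\mathfrak a}$ and $v\in\Gamma_{\mathfrak a}\cap Q$; - $M_Q'=v_0+M_Q$ for $v_0\in\Gamma_{\mathfrak a}\cap Q$ (this does not depend on $v_0$); - $V_Q$ be the linear subspace of $\mathbb R^n$ spanned by $Q$; - $L_Q$ be a linear function on $\mathbb R^n$ with rational coefficients and $L_Q=1$ on $Q$; - $R_Q=\{-L_Q(u): u\in(M_Q\smallsetminus M_Q')\cap V_Q\}$ (this does not depend on the choice of $L_Q$). Theorem. The Bernstein–Sato polynomial $b_{\mathfrak a}$ of $(f_1,\dots,f_r)$ exists and is unique, and its set of complex roots, taken without multiplicities, is $$\{z\in\mathbb C: b_{\mathfrak a}(z)=0\}=\bigcup_Q R_Q,$$ where $Q$ runs over the nonempty proper faces of $P_{\mathfrak a}$ that are not contained in any coordinate hyperplane. -/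

import Mathlib

open MvPolynomial

/-! ## Differentiation in a localization -/

section LocalizedDerivation

variable {R : Type*} [CommRing R] [Algebra ℂ R]

/-- The `ℂ`-algebra homomorphism `a ↦ a + (d a) ε` into the dual numbers over `R[1/p]`. -/
noncomputable def derivToDualNumber (d : Derivation ℂ R R) (p : R) :
    R →ₐ[ℂ] DualNumber (Localization.Away p) where
  toFun a := TrivSqZeroExt.inl (algebraMap R (Localization.Away p) a) +
    TrivSqZeroExt.inr (algebraMap R (Localization.Away p) (d a))
  map_one' := by simp
  map_zero' := by simp
  map_add' a b := by
    ext
    · simp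
    · simp only [map_add, TrivSqZeroExt.snd_add, TrivSqZeroExt.snd_inl, TrivSqZeroExt.snd_inr,
        zero_add]
  map_mul' a b := by
    ext
    · simp
    · simp only [Derivation.leibniz, smul_eq_mul, map_add, map_mul, TrivSqZeroExt.snd_add,
        TrivSqZeroExt.snd_inl, TrivSqZeroExt.snd_inr, zero_add, TrivSqZeroExt.snd_mul,
        TrivSqZeroExt.fst_add, TrivSqZeroExt.fst_inl, TrivSqZeroExt.fst_inr, add_zero,
        MulOpposite.smul_eq_mul_unop, MulOpposite.unop_op]
      ring
  commutes' c := by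
    ext
    · simp [← IsScalarTower.algebraMap_apply, TrivSqZeroExt.algebraMap_eq_inl']
    · simp [TrivSqZeroExt.algebraMap_eq_inl']

theorem isUnit_derivToDualNumber (d : Derivation ℂ R R) (p : R) (y : Submonoid.powers p) :
    IsUnit (derivToDualNumber d p y) := by
  rw [TrivSqZeroExt.isUnit_iff_isUnit_fst]
  simpa [derivToDualNumber] using IsLocalization.map_units (Localization.Away p) y

/-- The `ℂ`-algebra homomorphism `a ↦ a + (d a) ε` on the localization `R[1/p]`. -/
noncomputable def locDerivToDualNumber (d : Derivation ℂ R R) (p : R) :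
    Localization.Away p →ₐ[ℂ] DualNumber (Localization.Away p) :=
  IsLocalization.liftAlgHom (M := Submonoid.powers p) (f := derivToDualNumber d p)
    (isUnit_derivToDualNumber d p)

theorem fst_locDerivToDualNumber (d : Derivation ℂ R R) (p : R) (a : Localization.Away p) :
    (locDerivToDualNumber d p a).fst = a := by
  have h : ((TrivSqZeroExt.fstHom ℂ (Localization.Away p) (Localization.Away p)).comp
      (locDerivToDualNumber d p)).toRingHom = RingHom.id _ := by
    apply IsLocalization.ringHom_ext (Submonoid.powers p)
    ext x
    simp [locDerivToDualNumber, derivToDualNumber]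
  exact congrArg (fun g : Localization.Away p →+* Localization.Away p => g a) h

/-- The unique extension of a derivation `d` of `R` to a derivation of `R[1/p]`. -/
noncomputable def locDeriv (d : Derivation ℂ R R) (p : R) :
    Derivation ℂ (Localization.Away p) (Localization.Away p) :=
  Derivation.mk'
    ((TrivSqZeroExt.sndHom (Localization.Away p) (Localization.Away p)).restrictScalars ℂ ∘ₗ
      (locDerivToDualNumber d p).toLinearMap)
    (fun a b => by simp [fst_locDerivToDualNumber, mul_comm])

theorem locDeriv_algebraMap (d : Derivation ℂ R R) (p a : R) :
    locDeriv d p (algebraMap R (Localization.Away p) a) =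
      algebraMap R (Localization.Away p) (d a) := by
  change (IsLocalization.lift (M := Submonoid.powers p) (isUnit_derivToDualNumber d p)
    (algebraMap R (Localization.Away p) a)).snd = _
  rw [IsLocalization.lift_eq]
  change (TrivSqZeroExt.inl (algebraMap R (Localization.Away p) a) +
    TrivSqZeroExt.inr (algebraMap R (Localization.Away p) (d a)) :
      DualNumber (Localization.Away p)).snd = _
  rw [TrivSqZeroExt.snd_add, TrivSqZeroExt.snd_inl, TrivSqZeroExt.snd_inr, zero_add]

/-- A derivation `D` of `A`, extended to the polynomial ring `A[s₁, …, s_r]` by acting on the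
coefficients (so that `D sⱼ = 0`). -/
noncomputable def coeffDeriv {A : Type*} [CommRing A] [Algebra ℂ A] (r : ℕ)
    (D : Derivation ℂ A A) : Module.End ℂ (MvPolynomial (Fin r) A) where
  toFun p := AddMonoidAlgebra.map (D : A →ₗ[ℂ] A).toAddMonoidHom p
  map_add' p q := by
    ext m
    simp [MvPolynomial.coeff, AddMonoidAlgebra.map]
  map_smul' c p := by
    ext m
    simp [MvPolynomial.coeff, AddMonoidAlgebra.map]

theorem coeff_coeffDeriv {A : Type*} [CommRing A] [Algebra ℂ A] (r : ℕ)
    (D : Derivation ℂ A A) (p : MvPolynomial (Fin r) A) (m : Fin r →₀ ℕ) :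
    MvPolynomial.coeff m (coeffDeriv r D p) = D (MvPolynomial.coeff m p) := by
  simp [coeffDeriv, MvPolynomial.coeff, AddMonoidAlgebra.map]

end LocalizedDerivation

/-! ## Bernstein–Sato polynomials of ideals in `ℂ[x₁, …, xₙ]`

For nonzero `f₁, …, f_r`, the free module `ℂ[x][∏ fᵢ⁻¹, s₁, …, s_r] · ∏ fᵢ^{sᵢ}` is represented by
the coefficient of the generator `∏ fᵢ^{sᵢ}`: an element `g` of the coefficient ring stands for
`g · ∏ fᵢ^{sᵢ}`. -/

namespace BernsteinSato

section

variable {n r : ℕ} (f : Fin r → MvPolynomial (Fin n) ℂ)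

/-- `ℂ[x₁, …, xₙ][∏ fᵢ⁻¹]`. -/
abbrev Loc : Type := Localization.Away (∏ j, f j)

/-- `ℂ[x₁, …, xₙ][∏ fᵢ⁻¹, s₁, …, s_r]`. -/
abbrev Coeffs : Type := MvPolynomial (Fin r) (Loc f)

theorem isUnit_gen (j : Fin r) : IsUnit (algebraMap (MvPolynomial (Fin n) ℂ) (Loc f) (f j)) :=
  isUnit_of_dvd_unit (map_dvd _ (Finset.dvd_prod_of_mem f (Finset.mem_univ j)))
    (IsLocalization.Away.algebraMap_isUnit (∏ j, f j))

/-- `fⱼ` as a unit of `ℂ[x][∏ fᵢ⁻¹]`. -/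
noncomputable def genUnit (j : Fin r) : (Loc f)ˣ := (isUnit_gen f j).unit

/-- Multiplication by the coordinate `xᵢ`. -/
noncomputable def xOp (i : Fin n) : Module.End ℂ (Coeffs f) :=
  LinearMap.mulLeft ℂ (C (algebraMap (MvPolynomial (Fin n) ℂ) (Loc f) (X i)))

/-- The action of `∂/∂xᵢ`:
`∂ᵢ (g ∏ fⱼ^{sⱼ}) = (∂ᵢ g + g ∑ⱼ sⱼ (∂ᵢ fⱼ) fⱼ⁻¹) ∏ fⱼ^{sⱼ}`. -/
noncomputable def dOp (i : Fin n) : Module.End ℂ (Coeffs f) :=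
  coeffDeriv r (locDeriv (pderiv i) (∏ j, f j)) +
    LinearMap.mulLeft ℂ (∑ j, X j *
      C (algebraMap (MvPolynomial (Fin n) ℂ) (Loc f) (pderiv i (f j)) * ((genUnit f j)⁻¹ : (Loc f)ˣ)))

/-- The substitution `sⱼ ↦ sⱼ + c`, fixing `s_k` for `k ≠ j`. -/
noncomputable def shift (j : Fin r) (c : ℤ) : Coeffs f →ₐ[Loc f] Coeffs f :=
  aeval fun k => if k = j then X k + (c : Coeffs f) else X k

/-- The action of `tⱼ`: replace `sⱼ` by `sⱼ + 1`, both in the coefficient and in `∏ fᵢ^{sᵢ}`. -/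
noncomputable def tOp (j : Fin r) : Module.End ℂ (Coeffs f) :=
  LinearMap.mulLeft ℂ (C (genUnit f j : Loc f)) ∘ₗ
    ((shift f j 1).toLinearMap.restrictScalars ℂ)

/-- The action of `tⱼ⁻¹`: replace `sⱼ` by `sⱼ - 1`, both in the coefficient and in `∏ fᵢ^{sᵢ}`. -/
noncomputable def tInvOp (j : Fin r) : Module.End ℂ (Coeffs f) :=
  LinearMap.mulLeft ℂ (C (((genUnit f j)⁻¹ : (Loc f)ˣ) : Loc f)) ∘ₗ
    ((shift f j (-1)).toLinearMap.restrictScalars ℂ)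

theorem shift_shift (j : Fin r) (c d : ℤ) (h : c + d = 0) (g : Coeffs f) :
    shift f j c (shift f j d g) = g := by
  have e : (shift f j c).comp (shift f j d) = AlgHom.id _ _ := by
    ext k
    have h' : (c : Coeffs f) + (d : Coeffs f) = 0 := by rw [← Int.cast_add, h, Int.cast_zero]
    by_cases hk : k = j
    · simp [shift, hk, add_assoc, h']
    · simp [shift, hk]
  exact congrArg (fun φ : Coeffs f →ₐ[Loc f] Coeffs f => φ g) e

theorem tOp_mul_tInvOp (j : Fin r) : tOp f j * tInvOp f j = 1 := by
  refine LinearMap.ext fun g => ?_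
  change C (genUnit f j : Loc f) *
    shift f j 1 (C (((genUnit f j)⁻¹ : (Loc f)ˣ) : Loc f) * shift f j (-1) g) = g
  rw [map_mul, shift_shift f j 1 (-1) (by norm_num), ← mul_assoc]
  have : shift f j 1 (C (((genUnit f j)⁻¹ : (Loc f)ˣ) : Loc f)) =
    C (((genUnit f j)⁻¹ : (Loc f)ˣ) : Loc f) := by simp [shift]
  rw [this, ← C_mul]
  simp

theorem tInvOp_mul_tOp (j : Fin r) : tInvOp f j * tOp f j = 1 := by
  refine LinearMap.ext fun g => ?_
  change C (((genUnit f j)⁻¹ : (Loc f)ˣ) : Loc f) *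
    shift f j (-1) (C (genUnit f j : Loc f) * shift f j 1 g) = g
  rw [map_mul, shift_shift f j (-1) 1 (by norm_num), ← mul_assoc]
  have : shift f j (-1) (C (genUnit f j : Loc f)) = C (genUnit f j : Loc f) := by simp [shift]
  rw [this, ← C_mul]
  simp

/-- The operator `s_{i,j} = sᵢ tᵢ⁻¹ tⱼ`. -/
noncomputable def sOp (i j : Fin r) : Module.End ℂ (Coeffs f) :=
  LinearMap.mulLeft ℂ (X i) * tInvOp f i * tOp f j

/-- The ring of operators generated by the differential operators on affine space (that is, by
the `xᵢ` and the `∂/∂xᵢ`) and by the `s_{i,j}`. -/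
noncomputable def opRing : Subalgebra ℂ (Module.End ℂ (Coeffs f)) :=
  Algebra.adjoin ℂ (Set.range (xOp f) ∪ Set.range (dOp f) ∪
    Set.range fun ij : Fin r × Fin r => sOp f ij.1 ij.2)

/-- The functional equation `b(s₁ + ⋯ + s_r) ∏ fᵢ^{sᵢ} = ∑ₖ Pₖ tₖ ∏ fᵢ^{sᵢ}` with all `Pₖ` in the
ring generated by the differential operators and the `s_{i,j}`. -/
def SatisfiesFunctionalEquation (b : Polynomial ℂ) : Prop :=
  ∃ P : Fin r → Module.End ℂ (Coeffs f), (∀ k, P k ∈ opRing f) ∧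
    Polynomial.aeval (∑ j, (X j : Coeffs f)) b = ∑ k, P k (tOp f k 1)

/-- `b` is the Bernstein–Sato polynomial of `f = (f₁, …, f_r)`: a monic polynomial of the lowest
degree satisfying the functional equation. -/
def IsBernsteinSatoPolynomial (b : Polynomial ℂ) : Prop :=
  b.Monic ∧ SatisfiesFunctionalEquation f b ∧
    ∀ c : Polynomial ℂ, c.Monic → SatisfiesFunctionalEquation f c → b.natDegree ≤ c.natDegree

end

/-! ## Combinatorics of monomial ideals -/

section

variable {n : ℕ}

/-- An ideal generated by monomials. -/
def IsMonomialIdeal (a : Ideal (MvPolynomial (Fin n) ℂ)) : Prop :=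
  ∃ S : Set (Fin n →₀ ℕ), a = Ideal.span ((fun u => monomial u (1 : ℂ)) '' S)

/-- The semigroup `Γ` of exponents of the monomials in `a`, as a subset of `ℤⁿ`. -/
def expSet (a : Ideal (MvPolynomial (Fin n) ℂ)) : Set (Fin n → ℤ) :=
  {u | ∃ m : Fin n →₀ ℕ, monomial m (1 : ℂ) ∈ a ∧ ∀ i, u i = m i}

/-- The inclusion of `ℤⁿ` in `ℝⁿ`. -/
def toReal (u : Fin n → ℤ) : Fin n → ℝ := fun i => u i

/-- The Newton polyhedron: the convex hull of `Γ`. -/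
def newtonPolyhedron (a : Ideal (MvPolynomial (Fin n) ℂ)) : Set (Fin n → ℝ) :=
  convexHull ℝ (toReal '' expSet a)

/-- `Q` is a (nonempty) proper face of `P`: the locus where some linear function attains its
maximum over `P`, different from `P`. -/
def IsProperFace (P Q : Set (Fin n → ℝ)) : Prop :=
  Q.Nonempty ∧ Q ≠ P ∧ IsExposed ℝ P Q

/-- `Q` is contained in one of the coordinate hyperplanes `xᵢ = 0`. -/
def InCoordinateHyperplane (Q : Set (Fin n → ℝ)) : Prop :=
  ∃ i, ∀ x ∈ Q, x i = 0

/-- `Γ ∩ Q`. -/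
def expSetOn (a : Ideal (MvPolynomial (Fin n) ℂ)) (Q : Set (Fin n → ℝ)) : Set (Fin n → ℤ) :=
  {v | v ∈ expSet a ∧ toReal v ∈ Q}

/-- `M_Q`: the translate by `e = (1, …, 1)` of the subsemigroup of `ℤⁿ` generated by the elements
`u - v` with `u ∈ Γ` and `v ∈ Γ ∩ Q`. -/
def semigroupM (a : Ideal (MvPolynomial (Fin n) ℂ)) (Q : Set (Fin n → ℝ)) : Set (Fin n → ℤ) :=
  {w | ∃ m ∈ AddSubsemigroup.closure
      {d : Fin n → ℤ | ∃ u ∈ expSet a, ∃ v ∈ expSetOn a Q, d = u - v}, w = 1 + m}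

/-- `M_Q' = v₀ + M_Q` for `v₀ ∈ Γ ∩ Q`; the translate is the same for every `v₀`, see
`semigroupM'_eq`. -/
def semigroupM' (a : Ideal (MvPolynomial (Fin n) ℂ)) (Q : Set (Fin n → ℝ)) : Set (Fin n → ℤ) :=
  {w | ∃ v₀ ∈ expSetOn a Q, ∃ m ∈ semigroupM a Q, w = v₀ + m}

theorem semigroupM'_eq (a : Ideal (MvPolynomial (Fin n) ℂ)) (Q : Set (Fin n → ℝ))
    {v₀ : Fin n → ℤ} (hv₀ : v₀ ∈ expSetOn a Q) :
    semigroupM' a Q = (fun m => v₀ + m) '' semigroupM a Q := by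
  ext w
  constructor
  · rintro ⟨v₁, hv₁, m, ⟨k, hk, rfl⟩, rfl⟩
    refine ⟨1 + ((v₁ - v₀) + k), ⟨_, ?_, rfl⟩, by simp only []; abel⟩
    exact add_mem (AddSubsemigroup.subset_closure ⟨v₁, hv₁.1, v₀, hv₀, rfl⟩) hk
  · rintro ⟨m, hm, rfl⟩
    exact ⟨v₀, hv₀, m, hm, rfl⟩

/-- `l` gives the coefficients of a linear function `L_Q(x) = ∑ lᵢ xᵢ`, with rational
coefficients, that is equal to `1` on `Q`. -/
def IsLinearFormFor (Q : Set (Fin n → ℝ)) (l : Fin n → ℚ) : Prop :=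
  ∀ x ∈ Q, ∑ i, (l i : ℝ) * x i = 1

theorem IsLinearFormFor.value_eq {Q : Set (Fin n → ℝ)} {l l' : Fin n → ℚ}
    (hl : IsLinearFormFor Q l) (hl' : IsLinearFormFor Q l') {u : Fin n → ℤ}
    (hu : toReal u ∈ Submodule.span ℝ Q) : ∑ i, l i * (u i : ℚ) = ∑ i, l' i * (u i : ℚ) := by
  have h : ∀ x ∈ Submodule.span ℝ Q, ∑ i, (l i : ℝ) * x i = ∑ i, (l' i : ℝ) * x i := by
    intro x hx
    induction hx using Submodule.span_induction with
    | mem x hx => rw [hl x hx, hl' x hx]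
    | zero => simp
    | add x y _ _ hx hy => simp only [Pi.add_apply, mul_add, Finset.sum_add_distrib, hx, hy]
    | smul c x _ hx =>
      simp only [Pi.smul_apply, smul_eq_mul, mul_left_comm _ c, ← Finset.mul_sum, hx]
  have := h _ hu
  simp only [toReal] at this
  exact_mod_cast this

/-- `R_Q`: the set of the `-L_Q(u)` with `u ∈ (M_Q ∖ M_Q') ∩ V_Q`, where `V_Q` is the linear span
of `Q`. The value `L_Q(u)` is the same for all `L_Q`, because `u ∈ V_Q`: see
`IsLinearFormFor.value_eq`. -/
def faceRoots (a : Ideal (MvPolynomial (Fin n) ℂ)) (Q : Set (Fin n → ℝ)) : Set ℂ :=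
  {z | ∃ l : Fin n → ℚ, IsLinearFormFor Q l ∧ ∃ u : Fin n → ℤ,
    u ∈ semigroupM a Q ∧ u ∉ semigroupM' a Q ∧ toReal u ∈ Submodule.span ℝ Q ∧
      z = -((∑ i, l i * (u i : ℚ) : ℚ) : ℂ)}

end

end BernsteinSato

/-!
The roots are described through critical points of monomial systems of generators.

*The Weyl algebra model.* Send `y_j` to `s_j t_j⁻¹` and `∂/∂y_j` to `t_j`. This identifies the
module in the functional equation with the module generated by `a · exp(∑ f_j y_j)` in
`ℂ[x, y] exp(∑ f_j y_j)`, and `∑ s_j` with the Euler operator `∑ y_j ∂/∂y_j`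
(`satisfiesFunctionalEquation_iff_weyl`). Linear substitutions in the `y_j` show that the functional
equation depends only on the ideal `a` (`WeylFunctionalEquation.of_span_eq`), so that the generators
can be replaced by monomials `x^{a_j}`, and by different monomials in different parts of the proof.

*Critical points.* Write `ℓ_i(s) = ∑ a_{ji} s_j`. A point `s` is critical (`IsCritical`) if all the
polynomials `g_c(s) = ∏_{c_j<0} s_j ⋯ (s_j+c_j+1) · ∏_{ℓ_i(c)>0} (ℓ_i(s)+1) ⋯ (ℓ_i(s)+ℓ_i(c))` with
`∑ c_j = 1` vanish at `s`.

* Evaluating the functional equation near a critical point shows `b(∑ s_j) = 0`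
  (`WeylFunctionalEquation.eval_eq_zero`).
* Explicit operators show that `b` satisfies the functional equation if `b(∑ s_j)` belongs to the
  ideal generated by the `g_c` (`satisfiesFunctionalEquation_of_mem_span`). The critical points form
  a finite union of affine subspaces on which `∑ s_j` is rational, hence takes finitely many values;
  by the Nullstellensatz there is such a `b ≠ 0` whose roots are among these values
  (`exists_satisfiesFunctionalEquation_monomials`).

*Faces.* The coordinate sums of the critical points are the elements of the `R_Q`. An element of
`R_Q` is the coordinate sum of a critical point of a large enough monomial system
(`exists_isCritical_of_mem_faceRoots`). Conversely, Farkas' lemma with strict complementarity turns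
a critical point into a linear form that is at least `1` on the Newton polyhedron
(`IsCritical.exists_certificate`), and the face on which the form is equal to `1` is the required
`Q` (`IsCritical.exists_sum_mem_faceRoots`).
-/

namespace BernsteinSato

/-! ### Submodules generated under a set of operators -/

section Hull

variable {V : Type*} [AddCommGroup V] [Module ℂ V]

/-- The smallest subspace that contains `S` and is stable under the operators in `G`. -/
def hull (G : Set (Module.End ℂ V)) (S : Set V) : Submodule ℂ V :=
  sInf {W | S ⊆ W ∧ ∀ g ∈ G, ∀ w ∈ W, g w ∈ W}

variable {G : Set (Module.End ℂ V)} {S : Set V}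

theorem subset_hull : S ⊆ hull G S := by
  intro x hx
  simp only [hull, SetLike.mem_coe, Submodule.mem_sInf]
  intro W hW
  exact hW.1 hx

theorem apply_mem_hull {g : Module.End ℂ V} (hg : g ∈ G) {w : V} (hw : w ∈ hull G S) :
    g w ∈ hull G S := by
  simp only [hull, Submodule.mem_sInf] at hw ⊢
  intro W hW
  exact hW.2 g hg w (hw W hW)

theorem hull_le {W : Submodule ℂ V} (hS : S ⊆ W) (hG : ∀ g ∈ G, ∀ w ∈ W, g w ∈ W) :
    hull G S ≤ W := sInf_le ⟨hS, hG⟩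

theorem adjoin_apply_mem_hull {P : Module.End ℂ V} (hP : P ∈ Algebra.adjoin ℂ G) {w : V}
    (hw : w ∈ hull G S) : P w ∈ hull G S := by
  induction hP using Algebra.adjoin_induction generalizing w with
  | mem g hg => exact apply_mem_hull hg hw
  | algebraMap c => simpa [Module.algebraMap_end_apply] using Submodule.smul_mem _ c hw
  | add P Q _ _ hP hQ => simpa using add_mem (hP hw) (hQ hw)
  | mul P Q _ _ hP hQ => simpa using hP (hQ hw)

/-- The hull of finitely many vectors is what they generate over the algebra generated by `G`. -/
theorem mem_hull_range_iff {ι : Type*} [Fintype ι] (v : ι → V) (x : V) :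
    x ∈ hull G (Set.range v) ↔
      ∃ P : ι → Module.End ℂ V, (∀ k, P k ∈ Algebra.adjoin ℂ G) ∧ x = ∑ k, P k (v k) := by
  classical
  constructor
  · intro hx
    let W : Submodule ℂ V :=
      { carrier := {x | ∃ P : ι → Module.End ℂ V, (∀ k, P k ∈ Algebra.adjoin ℂ G) ∧
          x = ∑ k, P k (v k)}
        zero_mem' := ⟨0, fun k => zero_mem _, by simp⟩
        add_mem' := by
          rintro _ _ ⟨P, hP, rfl⟩ ⟨Q, hQ, rfl⟩
          exact ⟨P + Q, fun k => add_mem (hP k) (hQ k), by simp [Finset.sum_add_distrib]⟩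
        smul_mem' := by
          rintro c _ ⟨P, hP, rfl⟩
          exact ⟨c • P, fun k => Subalgebra.smul_mem _ (hP k) c, by simp [Finset.smul_sum]⟩ }
    refine hull_le (W := W) ?_ ?_ hx
    · rintro _ ⟨k, rfl⟩
      refine ⟨Pi.single k 1, fun l => ?_, ?_⟩
      · by_cases h : l = k
        · subst h
          simp
        · simp [Pi.single_eq_of_ne h]
      · rw [Finset.sum_eq_single k]
        · simp
        · intro l _ h
          simp [Pi.single_eq_of_ne h]
        · simp
    · rintro g hg _ ⟨P, hP, rfl⟩
      exact ⟨fun k => g * P k, fun k => mul_mem (Algebra.subset_adjoin hg) (hP k), by simp⟩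
  · rintro ⟨P, hP, rfl⟩
    exact Submodule.sum_mem _ fun k _ => adjoin_apply_mem_hull (hP k) (subset_hull ⟨k, rfl⟩)

end Hull

/-! ### The Weyl algebra model -/

section CoeffMap

variable {A : Type*} [CommRing A] [Algebra ℂ A] {σ : Type*}

/-- The action of a `ℂ`-linear endomorphism of `A` on the coefficients of polynomials over `A`. -/
noncomputable def coeffMap (σ : Type*) (L : A →ₗ[ℂ] A) :
    MvPolynomial σ A →ₗ[ℂ] MvPolynomial σ A where
  toFun p := AddMonoidAlgebra.map L.toAddMonoidHom p
  map_add' p q := by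
    ext m
    simp [MvPolynomial.coeff, AddMonoidAlgebra.map]
  map_smul' c p := by
    ext m
    simp [MvPolynomial.coeff, AddMonoidAlgebra.map]

@[simp]
theorem coeff_coeffMap (L : A →ₗ[ℂ] A) (p : MvPolynomial σ A) (m : σ →₀ ℕ) :
    MvPolynomial.coeff m (coeffMap σ L p) = L (MvPolynomial.coeff m p) := by
  simp [coeffMap, MvPolynomial.coeff, AddMonoidAlgebra.map]

@[simp]
theorem coeffMap_C (L : A →ₗ[ℂ] A) (a : A) : coeffMap σ L (C a) = C (L a) := by
  classical
  ext m
  simp only [coeff_coeffMap, coeff_C]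
  split_ifs <;> simp

theorem coeffMap_X_mul (L : A →ₗ[ℂ] A) (i : σ) (p : MvPolynomial σ A) :
    coeffMap σ L (X i * p) = X i * coeffMap σ L p := by
  classical
  ext m
  simp only [coeff_coeffMap, coeff_X_mul']
  split_ifs <;> simp

theorem coeffMap_C_mul {L : A →ₗ[ℂ] A} {a b : A} (h : ∀ x, L (a * x) = a * L x + b * x)
    (p : MvPolynomial σ A) :
    coeffMap σ L (C a * p) = C a * coeffMap σ L p + C b * p := by
  ext m
  simp only [coeff_coeffMap, coeff_C_mul, coeff_add, h]

theorem coeffMap_derivation_C_mul (D : Derivation ℂ A A) (a : A) (p : MvPolynomial σ A) :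
    coeffMap σ D.toLinearMap (C a * p) =
      C (D a) * p + C a * coeffMap σ D.toLinearMap p := by
  rw [coeffMap_C_mul (b := D a), add_comm]
  intro x
  simp [mul_comm]

theorem pderiv_coeffMap (L : A →ₗ[ℂ] A) (i : σ) (p : MvPolynomial σ A) :
    pderiv i (coeffMap σ L p) = coeffMap σ L (pderiv i p) := by
  ext m
  have h : ∀ x : A, L ((m i + 1 : ℕ) * x) = (m i + 1 : ℕ) * L x := by
    intro x
    rw [← nsmul_eq_mul, map_nsmul, nsmul_eq_mul]
  simp only [coeff_pderiv, coeff_coeffMap]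
  rw [mul_comm, mul_comm _ ((m i : A) + 1)]
  exact_mod_cast (h _).symm

end CoeffMap

section Weyl

variable {R : Type*} [CommRing R] [Algebra ℂ R] {κ : Type*} (δ : κ → Derivation ℂ R R)
  {ι : Type*} (f : ι → R)

/-- The operator `∂/∂yⱼ + fⱼ` on `R[y]`, that is, `∂/∂yⱼ` acting on `R[y] exp(∑ fⱼ yⱼ)`. -/
noncomputable def tTwist (j : ι) : Module.End ℂ (MvPolynomial ι R) :=
  (pderiv j : Derivation R _ (MvPolynomial ι R)).toLinearMap.restrictScalars ℂ +
    LinearMap.mulLeft ℂ (C (f j))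

theorem tTwist_apply (j : ι) (p : MvPolynomial ι R) :
    tTwist f j p = pderiv j p + C (f j) * p := rfl

theorem tTwist_X_mul [DecidableEq ι] (i j : ι) (p : MvPolynomial ι R) :
    tTwist f j (X i * p) = X i * tTwist f j p + if i = j then p else 0 := by
  simp only [tTwist_apply, pderiv_mul, pderiv_X, Pi.single_apply]
  split_ifs <;> ring

theorem tTwist_C_mul (a : R) (j : ι) (p : MvPolynomial ι R) :
    tTwist f j (C a * p) = C a * tTwist f j p := by
  simp only [tTwist_apply, pderiv_C_mul]
  ring

theorem tTwist_C (a : R) (j : ι) : tTwist f j (C a) = C (f j * a) := by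
  simp [tTwist_apply]

theorem tTwist_comm (j k : ι) (p : MvPolynomial ι R) :
    tTwist f j (tTwist f k p) = tTwist f k (tTwist f j p) := by
  classical
  induction p using MvPolynomial.induction_on with
  | C a => simp only [tTwist_C, mul_left_comm]
  | add p q hp hq => simp only [map_add, hp, hq]
  | mul_X p i hp =>
    rw [mul_comm p]
    simp only [tTwist_X_mul, map_add, hp]
    split_ifs <;> simp [add_comm, add_left_comm]

variable [Fintype ι]

/-- The operator `δᵢ + ∑ⱼ yⱼ δᵢ(fⱼ)` on `R[y]`, that is, the derivation `δᵢ` of the coefficients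
acting on `R[y] exp(∑ fⱼ yⱼ)`. -/
noncomputable def dTwist (i : κ) : Module.End ℂ (MvPolynomial ι R) :=
  coeffMap ι (δ i).toLinearMap + LinearMap.mulLeft ℂ (∑ j, X j * C (δ i (f j)))

theorem dTwist_apply (i : κ) (p : MvPolynomial ι R) :
    dTwist δ f i p = coeffMap ι (δ i).toLinearMap p + (∑ j, X j * C (δ i (f j))) * p := rfl

theorem dTwist_X_mul (i : κ) (j : ι) (p : MvPolynomial ι R) :
    dTwist δ f i (X j * p) = X j * dTwist δ f i p := by
  simp only [dTwist_apply, coeffMap_X_mul]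
  ring

theorem dTwist_C_mul (i : κ) (a : R) (p : MvPolynomial ι R) :
    dTwist δ f i (C a * p) = C (δ i a) * p + C a * dTwist δ f i p := by
  simp only [dTwist_apply, coeffMap_derivation_C_mul]
  ring

theorem dTwist_C (i : κ) (a : R) :
    dTwist δ f i (C a) = C (δ i a) + ∑ j, X j * C (δ i (f j) * a) := by
  simp [dTwist_apply, Finset.sum_mul, mul_assoc]

theorem tTwist_dTwist (i : κ) (j : ι) (p : MvPolynomial ι R) :
    tTwist f j (dTwist δ f i p) = dTwist δ f i (tTwist f j p) := by
  classical
  have h : pderiv j (∑ k, X k * C (δ i (f k)) : MvPolynomial ι R) = C (δ i (f j)) := by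
    simp [pderiv_X, Pi.single_apply]
  simp only [tTwist_apply, dTwist_apply, map_add, pderiv_mul, h, pderiv_coeffMap,
    coeffMap_derivation_C_mul]
  ring

/-- The operators that generate the action of the differential operators of `V`-degree zero on
`R[y] exp(∑ fⱼ yⱼ)`. -/
def weylGens : Set (Module.End ℂ (MvPolynomial ι R)) :=
  Set.range (fun a : R => LinearMap.mulLeft ℂ (C a)) ∪ Set.range (dTwist δ f) ∪
    Set.range fun ij : ι × ι => LinearMap.mulLeft ℂ (X ij.1) * tTwist f ij.2

/-- The Euler operator `∑ⱼ yⱼ ∂/∂yⱼ` acting on `R[y] exp(∑ fⱼ yⱼ)`. -/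
noncomputable def eulerTwist : Module.End ℂ (MvPolynomial ι R) :=
  ∑ j, LinearMap.mulLeft ℂ (X j) * tTwist f j

theorem eulerTwist_apply (p : MvPolynomial ι R) :
    eulerTwist f p = ∑ j, X j * tTwist f j p := by
  simp [eulerTwist]

/-- The functional equation in the Weyl algebra model: `b(∑ yⱼ ∂/∂yⱼ) exp(∑ fⱼ yⱼ)` lies in the
module generated by `a exp(∑ fⱼ yⱼ)`. The factor `exp(∑ fⱼ yⱼ)` is omitted from the elements, so
that it is represented by `1`. -/
def WeylFunctionalEquation (a : Ideal R) (b : Polynomial ℂ) : Prop :=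
  Polynomial.aeval (eulerTwist f) b 1 ∈ hull (weylGens δ f) (C '' (a : Set R))

section
variable {f δ} {S : Set (MvPolynomial ι R)} {p : MvPolynomial ι R}

theorem C_mul_mem_hull (a : R) (hp : p ∈ hull (weylGens δ f) S) :
    C a * p ∈ hull (weylGens δ f) S :=
  apply_mem_hull (g := LinearMap.mulLeft ℂ (C a)) (Or.inl (Or.inl ⟨a, rfl⟩)) hp

theorem dTwist_mem_hull (i : κ) (hp : p ∈ hull (weylGens δ f) S) :
    dTwist δ f i p ∈ hull (weylGens δ f) S :=
  apply_mem_hull (Or.inl (Or.inr ⟨i, rfl⟩)) hp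

theorem X_mul_tTwist_mem_hull (i j : ι) (hp : p ∈ hull (weylGens δ f) S) :
    X i * tTwist f j p ∈ hull (weylGens δ f) S :=
  apply_mem_hull (g := LinearMap.mulLeft ℂ (X i) * tTwist f j) (Or.inr ⟨(i, j), rfl⟩) hp

theorem weyl_hull_le {W : Submodule ℂ (MvPolynomial ι R)} (hS : S ⊆ W)
    (hC : ∀ a, ∀ p ∈ W, C a * p ∈ W) (hD : ∀ i, ∀ p ∈ W, dTwist δ f i p ∈ W)
    (hX : ∀ i j, ∀ p ∈ W, X i * tTwist f j p ∈ W) : hull (weylGens δ f) S ≤ W := by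
  refine hull_le hS ?_
  rintro _ ((⟨a, rfl⟩ | ⟨i, rfl⟩) | ⟨⟨i, j⟩, rfl⟩) w hw
  · exact hC a w hw
  · exact hD i w hw
  · exact hX i j w hw

end

/-- A linear map that intertwines two operators intertwines every polynomial in them. -/
theorem aeval_intertwine {V V' : Type*} [AddCommGroup V] [Module ℂ V] [AddCommGroup V']
    [Module ℂ V'] (T : V →ₗ[ℂ] V') (E : Module.End ℂ V) (E' : Module.End ℂ V')
    (h : ∀ v, T (E v) = E' (T v)) (b : Polynomial ℂ) (v : V) :
    T (Polynomial.aeval E b v) = Polynomial.aeval E' b (T v) := by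
  induction b using Polynomial.induction_on' with
  | add p q hp hq => simp [hp, hq]
  | monomial k c =>
    have : ∀ k : ℕ, T ((E ^ k) v) = (E' ^ k) (T v) := by
      intro k
      induction k with
      | zero => simp
      | succ k ih => rw [pow_succ', pow_succ', Module.End.mul_apply, Module.End.mul_apply, h, ih]
    simp [Polynomial.aeval_monomial, Module.algebraMap_end_apply, this]

end Weyl

/-! ### Independence of the generators -/

section Adjoin

variable {R : Type*} [CommRing R] {ι ι' : Type*} [Fintype ι']

/-- The substitution `yⱼ ↦ yⱼ + ∑ₖ Bₖⱼ Yₖ`. It maps `exp(∑ fⱼ yⱼ)` to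
`exp(∑ fⱼ yⱼ + ∑ gₖ Yₖ)` if `gₖ = ∑ⱼ Bₖⱼ fⱼ`. -/
noncomputable def adjoinSubst (B : ι' → ι → R) :
    MvPolynomial ι R →ₐ[R] MvPolynomial (ι ⊕ ι') R :=
  aeval fun j => X (Sum.inl j) + ∑ k, X (Sum.inr k) * C (B k j)

theorem adjoinSubst_X (B : ι' → ι → R) (j : ι) :
    adjoinSubst B (X j) = X (Sum.inl j) + ∑ k, X (Sum.inr k) * C (B k j) := by
  simp [adjoinSubst]

theorem adjoinSubst_C (B : ι' → ι → R) (a : R) :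
    adjoinSubst B (C a : MvPolynomial ι R) = C a := by
  simp [adjoinSubst, algebraMap_eq]

variable [Algebra ℂ R] {κ : Type*} {f : ι → R} {g : ι' → R} {B : ι' → ι → R}

theorem tTwist_inl_adjoinSubst_X_mul [DecidableEq ι] (i j : ι) (p : MvPolynomial (ι ⊕ ι') R) :
    tTwist (Sum.elim f g) (Sum.inl j) (adjoinSubst B (X i) * p) =
      adjoinSubst B (X i) * tTwist (Sum.elim f g) (Sum.inl j) p + if i = j then p else 0 := by
  classical
  simp only [adjoinSubst_X, add_mul, Finset.sum_mul, mul_assoc, map_add, map_sum, tTwist_X_mul,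
    tTwist_C_mul, reduceCtorEq, if_false, add_zero, Sum.inl.injEq]
  ring

theorem tTwist_inr_adjoinSubst_X_mul (i : ι) (k : ι') (p : MvPolynomial (ι ⊕ ι') R) :
    tTwist (Sum.elim f g) (Sum.inr k) (adjoinSubst B (X i) * p) =
      adjoinSubst B (X i) * tTwist (Sum.elim f g) (Sum.inr k) p + C (B k i) * p := by
  classical
  simp only [adjoinSubst_X, add_mul, Finset.sum_mul, mul_assoc, map_add, map_sum, tTwist_X_mul,
    tTwist_C_mul, reduceCtorEq, if_false, add_zero, Sum.inr.injEq, Finset.sum_add_distrib,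
    Finset.sum_ite_eq', Finset.mem_univ, if_true]
  ring

theorem adjoinSubst_tTwist (j : ι) (p : MvPolynomial ι R) :
    adjoinSubst B (tTwist f j p) = tTwist (Sum.elim f g) (Sum.inl j) (adjoinSubst B p) := by
  classical
  induction p using MvPolynomial.induction_on with
  | C a => simp [tTwist_C]
  | add p q hp hq => simp only [map_add, hp, hq]
  | mul_X p i hp =>
    rw [mul_comm p, tTwist_X_mul, map_mul, tTwist_inl_adjoinSubst_X_mul, map_add, map_mul, hp]
    split_ifs <;> simp

variable [Fintype ι]

theorem dTwist_adjoinSubst_X_mul (δ : κ → Derivation ℂ R R) (i : κ) (j : ι)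
    (p : MvPolynomial (ι ⊕ ι') R) :
    dTwist δ (Sum.elim f g) i (adjoinSubst B (X j) * p) =
      adjoinSubst B (X j) * dTwist δ (Sum.elim f g) i p +
        ∑ k, C (δ i (B k j)) * (X (Sum.inr k) * p) := by
  simp only [adjoinSubst_X, add_mul, Finset.sum_mul, mul_assoc, map_add, map_sum, dTwist_X_mul,
    dTwist_C_mul, Finset.sum_add_distrib, mul_left_comm (X (Sum.inr _))]
  ring

theorem tTwist_inr_adjoinSubst (hB : ∀ k, g k = ∑ j, B k j * f j) (k : ι')
    (p : MvPolynomial ι R) :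
    tTwist (Sum.elim f g) (Sum.inr k) (adjoinSubst B p) =
      ∑ j, C (B k j) * tTwist (Sum.elim f g) (Sum.inl j) (adjoinSubst B p) := by
  classical
  induction p using MvPolynomial.induction_on with
  | C a => simp [tTwist_C, hB, Finset.sum_mul, mul_assoc]
  | add p q hp hq => simp only [map_add, hp, hq, mul_add, Finset.sum_add_distrib]
  | mul_X p i hp =>
    rw [mul_comm p, map_mul, tTwist_inr_adjoinSubst_X_mul, hp]
    simp only [tTwist_inl_adjoinSubst_X_mul, mul_add, Finset.sum_add_distrib, Finset.mul_sum,
      mul_ite, mul_zero, Finset.sum_ite_eq, Finset.mem_univ, if_true]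
    simp only [mul_left_comm]

theorem dTwist_adjoinSubst (δ : κ → Derivation ℂ R R) (hB : ∀ k, g k = ∑ j, B k j * f j) (i : κ)
    (p : MvPolynomial ι R) :
    dTwist δ (Sum.elim f g) i (adjoinSubst B p) = adjoinSubst B (dTwist δ f i p) +
      ∑ k, ∑ j, C (δ i (B k j)) *
        (X (Sum.inr k) * tTwist (Sum.elim f g) (Sum.inl j) (adjoinSubst B p)) := by
  classical
  induction p using MvPolynomial.induction_on with
  | C a =>
    simp only [adjoinSubst_C, tTwist_C, dTwist_C, map_add, map_sum, map_mul, adjoinSubst_X,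
      Fintype.sum_sum_type, Sum.elim_inl, Sum.elim_inr, Finset.sum_add_distrib, hB,
      Derivation.leibniz, smul_eq_mul, Finset.mul_sum, Finset.sum_mul, add_mul, mul_add]
    rw [Finset.sum_comm (γ := ι)]
    simp only [mul_comm, mul_left_comm]
    ring
  | add p q hp hq =>
    simp only [map_add, hp, hq, mul_add, Finset.sum_add_distrib]
    ring
  | mul_X p j hp =>
    rw [mul_comm p, map_mul, dTwist_adjoinSubst_X_mul, hp, dTwist_X_mul, map_mul]
    simp only [tTwist_inl_adjoinSubst_X_mul, mul_add, Finset.sum_add_distrib, Finset.mul_sum,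
      mul_ite, mul_zero, Finset.sum_ite_eq, Finset.mem_univ, if_true]
    simp only [mul_left_comm (adjoinSubst B (X j)), add_assoc]

theorem adjoinSubst_eulerTwist (hB : ∀ k, g k = ∑ j, B k j * f j) (p : MvPolynomial ι R) :
    adjoinSubst B (eulerTwist f p) = eulerTwist (Sum.elim f g) (adjoinSubst B p) := by
  simp only [eulerTwist_apply, map_sum, map_mul, Fintype.sum_sum_type,
    tTwist_inr_adjoinSubst hB, adjoinSubst_tTwist (g := g), adjoinSubst_X, add_mul,
    Finset.sum_add_distrib, Finset.sum_mul, Finset.mul_sum, mul_assoc]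
  rw [Finset.sum_comm (γ := ι)]

/-- A functional equation persists when redundant generators are added. -/
theorem WeylFunctionalEquation.adjoin {δ : κ → Derivation ℂ R R} {a : Ideal R}
    {b : Polynomial ℂ} (hB : ∀ k, g k = ∑ j, B k j * f j)
    (h : WeylFunctionalEquation δ f a b) : WeylFunctionalEquation δ (Sum.elim f g) a b := by
  let τ : MvPolynomial ι R →ₗ[ℂ] MvPolynomial (ι ⊕ ι') R :=
    (adjoinSubst B).toLinearMap.restrictScalars ℂ
  let W := hull (weylGens δ (Sum.elim f g)) (C '' (a : Set R))
  have hle : hull (weylGens δ f) (C '' (a : Set R)) ≤ W.comap τ := by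
    refine weyl_hull_le ?_ ?_ ?_ ?_
    · rintro _ ⟨c, hc, rfl⟩
      change adjoinSubst B (C c) ∈ W
      rw [adjoinSubst_C]
      exact subset_hull ⟨c, hc, rfl⟩
    · intro c p hp
      change adjoinSubst B (C c * p) ∈ W
      rw [map_mul, adjoinSubst_C]
      exact C_mul_mem_hull c hp
    · intro i p hp
      change adjoinSubst B (dTwist δ f i p) ∈ W
      rw [← add_sub_cancel_right (adjoinSubst B (dTwist δ f i p)), ← dTwist_adjoinSubst δ hB]
      exact sub_mem (dTwist_mem_hull i hp) (sum_mem fun k _ => sum_mem fun j _ =>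
        C_mul_mem_hull _ (X_mul_tTwist_mem_hull _ _ hp))
    · intro i j p hp
      change adjoinSubst B (X i * tTwist f j p) ∈ W
      rw [map_mul, adjoinSubst_tTwist (g := g), adjoinSubst_X, add_mul, Finset.sum_mul]
      refine add_mem (X_mul_tTwist_mem_hull _ _ hp) (sum_mem fun k _ => ?_)
      rw [mul_assoc, mul_left_comm]
      exact C_mul_mem_hull _ (X_mul_tTwist_mem_hull _ _ hp)
  have := hle h
  rw [Submodule.mem_comap, aeval_intertwine τ _ (eulerTwist (Sum.elim f g))
    (adjoinSubst_eulerTwist hB)] at this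
  have h1 : τ 1 = 1 := map_one (adjoinSubst B)
  rwa [h1] at this

end Adjoin

section TCoeff

variable {R : Type*} [CommRing R] [Algebra ℂ R] {ι ι' : Type*} {g : ι' → R}

/-- `∂/∂Yₖ + gₖ`, acting on the coefficients of polynomials in the `Zⱼ`. -/
noncomputable abbrev tCoeff (ι : Type*) (g : ι' → R) (k : ι') :
    Module.End ℂ (MvPolynomial ι (MvPolynomial ι' R)) := coeffMap ι (tTwist g k)

theorem tCoeff_C_C_mul (k : ι') (a : R) (q : MvPolynomial ι (MvPolynomial ι' R)) :
    tCoeff ι g k (C (C a) * q) = C (C a) * tCoeff ι g k q := by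
  rw [coeffMap_C_mul (b := 0) (fun x => by simp [tTwist_C_mul])]
  simp

theorem tCoeff_X_mul (k : ι') (j : ι) (q : MvPolynomial ι (MvPolynomial ι' R)) :
    tCoeff ι g k (X j * q) = X j * tCoeff ι g k q := coeffMap_X_mul _ _ _

end TCoeff

section CoeffHull

variable {R : Type*} [CommRing R] [Algebra ℂ R] {κ ι' : Type*} [Fintype ι'] {g : ι' → R}

/-- The spaces `∑ t_{k₁} ⋯ t_{k_d} M`, where `M` is the hull of `S`. -/
noncomputable def hullShift (δ : κ → Derivation ℂ R R) (g : ι' → R) (S : Set (MvPolynomial ι' R)) :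
    ℕ → Submodule ℂ (MvPolynomial ι' R)
  | 0 => hull (weylGens δ g) S
  | d + 1 => ⨆ k, (hullShift δ g S d).map (tTwist g k)

section
variable {δ : κ → Derivation ℂ R R} {S : Set (MvPolynomial ι' R)} {d : ℕ} {p : MvPolynomial ι' R}

theorem tTwist_mem_hullShift (k : ι') (hp : p ∈ hullShift δ g S d) :
    tTwist g k p ∈ hullShift δ g S (d + 1) :=
  Submodule.mem_iSup_of_mem k (Submodule.mem_map_of_mem hp)

theorem hullShift_succ_le {W : Submodule ℂ (MvPolynomial ι' R)}
    (h : ∀ k, ∀ p ∈ hullShift δ g S d, tTwist g k p ∈ W) : hullShift δ g S (d + 1) ≤ W := by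
  refine iSup_le fun k => ?_
  rw [Submodule.map_le_iff_le_comap]
  exact h k

theorem C_mul_mem_hullShift (c : R) (hp : p ∈ hullShift δ g S d) :
    C c * p ∈ hullShift δ g S d := by
  induction d generalizing p with
  | zero => exact C_mul_mem_hull c hp
  | succ d ih =>
    refine hullShift_succ_le (W := (hullShift δ g S (d + 1)).comap (LinearMap.mulLeft ℂ (C c)))
      ?_ hp
    intro k q hq
    rw [Submodule.mem_comap, LinearMap.mulLeft_apply, ← tTwist_C_mul]
    exact tTwist_mem_hullShift k (ih hq)

theorem dTwist_mem_hullShift (i : κ) (hp : p ∈ hullShift δ g S d) :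
    dTwist δ g i p ∈ hullShift δ g S d := by
  induction d generalizing p with
  | zero => exact dTwist_mem_hull i hp
  | succ d ih =>
    refine hullShift_succ_le (W := (hullShift δ g S (d + 1)).comap (dTwist δ g i)) ?_ hp
    intro k q hq
    rw [Submodule.mem_comap, ← tTwist_dTwist]
    exact tTwist_mem_hullShift k (ih hq)

theorem X_mul_tTwist_mem_hullShift (k l : ι') (hp : p ∈ hullShift δ g S d) :
    X k * tTwist g l p ∈ hullShift δ g S d := by
  classical
  induction d generalizing p l with
  | zero => exact X_mul_tTwist_mem_hull k l hp
  | succ d ih =>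
    refine hullShift_succ_le (W := (hullShift δ g S (d + 1)).comap
      (LinearMap.mulLeft ℂ (X k) * tTwist g l)) ?_ hp
    intro m q hq
    have h : X k * tTwist g l (tTwist g m q) =
        tTwist g m (X k * tTwist g l q) - if k = m then tTwist g l q else 0 := by
      rw [tTwist_X_mul, tTwist_comm]
      ring
    change X k * tTwist g l (tTwist g m q) ∈ hullShift δ g S (d + 1)
    rw [h]
    refine sub_mem (tTwist_mem_hullShift m (ih l hq)) ?_
    split_ifs
    · exact tTwist_mem_hullShift l hq
    · exact zero_mem _

theorem X_mul_mem_hullShift (k : ι') (hp : p ∈ hullShift δ g S (d + 1)) :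
    X k * p ∈ hullShift δ g S d := by
  refine hullShift_succ_le (W := (hullShift δ g S d).comap (LinearMap.mulLeft ℂ (X k))) ?_ hp
  intro l q hq
  exact X_mul_tTwist_mem_hullShift k l hq

end

variable (ι : Type*) (g) (δ : κ → Derivation ℂ R R) (S : Set (MvPolynomial ι' R))

/-- The polynomials in `Z` whose coefficients of `Z^α` lie in `hullShift δ g S (|α| + d)`. -/
noncomputable def coeffHull (d : ℕ) : Submodule ℂ (MvPolynomial ι (MvPolynomial ι' R)) where
  carrier := {q | ∀ α, coeff α q ∈ hullShift δ g S (α.degree + d)}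
  zero_mem' α := by simp
  add_mem' hp hq α := by simpa using add_mem (hp α) (hq α)
  smul_mem' c q hq α := by simpa using Submodule.smul_mem _ c (hq α)

variable {ι g δ S} {d : ℕ} {q : MvPolynomial ι (MvPolynomial ι' R)}

theorem C_C_mul_mem_coeffHull (c : R) (hq : q ∈ coeffHull g ι δ S d) :
    C (C c) * q ∈ coeffHull g ι δ S d := by
  intro α
  rw [coeff_C_mul]
  exact C_mul_mem_hullShift c (hq α)

theorem coeffMap_dTwist_mem_coeffHull (i : κ) (hq : q ∈ coeffHull g ι δ S d) :
    coeffMap ι (dTwist δ g i) q ∈ coeffHull g ι δ S d := by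
  intro α
  rw [coeff_coeffMap]
  exact dTwist_mem_hullShift i (hq α)

theorem tCoeff_mem_coeffHull (k : ι') (hq : q ∈ coeffHull g ι δ S d) :
    tCoeff ι g k q ∈ coeffHull g ι δ S (d + 1) := by
  intro α
  rw [coeff_coeffMap]
  exact tTwist_mem_hullShift k (hq α)

theorem pderiv_mem_coeffHull (j : ι) (hq : q ∈ coeffHull g ι δ S d) :
    pderiv j q ∈ coeffHull g ι δ S (d + 1) := by
  intro α
  have h := hq (α + Finsupp.single j 1)
  rw [map_add, Finsupp.degree_single, add_assoc, add_comm 1 d] at h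
  rw [coeff_pderiv, mul_comm]
  have : ((α j : MvPolynomial ι' R) + 1) = C ((α j : R) + 1) := by simp
  rw [this]
  exact C_mul_mem_hullShift _ h

theorem C_X_mul_mem_coeffHull (k : ι') (hq : q ∈ coeffHull g ι δ S (d + 1)) :
    C (X k) * q ∈ coeffHull g ι δ S d := by
  intro α
  rw [coeff_C_mul]
  exact X_mul_mem_hullShift k (hq α)

theorem X_mul_mem_coeffHull (j : ι) (hq : q ∈ coeffHull g ι δ S (d + 1)) :
    X j * q ∈ coeffHull g ι δ S d := by
  classical
  intro α
  rw [coeff_X_mul']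
  split_ifs with h
  · have h1 : Finsupp.single j 1 ≤ α := by
      rw [Finsupp.single_le_iff]
      exact Nat.one_le_iff_ne_zero.2 (Finsupp.mem_support_iff.1 h)
    have h2 := hq (α - Finsupp.single j 1)
    have h3 : (α - Finsupp.single j 1).degree + 1 = α.degree := by
      conv_rhs => rw [← tsub_add_cancel_of_le h1, map_add, Finsupp.degree_single]
    rwa [add_comm d 1, ← add_assoc, h3] at h2
  · exact zero_mem _

end CoeffHull

section Remove

variable {R : Type*} [CommRing R] {ι ι' : Type*} [Fintype ι]

/-- The substitution `yⱼ ↦ Zⱼ`, `Yₖ ↦ Yₖ - ∑ⱼ Aⱼₖ Zⱼ`, where the `Zⱼ` are the outer variables. It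
maps `exp(∑ fⱼ yⱼ + ∑ gₖ Yₖ)` to `exp(∑ gₖ Yₖ)` if `fⱼ = ∑ₖ Aⱼₖ gₖ`. -/
noncomputable def removeSubst (A : ι → ι' → R) :
    MvPolynomial (ι ⊕ ι') R →ₐ[R] MvPolynomial ι (MvPolynomial ι' R) :=
  aeval (Sum.elim X fun k => C (X k) - ∑ j, C (C (A j k)) * X j)

theorem removeSubst_X_inl (A : ι → ι' → R) (j : ι) :
    removeSubst A (X (Sum.inl j)) = X j := by
  simp [removeSubst]

theorem removeSubst_X_inr (A : ι → ι' → R) (k : ι') :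
    removeSubst A (X (Sum.inr k)) = C (X k) - ∑ j, C (C (A j k)) * X j := by
  simp [removeSubst]

theorem removeSubst_C (A : ι → ι' → R) (a : R) :
    removeSubst A (C a) = C (C a) := by
  simp [removeSubst, algebraMap_eq]

theorem pderiv_removeSubst_X_inr (A : ι → ι' → R) (j : ι) (l : ι') :
    pderiv j (removeSubst A (X (Sum.inr l))) = -C (C (A j l)) := by
  classical
  simp [removeSubst_X_inr, pderiv_X, Pi.single_apply]

variable [Algebra ℂ R] {κ : Type*} {f : ι → R} {g : ι' → R} {A : ι → ι' → R}

theorem tCoeff_removeSubst_X_inr_mul [DecidableEq ι'] (k l : ι')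
    (q : MvPolynomial ι (MvPolynomial ι' R)) :
    tCoeff ι g k (removeSubst A (X (Sum.inr l)) * q) =
      removeSubst A (X (Sum.inr l)) * tCoeff ι g k q + if l = k then q else 0 := by
  simp only [removeSubst_X_inr, sub_mul, Finset.sum_mul, mul_assoc, map_sub, map_sum,
    tCoeff_C_C_mul, tCoeff_X_mul]
  rw [coeffMap_C_mul (a := X l) (b := if l = k then 1 else 0)
    (fun x => by rw [tTwist_X_mul]; split_ifs <;> simp)]
  split_ifs <;> simp
  ring

theorem removeSubst_tTwist_inr (k : ι') (p : MvPolynomial (ι ⊕ ι') R) :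
    removeSubst A (tTwist (Sum.elim f g) (Sum.inr k) p) = tCoeff ι g k (removeSubst A p) := by
  classical
  induction p using MvPolynomial.induction_on with
  | C a => simp only [tTwist_C, removeSubst_C, coeffMap_C, Sum.elim_inr]
  | add p q hp hq => simp only [map_add, hp, hq]
  | mul_X p i hp =>
    rw [mul_comm p, tTwist_X_mul, map_mul, map_add, map_mul, hp]
    rcases i with i | i
    · simp only [removeSubst_X_inl, tCoeff_X_mul, reduceCtorEq, if_false, map_zero, add_zero]
    · simp only [tCoeff_removeSubst_X_inr_mul, Sum.inr.injEq]
      split_ifs <;> simp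

variable [Fintype ι']

theorem removeSubst_tTwist_inl (hA : ∀ j, f j = ∑ k, A j k * g k) (j : ι)
    (p : MvPolynomial (ι ⊕ ι') R) :
    removeSubst A (tTwist (Sum.elim f g) (Sum.inl j) p) =
      pderiv j (removeSubst A p) + ∑ k, C (C (A j k)) * tCoeff ι g k (removeSubst A p) := by
  classical
  induction p using MvPolynomial.induction_on with
  | C a =>
    simp only [tTwist_C, removeSubst_C, coeffMap_C, Sum.elim_inl, hA, Finset.sum_mul, map_sum,
      map_mul, pderiv_C, zero_add, mul_assoc]
  | add p q hp hq =>
    simp only [map_add, hp, hq, mul_add, Finset.sum_add_distrib]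
    ring
  | mul_X p i hp =>
    rw [mul_comm p, tTwist_X_mul, map_mul, map_add, map_mul, hp, pderiv_mul]
    rcases i with i | i
    · simp only [removeSubst_X_inl, tCoeff_X_mul, Sum.inl.injEq, mul_left_comm _ (X i),
        ← Finset.mul_sum, pderiv_X, Pi.single_apply]
      split_ifs <;> simp <;> ring
    · simp only [tCoeff_removeSubst_X_inr_mul, pderiv_removeSubst_X_inr, reduceCtorEq, if_false,
        map_zero, mul_add, mul_ite, mul_zero, Finset.sum_add_distrib, Finset.sum_ite_eq,
        Finset.mem_univ, if_true, mul_left_comm _ (removeSubst A _), ← Finset.mul_sum]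
      ring

theorem removeSubst_dTwist (δ : κ → Derivation ℂ R R) (hA : ∀ j, f j = ∑ k, A j k * g k) (i : κ)
    (p : MvPolynomial (ι ⊕ ι') R) :
    removeSubst A (dTwist δ (Sum.elim f g) i p) = coeffMap ι (dTwist δ g i) (removeSubst A p) +
      ∑ j, ∑ k, C (C (δ i (A j k))) * (X j * tCoeff ι g k (removeSubst A p)) := by
  classical
  induction p using MvPolynomial.induction_on with
  | C a =>
    simp only [dTwist_C, removeSubst_C, coeffMap_C, Fintype.sum_sum_type, map_add, map_sum,
      map_mul, removeSubst_X_inl, removeSubst_X_inr, Sum.elim_inl, Sum.elim_inr, hA, tTwist_C,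
      Derivation.leibniz, smul_eq_mul, sub_mul, Finset.sum_sub_distrib, Finset.sum_mul,
      Finset.mul_sum, add_mul, mul_add, Finset.sum_add_distrib]
    rw [Finset.sum_comm (γ := ι')]
    simp only [mul_comm, mul_left_comm]
    ring
  | add p q hp hq =>
    simp only [map_add, hp, hq, mul_add, Finset.sum_add_distrib]
    ring
  | mul_X p l hp =>
    rw [mul_comm p, dTwist_X_mul, map_mul, map_mul, hp]
    rcases l with l | l
    · simp only [removeSubst_X_inl, coeffMap_X_mul, mul_add, Finset.mul_sum,
        mul_left_comm (X l)]
    · have h : ∀ q, coeffMap ι (dTwist δ g i) (removeSubst A (X (Sum.inr l)) * q) =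
          removeSubst A (X (Sum.inr l)) * coeffMap ι (dTwist δ g i) q -
            ∑ j, C (C (δ i (A j l))) * (X j * q) := by
        intro q
        have hC : ∀ (a : R) (q : MvPolynomial ι (MvPolynomial ι' R)),
            coeffMap ι (dTwist δ g i) (C (C a) * q) =
              C (C a) * coeffMap ι (dTwist δ g i) q + C (C (δ i a)) * q := fun a =>
          coeffMap_C_mul (fun x => by rw [dTwist_C_mul, add_comm])
        have hX : coeffMap ι (dTwist δ g i) (C (X l) * q) =
            C (X l) * coeffMap ι (dTwist δ g i) q := by
          rw [coeffMap_C_mul (b := 0) fun x => by rw [dTwist_X_mul]; simp]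
          simp
        simp only [removeSubst_X_inr, sub_mul, Finset.sum_mul, mul_assoc, map_sub, map_sum, hX,
          hC, coeffMap_X_mul, Finset.sum_add_distrib]
        ring
      simp only [h, tCoeff_removeSubst_X_inr_mul, mul_add, mul_ite, mul_zero,
        Finset.sum_add_distrib, Finset.sum_ite_eq, Finset.mem_univ, if_true, Finset.mul_sum,
        mul_left_comm (removeSubst A _)]
      ring

variable {δ : κ → Derivation ℂ R R} {S : Set (MvPolynomial ι' R)} {d : ℕ}
  {q : MvPolynomial ι (MvPolynomial ι' R)}

theorem removeSubst_X_mul_mem_coeffHull (i : ι ⊕ ι') (hq : q ∈ coeffHull g ι δ S (d + 1)) :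
    removeSubst A (X i) * q ∈ coeffHull g ι δ S d := by
  rcases i with i | i
  · rw [removeSubst_X_inl]
    exact X_mul_mem_coeffHull i hq
  · rw [removeSubst_X_inr, sub_mul, Finset.sum_mul]
    refine sub_mem (C_X_mul_mem_coeffHull i hq) (sum_mem fun j _ => ?_)
    rw [mul_assoc]
    exact C_C_mul_mem_coeffHull _ (X_mul_mem_coeffHull j hq)

theorem removeSubst_tTwist_mem_coeffHull (hA : ∀ j, f j = ∑ k, A j k * g k) (i : ι ⊕ ι')
    {p : MvPolynomial (ι ⊕ ι') R} (hp : removeSubst A p ∈ coeffHull g ι δ S d) :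
    removeSubst A (tTwist (Sum.elim f g) i p) ∈ coeffHull g ι δ S (d + 1) := by
  rcases i with i | i
  · rw [removeSubst_tTwist_inl hA]
    exact add_mem (pderiv_mem_coeffHull i hp) (sum_mem fun k _ =>
      C_C_mul_mem_coeffHull _ (tCoeff_mem_coeffHull k hp))
  · rw [removeSubst_tTwist_inr]
    exact tCoeff_mem_coeffHull i hp

theorem coeff_zero_removeSubst_eulerTwist (p : MvPolynomial (ι ⊕ ι') R) :
    coeff 0 (removeSubst A (eulerTwist (Sum.elim f g) p)) =
      eulerTwist g (coeff 0 (removeSubst A p)) := by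
  classical
  simp only [eulerTwist_apply, Fintype.sum_sum_type, map_add, map_sum, map_mul, coeff_add,
    coeff_sum, removeSubst_X_inl, removeSubst_X_inr, coeff_X_mul', sub_mul, coeff_sub, coeff_C_mul,
    Finset.sum_mul, mul_assoc, Finsupp.support_zero, Finset.notMem_empty, if_false,
    Finset.sum_const_zero, zero_add, sub_zero, mul_zero, removeSubst_tTwist_inr, coeff_coeffMap]

/-- Redundant generators can be removed from a functional equation: after the substitution
`removeSubst`, this is the comparison of the terms of degree zero in `Z`. The terms of higher degree
stay in `coeffHull`, because a factor `Z` is always accompanied by an operator `∂/∂Yₖ + gₖ`. -/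
theorem WeylFunctionalEquation.remove {a : Ideal R} {b : Polynomial ℂ}
    (hA : ∀ j, f j = ∑ k, A j k * g k)
    (h : WeylFunctionalEquation δ (Sum.elim f g) a b) : WeylFunctionalEquation δ g a b := by
  let ρ : MvPolynomial (ι ⊕ ι') R →ₗ[ℂ] MvPolynomial ι (MvPolynomial ι' R) :=
    (removeSubst A).toLinearMap.restrictScalars ℂ
  let W := coeffHull g ι δ (C '' (a : Set R)) 0
  have hle : hull (weylGens δ (Sum.elim f g)) (C '' (a : Set R)) ≤ W.comap ρ := by
    refine weyl_hull_le ?_ ?_ ?_ ?_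
    · rintro _ ⟨c, hc, rfl⟩
      change removeSubst A (C c) ∈ W
      rw [removeSubst_C]
      intro α
      classical
      rw [coeff_C]
      split_ifs with h0
      · subst h0
        exact subset_hull (S := C '' (a : Set R)) ⟨c, hc, rfl⟩
      · exact zero_mem _
    · intro c p hp
      change removeSubst A (C c * p) ∈ W
      rw [map_mul, removeSubst_C]
      exact C_C_mul_mem_coeffHull c hp
    · intro i p hp
      change removeSubst A (dTwist δ (Sum.elim f g) i p) ∈ W
      rw [removeSubst_dTwist δ hA]
      exact add_mem (coeffMap_dTwist_mem_coeffHull i hp) (sum_mem fun j _ => sum_mem fun k _ =>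
        C_C_mul_mem_coeffHull _ (X_mul_mem_coeffHull j (tCoeff_mem_coeffHull k hp)))
    · intro i j p hp
      change removeSubst A (X i * tTwist (Sum.elim f g) j p) ∈ W
      rw [map_mul]
      exact removeSubst_X_mul_mem_coeffHull i (removeSubst_tTwist_mem_coeffHull hA j hp)
  have h0 := hle h 0
  let c : MvPolynomial (ι ⊕ ι') R →ₗ[ℂ] MvPolynomial ι' R :=
    (lcoeff (R := MvPolynomial ι' R) 0).restrictScalars ℂ ∘ₗ ρ
  have h1 := aeval_intertwine c (eulerTwist (Sum.elim f g)) (eulerTwist g)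
    coeff_zero_removeSubst_eulerTwist b 1
  have h2 : c 1 = 1 := by
    change coeff 0 (removeSubst A 1) = 1
    simp
  rw [h2] at h1
  change Polynomial.aeval (eulerTwist g) b 1 ∈ _
  rw [← h1]
  exact h0

end Remove

/-- The functional equation depends only on the ideal, and not on its generators. -/
theorem WeylFunctionalEquation.of_span_eq {R : Type*} [CommRing R] [Algebra ℂ R] {κ : Type*}
    {δ : κ → Derivation ℂ R R} {ι ι' : Type*} [Fintype ι] [Fintype ι'] {f : ι → R} {g : ι' → R}
    (hfg : Ideal.span (Set.range f) = Ideal.span (Set.range g)) {a : Ideal R} {b : Polynomial ℂ}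
    (h : WeylFunctionalEquation δ f a b) : WeylFunctionalEquation δ g a b := by
  have hA : ∀ j, ∃ A : ι' → R, f j = ∑ k, A k * g k := fun j => by
    have : f j ∈ Ideal.span (Set.range g) := hfg ▸ Ideal.subset_span ⟨j, rfl⟩
    obtain ⟨A, hA⟩ := Ideal.mem_span_range_iff_exists_fun.1 this
    exact ⟨A, hA.symm⟩
  have hB : ∀ k, ∃ B : ι → R, g k = ∑ j, B j * f j := fun k => by
    have : g k ∈ Ideal.span (Set.range f) := hfg ▸ Ideal.subset_span ⟨k, rfl⟩
    obtain ⟨B, hB⟩ := Ideal.mem_span_range_iff_exists_fun.1 this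
    exact ⟨B, hB.symm⟩
  choose A hA using hA
  choose B hB using hB
  exact (h.adjoin hB).remove hA

/-! ### From the localized module to the Weyl algebra model -/

section Bridge

variable {n r : ℕ} (f : Fin r → MvPolynomial (Fin n) ℂ)

section Operators

variable {f}

theorem shift_C (j : Fin r) (c : ℤ) (a : Loc f) : shift f j c (C a) = C a := by
  simp [shift, algebraMap_eq]

theorem shift_X (i j : Fin r) (c : ℤ) :
    shift f j c (X i) = X i + if i = j then (c : Coeffs f) else 0 := by
  simp only [shift, aeval_X]
  split_ifs <;> simp

theorem shift_comm (i j : Fin r) (c d : ℤ) (g : Coeffs f) :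
    shift f i c (shift f j d g) = shift f j d (shift f i c g) := by
  have e : (shift f i c).comp (shift f j d) = (shift f j d).comp (shift f i c) := by
    ext k
    simp only [AlgHom.comp_apply, shift_X, map_add, apply_ite (shift f _ _), map_intCast,
      map_zero]
    exact add_right_comm _ _ _
  exact congrArg (fun φ : Coeffs f →ₐ[Loc f] Coeffs f => φ g) e

theorem tOp_apply (j : Fin r) (g : Coeffs f) :
    tOp f j g = C (genUnit f j : Loc f) * shift f j 1 g := rfl

theorem tInvOp_apply (j : Fin r) (g : Coeffs f) :
    tInvOp f j g = C (((genUnit f j)⁻¹ : (Loc f)ˣ) : Loc f) * shift f j (-1) g := rfl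

theorem tOp_tInvOp (i j : Fin r) (g : Coeffs f) :
    tOp f i (tInvOp f j g) = tInvOp f j (tOp f i g) := by
  simp only [tOp_apply, tInvOp_apply, map_mul, shift_C]
  rw [shift_comm]
  ring

theorem tInvOp_tOp_self (j : Fin r) (g : Coeffs f) : tInvOp f j (tOp f j g) = g :=
  LinearMap.congr_fun (tInvOp_mul_tOp f j) g

theorem tOp_X_mul (i j : Fin r) (g : Coeffs f) :
    tOp f j (X i * g) = X i * tOp f j g + if i = j then tOp f j g else 0 := by
  simp only [tOp_apply, map_mul, shift_X]
  split_ifs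
  · push_cast
    ring
  · ring

theorem dOp_apply (i : Fin n) (g : Coeffs f) :
    dOp f i g = coeffMap (Fin r) (locDeriv (pderiv i) (∏ j, f j)).toLinearMap g +
      (∑ j, X j * C (algebraMap (MvPolynomial (Fin n) ℂ) (Loc f) (pderiv i (f j)) *
        ((genUnit f j)⁻¹ : (Loc f)ˣ))) * g := rfl

theorem dOp_X_mul (i : Fin n) (j : Fin r) (g : Coeffs f) :
    dOp f i (X j * g) = X j * dOp f i g := by
  simp only [dOp_apply, coeffMap_X_mul]
  ring

theorem dOp_C_mul (i : Fin n) (a : Loc f) (g : Coeffs f) :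
    dOp f i (C a * g) = C (locDeriv (pderiv i) (∏ j, f j) a) * g + C a * dOp f i g := by
  simp only [dOp_apply, coeffMap_derivation_C_mul]
  ring

theorem coeffMap_shift (D : Derivation ℂ (Loc f) (Loc f)) (j : Fin r) (c : ℤ) (g : Coeffs f) :
    coeffMap (Fin r) D.toLinearMap (shift f j c g) =
      shift f j c (coeffMap (Fin r) D.toLinearMap g) := by
  induction g using MvPolynomial.induction_on with
  | C a => simp only [shift_C, coeffMap_C]
  | add p q hp hq => simp only [map_add, hp, hq]
  | mul_X p i hp =>
    have hc : ∀ q : Coeffs f, coeffMap (Fin r) D.toLinearMap ((c : Coeffs f) * q) =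
        (c : Coeffs f) * coeffMap (Fin r) D.toLinearMap q := by
      intro q
      have : (c : Coeffs f) = C (c : Loc f) := by simp
      rw [this, coeffMap_derivation_C_mul]
      simp
    rw [mul_comm p]
    simp only [map_mul, shift_X, add_mul, map_add, coeffMap_X_mul, hp]
    split_ifs
    · rw [hc, hp]
    · simp

theorem genUnit_val (j : Fin r) :
    (genUnit f j : Loc f) = algebraMap (MvPolynomial (Fin n) ℂ) (Loc f) (f j) := rfl

theorem dOp_tInvOp (i : Fin n) (j : Fin r) (g : Coeffs f) :
    dOp f i (tInvOp f j g) = tInvOp f j (dOp f i g) := by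
  set D := locDeriv (pderiv i) (∏ j, f j)
  set u := genUnit f j with hu
  have hD : D ((u⁻¹ : (Loc f)ˣ) : Loc f) = -(((u⁻¹ : (Loc f)ˣ) : Loc f) *
      (algebraMap (MvPolynomial (Fin n) ℂ) (Loc f) (pderiv i (f j)) *
        ((u⁻¹ : (Loc f)ˣ) : Loc f))) := by
    have h := D.leibniz_of_mul_eq_one (Units.inv_mul u)
    rw [h, hu, genUnit_val, locDeriv_algebraMap, smul_eq_mul]
    ring
  have hs : shift f j (-1) (∑ k, X k * C (algebraMap (MvPolynomial (Fin n) ℂ) (Loc f)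
      (pderiv i (f k)) * ((genUnit f k)⁻¹ : (Loc f)ˣ))) =
      (∑ k, X k * C (algebraMap (MvPolynomial (Fin n) ℂ) (Loc f)
        (pderiv i (f k)) * ((genUnit f k)⁻¹ : (Loc f)ˣ))) -
        C (algebraMap (MvPolynomial (Fin n) ℂ) (Loc f) (pderiv i (f j)) * ((u⁻¹ : (Loc f)ˣ))) := by
    simp only [map_sum, map_mul (shift f j (-1)), shift_X, shift_C, add_mul,
      Finset.sum_add_distrib, ite_mul, zero_mul, Finset.sum_ite_eq', Finset.mem_univ, if_true]
    push_cast
    ring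
  simp only [tInvOp_apply]
  rw [dOp_C_mul, hD, dOp_apply, dOp_apply, map_add, map_mul, hs, coeffMap_shift]
  simp only [map_neg, map_mul]
  ring

end Operators

/-- The image of `y_jᵏ`: `s_j (s_j - 1) ⋯ (s_j - k + 1) f_j^{-k}`. -/
noncomputable def toCoeffsFactor (j : Fin r) (k : ℕ) : Coeffs f :=
  C (((genUnit f j)⁻¹ : (Loc f)ˣ) : Loc f) ^ k * ∏ l ∈ Finset.range k, (X j - (l : Coeffs f))

/-- The map from the Weyl algebra model to `ℂ[x][∏ fᵢ⁻¹, s₁, …, s_r] ∏ fᵢ^{sᵢ}` that turns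
`yⱼ` into `sⱼ tⱼ⁻¹` and `∂/∂yⱼ + fⱼ` into `tⱼ`. -/
noncomputable def toCoeffs :
    MvPolynomial (Fin r) (MvPolynomial (Fin n) ℂ) →ₗ[MvPolynomial (Fin n) ℂ] Coeffs f :=
  (basisMonomials (Fin r) (MvPolynomial (Fin n) ℂ)).constr (MvPolynomial (Fin n) ℂ)
    fun ν => ∏ j, toCoeffsFactor f j (ν j)

variable {f}

theorem toCoeffs_monomial (ν : Fin r →₀ ℕ) (h : MvPolynomial (Fin n) ℂ) :
    toCoeffs f (monomial ν h) = C (algebraMap _ (Loc f) h) * ∏ j, toCoeffsFactor f j (ν j) := by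
  have h1 : (monomial ν h : MvPolynomial (Fin r) (MvPolynomial (Fin n) ℂ)) =
      h • basisMonomials (Fin r) (MvPolynomial (Fin n) ℂ) ν := by
    simp [smul_monomial]
  rw [h1, map_smul, toCoeffs, Module.Basis.constr_basis, Algebra.smul_def]
  rfl

theorem toCoeffs_C (h : MvPolynomial (Fin n) ℂ) :
    toCoeffs f (C h) = C (algebraMap _ (Loc f) h) := by
  rw [C_apply, toCoeffs_monomial]
  simp [toCoeffsFactor]

theorem toCoeffs_C_mul (h : MvPolynomial (Fin n) ℂ)
    (p : MvPolynomial (Fin r) (MvPolynomial (Fin n) ℂ)) :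
    toCoeffs f (C h * p) = C (algebraMap _ (Loc f) h) * toCoeffs f p := by
  rw [← smul_eq_C_mul, map_smul, Algebra.smul_def]
  rfl

theorem toCoeffs_X_mul (i : Fin r) (p : MvPolynomial (Fin r) (MvPolynomial (Fin n) ℂ)) :
    toCoeffs f (X i * p) = X i * tInvOp f i (toCoeffs f p) := by
  induction p using MvPolynomial.induction_on' with
  | add p q hp hq => simp only [mul_add, map_add, hp, hq]
  | monomial ν h =>
    have h1 : (X i * monomial ν h : MvPolynomial (Fin r) (MvPolynomial (Fin n) ℂ)) =
        monomial (Finsupp.single i 1 + ν) h := by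
      rw [X, monomial_mul, one_mul]
    have h2 : ∀ k, X i * (C (((genUnit f i)⁻¹ : (Loc f)ˣ) : Loc f) *
        shift f i (-1) (toCoeffsFactor f i k)) = toCoeffsFactor f i (1 + k) := by
      intro k
      simp only [toCoeffsFactor, map_mul, map_pow, map_prod, shift_C, map_sub, shift_X, if_true,
        map_natCast]
      rw [add_comm 1 k, Finset.prod_range_succ', pow_succ]
      push_cast
      have h3 : ∀ l ∈ Finset.range k, (X i + -1 - (l : Coeffs f)) = X i - ((l : Coeffs f) + 1) :=
        fun l _ => by ring
      rw [Finset.prod_congr rfl h3]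
      ring
    have h4 : ∀ j ∈ Finset.univ.erase i, shift f i (-1) (toCoeffsFactor f j (ν j)) =
        toCoeffsFactor f j ((Finsupp.single i 1 + ν : Fin r →₀ ℕ) j) := by
      intro j hj
      have hj' : j ≠ i := Finset.ne_of_mem_erase hj
      simp [toCoeffsFactor, shift_X, hj']
    have h5 : (Finsupp.single i 1 + ν : Fin r →₀ ℕ) i = 1 + ν i := by simp
    have h6 := Finset.mul_prod_erase Finset.univ
      (fun j => toCoeffsFactor f j ((Finsupp.single i 1 + ν : Fin r →₀ ℕ) j)) (Finset.mem_univ i)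
    have h7 := Finset.mul_prod_erase Finset.univ
      (fun j => shift f i (-1) (toCoeffsFactor f j (ν j))) (Finset.mem_univ i)
    rw [h1, toCoeffs_monomial, toCoeffs_monomial, tInvOp_apply, map_mul, shift_C, map_prod,
      ← h6, ← h7, Finset.prod_congr rfl h4, h5, ← h2]
    ring

theorem toCoeffs_tTwist (j : Fin r) (p : MvPolynomial (Fin r) (MvPolynomial (Fin n) ℂ)) :
    toCoeffs f (tTwist f j p) = tOp f j (toCoeffs f p) := by
  induction p using MvPolynomial.induction_on with
  | C a => rw [tTwist_C, toCoeffs_C, toCoeffs_C, tOp_apply, shift_C, genUnit_val, map_mul, C_mul]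
  | add p q hp hq => simp only [map_add, hp, hq]
  | mul_X p i hp =>
    rw [mul_comm p, tTwist_X_mul, map_add, toCoeffs_X_mul, toCoeffs_X_mul, hp, tOp_X_mul,
      tOp_tInvOp]
    by_cases h : i = j
    · subst h
      simp [tInvOp_tOp_self]
    · simp [h]

theorem toCoeffs_dTwist (i : Fin n) (p : MvPolynomial (Fin r) (MvPolynomial (Fin n) ℂ)) :
    toCoeffs f (dTwist pderiv f i p) = dOp f i (toCoeffs f p) := by
  induction p using MvPolynomial.induction_on with
  | C a =>
    rw [dTwist_C, map_add, map_sum, toCoeffs_C, toCoeffs_C, dOp_apply, coeffMap_C,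
      Derivation.coeFn_coe, locDeriv_algebraMap, Finset.sum_mul]
    congr 1
    refine Finset.sum_congr rfl fun j _ => ?_
    rw [toCoeffs_X_mul, toCoeffs_C, tInvOp_apply, shift_C]
    simp only [map_mul]
    ring
  | add p q hp hq => simp only [map_add, hp, hq]
  | mul_X p j hp =>
    rw [mul_comm p, dTwist_X_mul, toCoeffs_X_mul, toCoeffs_X_mul, hp, dOp_X_mul, dOp_tInvOp]

theorem toCoeffs_eulerTwist (p : MvPolynomial (Fin r) (MvPolynomial (Fin n) ℂ)) :
    toCoeffs f (eulerTwist f p) = (∑ j, X j) * toCoeffs f p := by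
  simp only [eulerTwist_apply, map_sum, toCoeffs_X_mul, toCoeffs_tTwist, tInvOp_tOp_self,
    Finset.sum_mul]

/-- Evaluation of `toCoeffs f p` at `s = ν`, for `ν` of minimal degree in the support of `p`,
leaves only the term of `p` at `ν`. -/
theorem toCoeffs_injective (hf : ∀ j, f j ≠ 0) : Function.Injective (toCoeffs f) := by
  rw [injective_iff_map_eq_zero]
  intro p hp
  by_contra hne
  have hprod : ∏ j, f j ≠ 0 := Finset.prod_ne_zero_iff.2 fun j _ => hf j
  have hle : Submonoid.powers (∏ j, f j) ≤ nonZeroDivisors (MvPolynomial (Fin n) ℂ) :=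
    powers_le_nonZeroDivisors_of_noZeroDivisors hprod
  have : IsDomain (Loc f) := IsLocalization.isDomain_localization hle
  have hinj : Function.Injective (algebraMap (MvPolynomial (Fin n) ℂ) (Loc f)) :=
    IsLocalization.injective _ hle
  have : CharZero (Loc f) := charZero_of_injective_algebraMap hinj
  obtain ⟨ν, hν, hmin⟩ := Finset.exists_min_image p.support Finsupp.degree
    (Finset.nonempty_iff_ne_empty.2 (by simpa using hne))
  let ev : Coeffs f →+* Loc f := eval fun j => (ν j : Loc f)
  have hev : ∀ j k, ev (toCoeffsFactor f j k) = (((genUnit f j)⁻¹ : (Loc f)ˣ) : Loc f) ^ k *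
      ∏ l ∈ Finset.range k, ((ν j : Loc f) - l) := by
    intro j k
    simp [ev, toCoeffsFactor, map_prod]
  have h0 : ev (toCoeffs f p) = algebraMap _ (Loc f) (coeff ν p) *
      ∏ j, ev (toCoeffsFactor f j (ν j)) := by
    conv_lhs => rw [p.as_sum]
    rw [map_sum, map_sum, Finset.sum_eq_single ν]
    · rw [toCoeffs_monomial, map_mul, map_prod]
      simp [ev]
    · intro μ hμ hμν
      obtain ⟨j, hj⟩ : ∃ j, ν j < μ j := by
        by_contra! hle
        apply hμν
        have h1 : μ ≤ ν := hle
        have h2 := hmin μ hμ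
        have h3 : ν - μ + μ = ν := tsub_add_cancel_of_le h1
        have h4 : (ν - μ).degree + μ.degree = ν.degree := by rw [← map_add, h3]
        have h5 : (ν - μ).degree = 0 := by omega
        rw [Finsupp.degree_eq_zero_iff] at h5
        rw [← h3, h5, zero_add]
      have h6 : ev (toCoeffsFactor f j (μ j)) = 0 := by
        rw [hev, Finset.prod_eq_zero (Finset.mem_range.2 hj) (sub_self _), mul_zero]
      have h7 : ∏ j, ev (toCoeffsFactor f j (μ j)) = 0 :=
        Finset.prod_eq_zero (Finset.mem_univ j) h6
      rw [toCoeffs_monomial, map_mul, map_prod, h7, mul_zero]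
    · intro h
      exact absurd hν h
  rw [hp, map_zero] at h0
  have h1 : coeff ν p ≠ 0 := by simpa using hν
  have h2 : algebraMap _ (Loc f) (coeff ν p) ≠ 0 := fun h => h1 (hinj (by rw [h, map_zero]))
  refine mul_ne_zero h2 (Finset.prod_ne_zero_iff.2 fun j _ => ?_) h0.symm
  rw [hev]
  refine mul_ne_zero (pow_ne_zero _ (Units.ne_zero _)) (Finset.prod_ne_zero_iff.2 fun l hl => ?_)
  rw [sub_ne_zero]
  exact_mod_cast (Finset.mem_range.1 hl).ne'

variable (f) in
/-- The operators that generate the ring in the functional equation. -/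
def opGens : Set (Module.End ℂ (Coeffs f)) :=
  Set.range (xOp f) ∪ Set.range (dOp f) ∪ Set.range fun ij : Fin r × Fin r => sOp f ij.1 ij.2

theorem satisfiesFunctionalEquation_iff (b : Polynomial ℂ) :
    SatisfiesFunctionalEquation f b ↔ Polynomial.aeval (∑ j, (X j : Coeffs f)) b ∈
      hull (opGens f) (Set.range fun k => tOp f k 1) :=
  (mem_hull_range_iff _ _).symm

section
variable {S : Set (Coeffs f)} {p : Coeffs f}

theorem C_mul_mem_opHull (a : MvPolynomial (Fin n) ℂ) (hp : p ∈ hull (opGens f) S) :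
    C (algebraMap _ (Loc f) a) * p ∈ hull (opGens f) S := by
  induction a using MvPolynomial.induction_on generalizing p with
  | C z =>
    have h : C (algebraMap _ (Loc f) (C z : MvPolynomial (Fin n) ℂ)) * p = z • p := by
      rw [Algebra.smul_def]
      congr 1
    rw [h]
    exact Submodule.smul_mem _ z hp
  | add a b ha hb =>
    rw [map_add, C_add, add_mul]
    exact add_mem (ha hp) (hb hp)
  | mul_X a i ha =>
    rw [map_mul, C_mul, mul_assoc]
    exact ha (apply_mem_hull (g := xOp f i) (Or.inl (Or.inl ⟨i, rfl⟩)) hp)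

theorem dOp_mem_opHull (i : Fin n) (hp : p ∈ hull (opGens f) S) :
    dOp f i p ∈ hull (opGens f) S :=
  apply_mem_hull (Or.inl (Or.inr ⟨i, rfl⟩)) hp

theorem sOp_mem_opHull (i j : Fin r) (hp : p ∈ hull (opGens f) S) :
    X i * tInvOp f i (tOp f j p) ∈ hull (opGens f) S :=
  apply_mem_hull (g := sOp f i j) (Or.inr ⟨(i, j), rfl⟩) hp

end

/-- The modules generated by the `tₖ ∏ fᵢ^{sᵢ}` and by `a exp(∑ fⱼ yⱼ)` correspond. -/
theorem hull_opGens_eq_map :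
    hull (opGens f) (Set.range fun k => tOp f k 1) =
      (hull (weylGens pderiv f) (C '' (Ideal.span (Set.range f) : Set _))).map
        ((toCoeffs f).restrictScalars ℂ) := by
  have ht : ∀ k, tOp f k 1 = C (algebraMap _ (Loc f) (f k)) := fun k => by
    rw [tOp_apply, map_one, mul_one, genUnit_val]
  apply le_antisymm
  · refine hull_le ?_ ?_
    · rintro _ ⟨k, rfl⟩
      refine ⟨C (f k), subset_hull ⟨f k, Ideal.subset_span ⟨k, rfl⟩, rfl⟩, ?_⟩
      change toCoeffs f _ = tOp f k 1
      rw [toCoeffs_C, ht]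
    · rintro _ ((⟨i, rfl⟩ | ⟨i, rfl⟩) | ⟨⟨i, j⟩, rfl⟩) _ ⟨p, hp, rfl⟩
      · exact ⟨C (X i) * p, C_mul_mem_hull _ hp, toCoeffs_C_mul _ _⟩
      · exact ⟨dTwist pderiv f i p, dTwist_mem_hull _ hp, toCoeffs_dTwist _ _⟩
      · refine ⟨X i * tTwist f j p, X_mul_tTwist_mem_hull _ _ hp, ?_⟩
        change toCoeffs f (X i * tTwist f j p) = X i * tInvOp f i (tOp f j (toCoeffs f p))
        rw [toCoeffs_X_mul, toCoeffs_tTwist]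
  · rw [Submodule.map_le_iff_le_comap]
    let W := hull (opGens f) (Set.range fun k => tOp f k 1)
    refine weyl_hull_le ?_ ?_ ?_ ?_
    · rintro _ ⟨c, hc, rfl⟩
      change toCoeffs f (C c) ∈ W
      rw [toCoeffs_C]
      induction hc using Submodule.span_induction with
      | mem x hx =>
        obtain ⟨k, rfl⟩ := hx
        exact subset_hull ⟨k, ht k⟩
      | zero => simp
      | add x y _ _ hx hy =>
        rw [map_add, C_add]
        exact add_mem hx hy
      | smul a x _ hx =>
        rw [smul_eq_mul, map_mul, C_mul]
        exact C_mul_mem_opHull a hx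
    · intro a p hp
      change toCoeffs f (C a * p) ∈ W
      rw [toCoeffs_C_mul]
      exact C_mul_mem_opHull a hp
    · intro i p hp
      change toCoeffs f (dTwist pderiv f i p) ∈ W
      rw [toCoeffs_dTwist]
      exact dOp_mem_opHull i hp
    · intro i j p hp
      change toCoeffs f (X i * tTwist f j p) ∈ W
      rw [toCoeffs_X_mul, toCoeffs_tTwist]
      exact sOp_mem_opHull i j hp

/-- The functional equation can be tested in the Weyl algebra model, where the operator `∑ yⱼ ∂/∂yⱼ`
corresponds to multiplication by `∑ sⱼ`. -/
theorem satisfiesFunctionalEquation_iff_weyl (hf : ∀ j, f j ≠ 0) (b : Polynomial ℂ) :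
    SatisfiesFunctionalEquation f b ↔
      WeylFunctionalEquation pderiv f (Ideal.span (Set.range f)) b := by
  have h1 := aeval_intertwine ((toCoeffs f).restrictScalars ℂ) (eulerTwist f)
    (LinearMap.mulLeft ℂ (∑ j, (X j : Coeffs f))) toCoeffs_eulerTwist b 1
  have h2 : toCoeffs f 1 = 1 := by
    rw [← C_1, toCoeffs_C, map_one, C_1]
  have h3 : Polynomial.aeval (LinearMap.mulLeft ℂ (∑ j, (X j : Coeffs f))) b =
      LinearMap.mulLeft ℂ (Polynomial.aeval (∑ j, (X j : Coeffs f)) b) :=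
    (Polynomial.aeval_algHom_apply (Algebra.lmul ℂ (Coeffs f)) _ b)
  have h4 : (toCoeffs f) (Polynomial.aeval (eulerTwist f) b 1) =
      Polynomial.aeval (∑ j, (X j : Coeffs f)) b := by
    refine h1.trans ?_
    rw [h3, LinearMap.mulLeft_apply]
    change _ * toCoeffs f 1 = _
    rw [h2, mul_one]
  rw [satisfiesFunctionalEquation_iff, hull_opGens_eq_map, ← h4, WeylFunctionalEquation]
  constructor
  · rintro ⟨p, hp, h⟩
    rwa [← toCoeffs_injective hf h]
  · intro h
    exact ⟨_, h, rfl⟩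

end Bridge

/-! ### Evaluation of the functional equation at critical points -/

section LinearForms

variable {ι : Type*} [Fintype ι] {n : ℕ}

/-- The linear forms `ℓᵢ(s) = ∑ⱼ aⱼᵢ sⱼ` of a system of exponents `aⱼ`, so that
`∏ⱼ (x^{aⱼ})^{sⱼ} = x^{ℓ(s)}`. -/
def expForm {K : Type*} [CommRing K] (E : ι → Fin n →₀ ℕ) (s : ι → K) (i : Fin n) : K :=
  ∑ j, (E j i : K) * s j

variable {K : Type*} [CommRing K] (E : ι → Fin n →₀ ℕ)

theorem expForm_add (s t : ι → K) (i : Fin n) :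
    expForm E (s + t) i = expForm E s i + expForm E t i := by
  simp [expForm, mul_add, Finset.sum_add_distrib]

theorem expForm_sub (s t : ι → K) (i : Fin n) :
    expForm E (s - t) i = expForm E s i - expForm E t i := by
  simp [expForm, mul_sub, Finset.sum_sub_distrib]

theorem expForm_smul (a : K) (s : ι → K) (i : Fin n) :
    expForm E (a • s) i = a * expForm E s i := by
  simp [expForm, Finset.mul_sum, mul_left_comm]

theorem expForm_single [DecidableEq ι] (j : ι) (a : K) (i : Fin n) :
    expForm E (Pi.single j a) i = E j i * a := by
  simp [expForm, Pi.single_apply]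

theorem intCast_expForm (c : ι → ℤ) (i : Fin n) :
    ((expForm E c i : ℤ) : K) = expForm E (fun j => (c j : K)) i := by
  simp [expForm]

/-- The points `s` at which all the polynomials
`∏_{cⱼ<0} sⱼ (sⱼ-1) ⋯ (sⱼ+cⱼ+1) · ∏_{ℓᵢ(c)>0} (ℓᵢ(s)+1) ⋯ (ℓᵢ(s)+ℓᵢ(c))`
with `∑ cⱼ = 1` vanish. -/
def IsCritical (s : ι → ℂ) : Prop :=
  ∀ c : ι → ℤ, ∑ j, c j = 1 → (∃ j, ∃ k : ℕ, s j = k ∧ (k : ℤ) < -c j) ∨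
    ∃ i, ∃ k : ℕ, expForm E s i = -(k + 1) ∧ (k : ℤ) < expForm E c i

end LinearForms

section LaurentCoeff

variable {n : ℕ}

open Classical in
/-- The coefficient of `x^z`, for `z ∈ ℤⁿ`, of a polynomial. -/
noncomputable def laurentCoeff (z : Fin n → ℤ) : MvPolynomial (Fin n) ℂ →ₗ[ℂ] ℂ :=
  if 0 ≤ z then lcoeff ℂ (Finsupp.equivFunOnFinite.symm fun i => (z i).toNat) else 0

open Classical in
theorem laurentCoeff_monomial (z : Fin n → ℤ) (w : Fin n →₀ ℕ) (a : ℂ) :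
    laurentCoeff z (monomial w a) = if z = fun i => (w i : ℤ) then a else 0 := by
  unfold laurentCoeff
  by_cases hz : 0 ≤ z
  · rw [if_pos hz, lcoeff_apply, coeff_monomial]
    congr 1
    rw [eq_iff_iff]
    constructor
    · rintro rfl
      ext i
      simpa using hz i
    · rintro rfl
      ext i
      simp
  · rw [if_neg hz, LinearMap.zero_apply, if_neg]
    rintro rfl
    exact hz fun i => by simp

theorem laurentCoeff_monomial_mul (z : Fin n → ℤ) (u : Fin n →₀ ℕ) (b : ℂ)
    (h : MvPolynomial (Fin n) ℂ) :
    laurentCoeff z (monomial u b * h) = b * laurentCoeff (z - fun i => (u i : ℤ)) h := by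
  classical
  induction h using MvPolynomial.induction_on' with
  | add p q hp hq => simp only [mul_add, map_add, hp, hq]
  | monomial w a =>
    rw [monomial_mul, laurentCoeff_monomial, laurentCoeff_monomial, mul_ite, mul_zero]
    congr 1
    rw [eq_iff_iff, sub_eq_iff_eq_add]
    have : (fun i => ((u + w) i : ℤ)) = (fun i => (w i : ℤ)) + fun i => (u i : ℤ) := by
      ext i
      simp [add_comm]
    rw [this]

theorem laurentCoeff_pderiv (z : Fin n → ℤ) (i : Fin n) (h : MvPolynomial (Fin n) ℂ) :
    laurentCoeff z (pderiv i h) = (z i + 1) * laurentCoeff (z + Pi.single i 1) h := by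
  classical
  induction h using MvPolynomial.induction_on' with
  | add p q hp hq => simp only [mul_add, map_add, hp, hq]
  | monomial w a =>
    rw [pderiv_monomial, laurentCoeff_monomial, laurentCoeff_monomial, mul_ite, mul_zero]
    rcases Nat.eq_zero_or_pos (w i) with h0 | h0
    · rw [h0]
      simp only [Nat.cast_zero, mul_zero, ite_self]
      split_ifs with h1
      · have := congrFun h1 i
        simp only [Pi.add_apply, Pi.single_eq_same, h0, Nat.cast_zero] at this
        have h2 : (z i : ℂ) + 1 = 0 := by exact_mod_cast this
        rw [h2, zero_mul]
      · rfl
    · have h1 : (z = fun j => (((w - Finsupp.single i 1 : Fin n →₀ ℕ) j : ℕ) : ℤ)) ↔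
          z + Pi.single i 1 = fun j => (w j : ℤ) := by
        simp only [funext_iff]
        refine forall_congr' fun j => ?_
        by_cases hj : j = i
        · subst hj
          simp only [Finsupp.tsub_apply, Finsupp.single_eq_same, Pi.add_apply, Pi.single_eq_same]
          omega
        · simp [hj]
      simp only [h1]
      split_ifs with h2
      · have := congrFun h2 i
        simp only [Pi.add_apply, Pi.single_eq_same] at this
        have h3 : (z i : ℂ) + 1 = w i := by exact_mod_cast this
        rw [h3, mul_comm]
      · rfl

end LaurentCoeff

section Evaluation

variable {ι : Type*} [Fintype ι] {n : ℕ} (E : ι → Fin n →₀ ℕ) (s : ι → ℂ)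

/-- The coefficient of `x^{ℓ(s)+v}` in the value at `s + c` of an element of the Weyl algebra model
of a monomial system, where `y^ν` stands for `∏ⱼ sⱼ (sⱼ-1) ⋯ (sⱼ-νⱼ+1) · x^{ℓ(s-ν)}`. -/
noncomputable def evalCoeff (c : ι → ℤ) (v : Fin n → ℤ) :
    MvPolynomial ι (MvPolynomial (Fin n) ℂ) →ₗ[ℂ] ℂ :=
  (Finsupp.lsum ℂ fun ν : ι →₀ ℕ =>
    (∏ j, ∏ l ∈ Finset.range (ν j), (s j + c j - l)) •
      laurentCoeff (v - expForm E c + expForm E fun j => (ν j : ℤ))) ∘ₗ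
    (AddMonoidAlgebra.coeffLinearEquiv ℂ).toLinearMap

theorem evalCoeff_monomial (c : ι → ℤ) (v : Fin n → ℤ) (ν : ι →₀ ℕ)
    (h : MvPolynomial (Fin n) ℂ) :
    evalCoeff E s c v (monomial ν h) = (∏ j, ∏ l ∈ Finset.range (ν j), (s j + c j - l)) *
      laurentCoeff (v - expForm E c + expForm E fun j => (ν j : ℤ)) h := by
  simp [evalCoeff, ← single_eq_monomial]

theorem evalCoeff_C (c : ι → ℤ) (v : Fin n → ℤ) (h : MvPolynomial (Fin n) ℂ) :
    evalCoeff E s c v (C h) = laurentCoeff (v - expForm E c) h := by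
  rw [C_apply, evalCoeff_monomial]
  have : (expForm E fun j => (((0 : ι →₀ ℕ) j : ℕ) : ℤ)) = 0 := by
    ext i
    simp [expForm]
  rw [this]
  simp

variable {E s}

theorem evalCoeff_X_mul [DecidableEq ι] (c : ι → ℤ) (v : Fin n → ℤ) (j : ι)
    (p : MvPolynomial ι (MvPolynomial (Fin n) ℂ)) :
    evalCoeff E s c v (X j * p) = (s j + c j) * evalCoeff E s (c - Pi.single j 1) v p := by
  induction p using MvPolynomial.induction_on' with
  | add p q hp hq => simp only [mul_add, map_add, hp, hq]
  | monomial ν h =>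
    have h1 : (X j * monomial ν h : MvPolynomial ι (MvPolynomial (Fin n) ℂ)) =
        monomial (ν + Finsupp.single j 1) h := by
      rw [X, monomial_mul, one_mul, add_comm]
    have h2 : v - expForm E c + (expForm E fun k => (((ν + Finsupp.single j 1 : ι →₀ ℕ) k : ℕ) : ℤ))
        = v - expForm E (c - Pi.single j 1) + expForm E fun k => (ν k : ℤ) := by
      have : (fun k => (((ν + Finsupp.single j 1 : ι →₀ ℕ) k : ℕ) : ℤ)) =
          (fun k => (ν k : ℤ)) + Pi.single j 1 := by
        ext k
        simp [Finsupp.single_apply, Pi.single_apply, eq_comm]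
      rw [this]
      ext i
      simp only [Pi.add_apply, Pi.sub_apply, expForm_add, expForm_sub]
      ring
    rw [h1, evalCoeff_monomial, evalCoeff_monomial, h2, ← mul_assoc]
    congr 1
    have h3 := Finset.mul_prod_erase Finset.univ (fun k =>
      ∏ l ∈ Finset.range ((ν + Finsupp.single j 1 : ι →₀ ℕ) k), (s k + c k - (l : ℂ)))
      (Finset.mem_univ j)
    have h4 := Finset.mul_prod_erase Finset.univ (fun k =>
      ∏ l ∈ Finset.range (ν k), (s k + ((c - Pi.single j 1 : ι → ℤ) k : ℤ) - (l : ℂ)))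
      (Finset.mem_univ j)
    rw [← h3, ← h4, ← mul_assoc]
    congr 1
    · simp only [Finsupp.add_apply, Finsupp.single_eq_same, Finset.prod_range_succ', Pi.sub_apply,
        Pi.single_eq_same]
      rw [mul_comm]
      push_cast
      congr 1
      · ring
      · exact Finset.prod_congr rfl fun l _ => by ring
    · refine Finset.prod_congr rfl fun k hk => ?_
      have hk' : k ≠ j := Finset.ne_of_mem_erase hk
      simp [hk']

theorem evalCoeff_C_X_mul (c : ι → ℤ) (v : Fin n → ℤ) (i : Fin n)
    (p : MvPolynomial ι (MvPolynomial (Fin n) ℂ)) :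
    evalCoeff E s c v (C (X i) * p) = evalCoeff E s c (v - Pi.single i 1) p := by
  classical
  induction p using MvPolynomial.induction_on generalizing c with
  | C a =>
    rw [← C_mul, evalCoeff_C, evalCoeff_C, X, laurentCoeff_monomial_mul, one_mul]
    congr 2
    ext k
    simp only [Pi.sub_apply, Finsupp.single_apply, Pi.single_apply, eq_comm (a := i)]
    split_ifs <;> push_cast <;> ring
  | add p q hp hq => simp only [mul_add, map_add, hp, hq]
  | mul_X p j hp => rw [mul_comm p, mul_left_comm, evalCoeff_X_mul, evalCoeff_X_mul, hp]

theorem evalCoeff_tTwist [DecidableEq ι] (c : ι → ℤ) (v : Fin n → ℤ) (j : ι)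
    (p : MvPolynomial ι (MvPolynomial (Fin n) ℂ)) :
    evalCoeff E s c v (tTwist (fun k => monomial (E k) 1) j p) =
      evalCoeff E s (c + Pi.single j 1) v p := by
  induction p using MvPolynomial.induction_on generalizing c with
  | C a =>
    rw [tTwist_C, evalCoeff_C, evalCoeff_C, laurentCoeff_monomial_mul, one_mul]
    congr 2
    ext i
    simp only [Pi.sub_apply, expForm_add, expForm_single]
    ring
  | add p q hp hq => simp only [map_add, hp, hq]
  | mul_X p i hp =>
    rw [mul_comm p, tTwist_X_mul, map_add, evalCoeff_X_mul, evalCoeff_X_mul, hp,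
      apply_ite (evalCoeff E s c v), map_zero, sub_add_eq_add_sub]
    split_ifs with h
    · subst h
      simp only [Pi.add_apply, Pi.single_eq_same, add_sub_cancel_right]
      push_cast
      ring
    · simp [Pi.single_eq_of_ne h]

theorem evalCoeff_dTwist (c : ι → ℤ) (v : Fin n → ℤ) (i : Fin n)
    (p : MvPolynomial ι (MvPolynomial (Fin n) ℂ)) :
    evalCoeff E s c v (dTwist pderiv (fun k => monomial (E k) 1) i p) =
      (expForm E s i + v i + 1) * evalCoeff E s c (v + Pi.single i 1) p := by
  classical
  induction p using MvPolynomial.induction_on generalizing c with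
  | C a =>
    have h : ∀ j, laurentCoeff (v - expForm E (c - Pi.single j 1))
        (pderiv i (monomial (E j) 1) * a) =
          E j i * laurentCoeff (v + Pi.single i 1 - expForm E c) a := by
      intro j
      rw [pderiv_monomial, laurentCoeff_monomial_mul, one_mul]
      rcases Nat.eq_zero_or_pos (E j i) with h0 | h0
      · simp [h0]
      · congr 3
        ext k
        simp only [Pi.sub_apply, Pi.add_apply, expForm_sub, expForm_single, Finsupp.tsub_apply,
          Finsupp.single_apply, Pi.single_apply, eq_comm (a := i)]
        split_ifs with hk
        · subst hk
          push_cast [h0]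
          ring
        · simp
          ring
    have h' : v - expForm E c + Pi.single i 1 = v + Pi.single i 1 - expForm E c := by abel
    simp only [dTwist_C, map_add, map_sum, evalCoeff_X_mul, evalCoeff_C, h, laurentCoeff_pderiv, h',
      ← mul_assoc, ← Finset.sum_mul, ← add_mul]
    congr 1
    have h3 : ∑ j, (s j + c j) * (E j i : ℂ) = expForm E s i + (expForm E c i : ℤ) := by
      rw [intCast_expForm, ← expForm_add]
      exact Finset.sum_congr rfl fun j _ => by simp [mul_comm]
    rw [h3]
    push_cast [Pi.sub_apply]
    ring
  | add p q hp hq => simp only [map_add, hp, hq, mul_add]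
  | mul_X p j hp =>
    rw [mul_comm p, dTwist_X_mul, evalCoeff_X_mul, evalCoeff_X_mul, hp]
    ring

/-- The pairs `(c, v)` that can be reached from `(0, 0)` by the operators of the Weyl algebra model
without crossing a zero of a coefficient. -/
def Reachable (E : ι → Fin n →₀ ℕ) (s : ι → ℂ) (c : ι → ℤ) (v : Fin n → ℤ) : Prop :=
  ∑ j, c j = 0 ∧ (∀ j, ∀ k : ℕ, s j = k → -(k : ℤ) ≤ c j) ∧
    ∀ i, ∀ k : ℕ, expForm E s i = -(k + 1) → v i ≤ k

/-- If `b` satisfies the functional equation of a monomial system, then it vanishes at the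
coordinate sum of each critical point `s`. The functionals `evalCoeff E s c v` with `(c, v)` reachable
vanish on the generators, because `s` is critical, and an operator that leaves the reachable pairs
introduces a factor zero; hence they vanish on the module, whereas the functional at `(0, 0)` takes
the value `b(∑ sⱼ)` on `b(∑ yⱼ ∂/∂yⱼ) exp(∑ fⱼ yⱼ)`. -/
theorem WeylFunctionalEquation.eval_eq_zero {a : Ideal (MvPolynomial (Fin n) ℂ)}
    (hE : a = Ideal.span (Set.range fun j => monomial (E j) (1 : ℂ))) (hs : IsCritical E s)
    {b : Polynomial ℂ}
    (h : WeylFunctionalEquation pderiv (fun j => monomial (E j) (1 : ℂ)) a b) :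
    b.eval (∑ j, s j) = 0 := by
  classical
  let W : Submodule ℂ (MvPolynomial ι (MvPolynomial (Fin n) ℂ)) :=
    { carrier := {p | ∀ c v, Reachable E s c v → evalCoeff E s c v p = 0}
      zero_mem' := by simp
      add_mem' := fun hp hq c v hcv => by simp [hp c v hcv, hq c v hcv]
      smul_mem' := fun z p hp c v hcv => by simp [hp c v hcv] }
  have hCW : ∀ (h : MvPolynomial (Fin n) ℂ), ∀ p ∈ W, C h * p ∈ W := by
    intro h
    induction h using MvPolynomial.induction_on with
    | C z =>
      intro p hp
      have : (C (C z) * p : MvPolynomial ι (MvPolynomial (Fin n) ℂ)) = z • p := by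
        rw [Algebra.smul_def]
        rfl
      rw [this]
      exact W.smul_mem z hp
    | add h k hh hk =>
      intro p hp
      rw [C_add, add_mul]
      exact add_mem (hh p hp) (hk p hp)
    | mul_X h i hh =>
      intro p hp
      rw [C_mul, mul_assoc]
      refine hh _ fun c v hcv => ?_
      rw [evalCoeff_C_X_mul]
      refine hp _ _ ⟨hcv.1, hcv.2.1, fun k l hl => ?_⟩
      have h1 := hcv.2.2 k l hl
      have h2 : (0 : ℤ) ≤ (Pi.single i 1 : Fin n → ℤ) k := by
        rw [Pi.single_apply]
        split_ifs <;> simp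
      simp only [Pi.sub_apply]
      omega
  have hle : hull (weylGens pderiv fun j => monomial (E j) (1 : ℂ))
      (C '' (a : Set (MvPolynomial (Fin n) ℂ))) ≤ W := by
    refine weyl_hull_le ?_ hCW ?_ ?_
    · rintro _ ⟨h, hh, rfl⟩
      rw [SetLike.mem_coe, hE] at hh
      induction hh using Submodule.span_induction with
      | mem x hx =>
        obtain ⟨j, rfl⟩ := hx
        intro c v hcv
        rw [evalCoeff_C, laurentCoeff_monomial, if_neg]
        intro heq
        have hv : ∀ i, v i = expForm E (c + Pi.single j 1) i := by
          intro i
          have := congrFun heq i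
          simp only [Pi.sub_apply] at this
          rw [expForm_add, expForm_single]
          omega
        rcases hs (c + Pi.single j 1) (by
          simp [Finset.sum_add_distrib, hcv.1, Pi.single_apply]) with
          ⟨k, l, hl, hlt⟩ | ⟨i, l, hl, hlt⟩
        · have h1 := hcv.2.1 k l hl
          have h2 : (0 : ℤ) ≤ (Pi.single j 1 : ι → ℤ) k := by
            rw [Pi.single_apply]
            split_ifs <;> simp
          simp only [Pi.add_apply] at hlt
          omega
        · have h1 := hcv.2.2 i l hl
          rw [← hv] at hlt
          omega
      | zero => simp
      | add x y _ _ hx hy =>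
        rw [C_add]
        exact add_mem hx hy
      | smul b x _ hx =>
        rw [smul_eq_mul, C_mul]
        exact hCW b _ hx
    · intro i p hp c v hcv
      rw [evalCoeff_dTwist]
      by_cases h0 : expForm E s i + v i + 1 = 0
      · rw [h0, zero_mul]
      · rw [hp, mul_zero]
        refine ⟨hcv.1, hcv.2.1, fun k l hl => ?_⟩
        have h1 := hcv.2.2 k l hl
        by_cases hk : k = i
        · subst hk
          have h2 : v k ≠ l := by
            intro h2
            apply h0
            rw [hl, h2]
            push_cast
            ring
          simp only [Pi.add_apply, Pi.single_eq_same]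
          omega
        · simpa [hk] using h1
    · intro i j p hp c v hcv
      rw [evalCoeff_X_mul, evalCoeff_tTwist]
      by_cases h0 : s i + c i = 0
      · rw [h0, zero_mul]
      · rw [hp, mul_zero]
        refine ⟨?_, fun k l hl => ?_, hcv.2.2⟩
        · simp [Finset.sum_add_distrib, hcv.1, Pi.single_apply]
        · have h1 := hcv.2.1 k l hl
          have h2 : (0 : ℤ) ≤ (Pi.single j 1 : ι → ℤ) k := by
            rw [Pi.single_apply]
            split_ifs <;> simp
          by_cases hk : k = i
          · subst hk
            have h3 : c k ≠ -l := by
              intro h3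
              apply h0
              rw [hl, h3]
              push_cast
              ring
            simp only [Pi.add_apply, Pi.sub_apply, Pi.single_eq_same]
            omega
          · simp only [Pi.add_apply, Pi.sub_apply, Pi.single_eq_of_ne hk]
            omega
  have h0 : Reachable E s 0 0 := ⟨by simp, by simp, by simp⟩
  have h1 := aeval_intertwine (evalCoeff E s 0 0) (eulerTwist fun j => monomial (E j) (1 : ℂ))
    (LinearMap.mulLeft ℂ (∑ j, s j)) (fun p => by
      simp [eulerTwist_apply, evalCoeff_X_mul, evalCoeff_tTwist, Finset.sum_mul]) b 1
  have h2 : evalCoeff E s 0 0 1 = 1 := by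
    rw [← C_1, evalCoeff_C, ← C_1, C_apply, laurentCoeff_monomial, if_pos]
    ext i
    simp [expForm]
  have h3 : Polynomial.aeval (LinearMap.mulLeft ℂ (∑ j, s j)) b =
      LinearMap.mulLeft ℂ (Polynomial.aeval (∑ j, s j) b) :=
    (Polynomial.aeval_algHom_apply (Algebra.lmul ℂ ℂ) _ b)
  rw [hle h 0 0 h0, h2, h3, LinearMap.mulLeft_apply, mul_one, Polynomial.coe_aeval_eq_eval] at h1
  exact h1.symm

end Evaluation

/-! ### Functional equations of monomial systems -/

theorem exists_eq_add_single {ι : Type*} {μ : ι →₀ ℕ} (h : 0 < μ.degree) :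
    ∃ j μ', μ = μ' + Finsupp.single j 1 := by
  have h0 : μ ≠ 0 := by
    rintro rfl
    simp at h
  obtain ⟨j, hj⟩ := Finsupp.support_nonempty_iff.2 h0
  refine ⟨j, μ - Finsupp.single j 1, (tsub_add_cancel_of_le ?_).symm⟩
  rw [Finsupp.single_le_iff]
  exact Nat.one_le_iff_ne_zero.2 (Finsupp.mem_support_iff.1 hj)

section MonomialSystem

variable {ι : Type*} [Fintype ι] {n : ℕ}

/-- The polynomial
`∏_{cⱼ<0} sⱼ (sⱼ-1) ⋯ (sⱼ+cⱼ+1) · ∏_{ℓᵢ(c)>0} (ℓᵢ(s)+1) ⋯ (ℓᵢ(s)+ℓᵢ(c))`. -/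
noncomputable def criticalPoly (E : ι → Fin n →₀ ℕ) (c : ι → ℤ) : MvPolynomial ι ℂ :=
  (∏ j, ∏ l ∈ Finset.range (-c j).toNat, (X j - (l : MvPolynomial ι ℂ))) *
    ∏ i, ∏ l ∈ Finset.range (expForm E c i).toNat, (expForm E X i + (l + 1 : MvPolynomial ι ℂ))

theorem eval_criticalPoly_eq_zero_iff (E : ι → Fin n →₀ ℕ) (c : ι → ℤ) (s : ι → ℂ) :
    eval s (criticalPoly E c) = 0 ↔ (∃ j, ∃ k : ℕ, s j = k ∧ (k : ℤ) < -c j) ∨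
      ∃ i, ∃ k : ℕ, expForm E s i = -(k + 1) ∧ (k : ℤ) < expForm E c i := by
  have h : ∀ i, eval s (expForm E X i) = expForm E s i := fun i => by simp [expForm]
  simp only [criticalPoly, map_mul, map_prod, map_sub, map_add, eval_X, map_natCast, map_one, h,
    mul_eq_zero, Finset.prod_eq_zero_iff, Finset.mem_univ, true_and, Finset.mem_range,
    Int.lt_toNat, sub_eq_zero, add_eq_zero_iff_eq_neg, and_comm]

theorem isCritical_iff (E : ι → Fin n →₀ ℕ) (s : ι → ℂ) :
    IsCritical E s ↔ ∀ c : ι → ℤ, ∑ j, c j = 1 → eval s (criticalPoly E c) = 0 :=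
  forall₂_congr fun c _ => (eval_criticalPoly_eq_zero_iff E c s).symm

/-- The exponent `∑ⱼ μⱼ aⱼ`. -/
noncomputable def totalExp (E : ι → Fin n →₀ ℕ) (μ : ι →₀ ℕ) : Fin n →₀ ℕ := ∑ j, μ j • E j

theorem totalExp_add (E : ι → Fin n →₀ ℕ) (μ ν : ι →₀ ℕ) :
    totalExp E (μ + ν) = totalExp E μ + totalExp E ν := by
  simp [totalExp, add_smul, Finset.sum_add_distrib]

theorem totalExp_single (E : ι → Fin n →₀ ℕ) (j : ι) :
    totalExp E (Finsupp.single j 1) = E j := by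
  classical
  simp [totalExp, Finsupp.single_apply]

theorem totalExp_apply (E : ι → Fin n →₀ ℕ) (μ : ι →₀ ℕ) (i : Fin n) :
    totalExp E μ i = ∑ j, μ j * E j i := by
  simp [totalExp]

/-- Products of operators `s_{i,j}` map a generator to `y^ν x^{∑ μⱼ aⱼ}` if `|ν| < |μ|`. -/
theorem monomial_mem_hull (E : ι → Fin n →₀ ℕ) {a : Ideal (MvPolynomial (Fin n) ℂ)}
    (ha : ∀ j, monomial (E j) (1 : ℂ) ∈ a) (ν μ : ι →₀ ℕ) (hdeg : ν.degree < μ.degree)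
    (hdisj : ∀ j, ν j = 0 ∨ μ j = 0) :
    monomial ν (monomial (totalExp E μ) (1 : ℂ)) ∈
      hull (weylGens pderiv fun j => monomial (E j) (1 : ℂ))
        (C '' (a : Set (MvPolynomial (Fin n) ℂ))) := by
  induction hd : ν.degree generalizing ν μ with
  | zero =>
    obtain ⟨j, μ', rfl⟩ := exists_eq_add_single (lt_of_le_of_lt (Nat.zero_le _) hdeg)
    rw [Finsupp.degree_eq_zero_iff] at hd
    subst hd
    refine subset_hull ⟨_, ?_, rfl⟩
    have : monomial (totalExp E (μ' + Finsupp.single j 1)) (1 : ℂ) =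
        monomial (totalExp E μ') 1 * monomial (E j) 1 := by
      rw [monomial_mul, totalExp_add, totalExp_single, one_mul]
    rw [this]
    exact a.mul_mem_left _ (ha j)
  | succ d ih =>
    obtain ⟨i, ν', rfl⟩ := exists_eq_add_single (μ := ν) (by omega)
    obtain ⟨j, μ', rfl⟩ := exists_eq_add_single (lt_of_le_of_lt (Nat.zero_le _) hdeg)
    simp only [map_add, Finsupp.degree_single] at hd hdeg
    have hj : (ν' + Finsupp.single i 1 : ι →₀ ℕ) j = 0 := (hdisj j).resolve_right (by simp)
    have hj' : ν' j = 0 := by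
      simp only [Finsupp.add_apply] at hj
      omega
    have h := X_mul_tTwist_mem_hull (f := fun j => monomial (E j) (1 : ℂ)) i j
      (ih ν' μ' (by omega) (fun k => by
        have := hdisj k
        simp only [Finsupp.add_apply] at this
        omega) (by omega))
    have h1 : X i * tTwist (fun j => monomial (E j) (1 : ℂ)) j
        (monomial ν' (monomial (totalExp E μ') 1)) =
          monomial (ν' + Finsupp.single i 1)
            (monomial (totalExp E (μ' + Finsupp.single j 1)) 1) := by
      rw [tTwist_apply, pderiv_monomial, hj', Nat.cast_zero, mul_zero, map_zero, zero_add,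
        C_mul_monomial, monomial_mul, X, monomial_mul, totalExp_add, totalExp_single]
      simp [add_comm]
    rwa [h1] at h

end MonomialSystem

section MonomialCoeffs

variable {n r : ℕ} (E : Fin r → Fin n →₀ ℕ)

/-- The monomials `x^{aⱼ}` with exponents `aⱼ`. -/
noncomputable def monomials : Fin r → MvPolynomial (Fin n) ℂ := fun j => monomial (E j) 1

/-- The inclusion of `ℂ[s]` in `ℂ[x][∏ fᵢ⁻¹, s]`. -/
noncomputable def inclS (f : Fin r → MvPolynomial (Fin n) ℂ) :
    MvPolynomial (Fin r) ℂ →ₐ[ℂ] Coeffs f := aeval X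

variable {f : Fin r → MvPolynomial (Fin n) ℂ}

/-- The module is stable under `ℂ[s]`, because `sⱼ` is the operator `s_{j,j}`. -/
theorem inclS_mul_mem_opHull (q : MvPolynomial (Fin r) ℂ) {S : Set (Coeffs f)} {p : Coeffs f}
    (hp : p ∈ hull (opGens f) S) : inclS f q * p ∈ hull (opGens f) S := by
  induction q using MvPolynomial.induction_on generalizing p with
  | C z =>
    have : inclS f (C z) * p = z • p := by
      rw [Algebra.smul_def, ← algebraMap_eq, AlgHom.commutes]
    rw [this]
    exact Submodule.smul_mem _ z hp
  | add q q' h h' =>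
    rw [map_add, add_mul]
    exact add_mem (h hp) (h' hp)
  | mul_X q j h =>
    rw [map_mul, mul_assoc]
    have := sOp_mem_opHull j j hp
    rw [tInvOp_tOp_self] at this
    simpa [inclS] using h this

theorem coeffMap_inclS (D : Derivation ℂ (Loc f) (Loc f)) (q : MvPolynomial (Fin r) ℂ) :
    coeffMap (Fin r) D.toLinearMap (inclS f q) = 0 := by
  induction q using MvPolynomial.induction_on with
  | C z =>
    have : inclS f (C z) = C (algebraMap ℂ (Loc f) z) := by
      rw [← algebraMap_eq, AlgHom.commutes]
      rfl
    rw [this, coeffMap_C, Derivation.coeFn_coe, Derivation.map_algebraMap, map_zero]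
  | add q q' h h' => rw [map_add, map_add, h, h', add_zero]
  | mul_X q j h =>
    have : inclS f (q * X j) = X j * inclS f q := by simp [inclS, mul_comm]
    rw [this, coeffMap_X_mul, h, mul_zero]

/-- `∂ᵢ (x^{v+eᵢ} ∏ xᵃʲˢʲ) = (ℓᵢ(s) + vᵢ + 1) x^v ∏ xᵃʲˢʲ`. -/
theorem dOp_monomial_mul_inclS (i : Fin n) (v : Fin n →₀ ℕ) (q : MvPolynomial (Fin r) ℂ) :
    dOp (monomials E) i (C (algebraMap (MvPolynomial (Fin n) ℂ) (Loc (monomials E))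
      (monomial (v + Finsupp.single i 1) 1)) * inclS _ q) =
        C (algebraMap (MvPolynomial (Fin n) ℂ) (Loc (monomials E)) (monomial v 1)) *
          inclS _ (q * (expForm E X i + ((v i : MvPolynomial (Fin r) ℂ) + 1))) := by
  have h1 : ∀ j, algebraMap (MvPolynomial (Fin n) ℂ) (Loc (monomials E))
        (monomial (v + Finsupp.single i 1) 1) *
      (algebraMap (MvPolynomial (Fin n) ℂ) (Loc (monomials E)) (pderiv i (monomials E j)) *
        (((genUnit (monomials E) j)⁻¹ : (Loc (monomials E))ˣ) : Loc (monomials E))) =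
        (E j i : Loc (monomials E)) *
          algebraMap (MvPolynomial (Fin n) ℂ) (Loc (monomials E)) (monomial v 1) := by
    intro j
    have h2 : monomial (v + Finsupp.single i 1) (1 : ℂ) * pderiv i (monomials E j) =
        (E j i : MvPolynomial (Fin n) ℂ) * monomial v 1 * monomials E j := by
      have h3 : (monomial (v + Finsupp.single i 1) (1 : ℂ) : MvPolynomial (Fin n) ℂ) =
          monomial v 1 * X i := by
        rw [X, monomial_mul, one_mul]
      rw [h3, mul_assoc, monomials, X_mul_pderiv_monomial]
      simp only [nsmul_eq_mul]
      ring
    rw [← mul_assoc, ← map_mul, h2, map_mul, ← genUnit_val, mul_assoc, Units.mul_inv, mul_one,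
      map_mul, map_natCast]
  have h4 : pderiv i (monomial (v + Finsupp.single i 1) (1 : ℂ)) =
      ((v i : MvPolynomial (Fin n) ℂ) + 1) * monomial v 1 := by
    rw [pderiv_monomial, add_tsub_cancel_right]
    have : ((v i : MvPolynomial (Fin n) ℂ) + 1) = C ((v i : ℂ) + 1) := by simp
    rw [this, C_mul_monomial]
    simp
  have h5 : inclS (monomials E) (expForm E X i + ((v i : MvPolynomial (Fin r) ℂ) + 1)) =
      (∑ j, (E j i : Coeffs (monomials E)) * X j) + (v i + 1) := by
    simp [inclS, expForm]
  rw [dOp_C_mul, dOp_apply, coeffMap_inclS, zero_add, locDeriv_algebraMap, h4, ← mul_assoc,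
    Finset.mul_sum, map_mul (inclS (monomials E)), h5]
  have h6 : ∀ j ∈ Finset.univ, C (algebraMap (MvPolynomial (Fin n) ℂ) (Loc (monomials E))
      (monomial (v + Finsupp.single i 1) 1)) * (X j * C
        (algebraMap (MvPolynomial (Fin n) ℂ) (Loc (monomials E)) (pderiv i (monomials E j)) *
        (((genUnit (monomials E) j)⁻¹ : (Loc (monomials E))ˣ) : Loc (monomials E)))) =
      C (algebraMap (MvPolynomial (Fin n) ℂ) (Loc (monomials E)) (monomial v 1)) *
        ((E j i : Coeffs (monomials E)) * X j) := by
    intro j _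
    rw [mul_left_comm, ← C_mul, h1, C_mul, map_natCast]
    ring
  rw [Finset.sum_congr rfl h6, ← Finset.mul_sum, map_mul, map_add, map_natCast, map_one, C_mul,
    C_add, map_natCast, C_1]
  ring

variable {E}

/-- Repeated differentiation of `x^v q(s) ∏ xᵃʲˢʲ` removes the monomial `x^v` at the cost of the
factors `ℓᵢ(s) + 1, …, ℓᵢ(s) + vᵢ`. -/
theorem inclS_mul_prod_mem_opHull {S : Set (Coeffs (monomials E))} (v : Fin n →₀ ℕ)
    (q : MvPolynomial (Fin r) ℂ)
    (h : C (algebraMap (MvPolynomial (Fin n) ℂ) (Loc (monomials E)) (monomial v 1)) * inclS _ q ∈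
      hull (opGens (monomials E)) S) :
    inclS _ (q * ∏ i, ∏ l ∈ Finset.range (v i),
      (expForm E X i + (l + 1 : MvPolynomial (Fin r) ℂ))) ∈ hull (opGens (monomials E)) S := by
  induction hd : v.degree generalizing v q with
  | zero =>
    rw [Finsupp.degree_eq_zero_iff] at hd
    subst hd
    have : (monomial (0 : Fin n →₀ ℕ) (1 : ℂ)) = 1 := rfl
    rw [this, map_one, C_1, one_mul] at h
    simpa using h
  | succ d ih =>
    obtain ⟨i, v', rfl⟩ := exists_eq_add_single (μ := v) (by omega)
    simp only [map_add, Finsupp.degree_single] at hd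
    have h1 := dOp_mem_opHull i h
    rw [dOp_monomial_mul_inclS] at h1
    have h2 := ih v' _ h1 (by omega)
    have h3 := Finset.mul_prod_erase Finset.univ (fun k => ∏ l ∈ Finset.range (v' k),
      (expForm E X k + (l + 1 : MvPolynomial (Fin r) ℂ))) (Finset.mem_univ i)
    have h4 := Finset.mul_prod_erase Finset.univ (fun k => ∏ l ∈ Finset.range
      ((v' + Finsupp.single i 1 : Fin n →₀ ℕ) k),
      (expForm E X k + (l + 1 : MvPolynomial (Fin r) ℂ))) (Finset.mem_univ i)
    have h5 : ∀ k ∈ Finset.univ.erase i, (∏ l ∈ Finset.range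
        ((v' + Finsupp.single i 1 : Fin n →₀ ℕ) k),
        (expForm E X k + (l + 1 : MvPolynomial (Fin r) ℂ))) = ∏ l ∈ Finset.range (v' k),
        (expForm E X k + (l + 1 : MvPolynomial (Fin r) ℂ)) := by
      intro k hk
      simp [Finset.ne_of_mem_erase hk]
    have h6 : (v' + Finsupp.single i 1 : Fin n →₀ ℕ) i = v' i + 1 := by simp
    rw [← h3] at h2
    rw [← h4, Finset.prod_congr rfl h5, h6, Finset.prod_range_succ]
    convert h2 using 2
    ring

/-- The critical polynomials give elements of the module generated by the `tⱼ ∏ xᵃʲˢʲ`. The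
negative part `ν` of `c` is produced by the operators `s_{i,j}`, and the monomial that remains is
removed by differentiation. -/
theorem inclS_criticalPoly_mem_opHull (c : Fin r → ℤ) (hc : ∑ j, c j = 1) :
    inclS _ (criticalPoly E c) ∈
      hull (opGens (monomials E)) (Set.range fun k => tOp (monomials E) k 1) := by
  let μ : Fin r →₀ ℕ := Finsupp.equivFunOnFinite.symm fun j => (c j).toNat
  let ν : Fin r →₀ ℕ := Finsupp.equivFunOnFinite.symm fun j => (-c j).toNat
  have hμν : ∀ j, c j = μ j - ν j := fun j => by
    simp only [μ, ν, Finsupp.equivFunOnFinite_symm_apply_apply]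
    omega
  have hdeg : ν.degree < μ.degree := by
    have h1 : (μ.degree : ℤ) - ν.degree = 1 := by
      rw [Finsupp.degree_eq_sum, Finsupp.degree_eq_sum, ← hc]
      push_cast
      rw [← Finset.sum_sub_distrib]
      exact Finset.sum_congr rfl fun j _ => (hμν j).symm
    omega
  have hmem := monomial_mem_hull E (a := Ideal.span (Set.range (monomials E)))
    (fun j => Ideal.subset_span ⟨j, rfl⟩) ν μ hdeg (fun j => by
      simp only [μ, ν, Finsupp.equivFunOnFinite_symm_apply_apply]
      omega)
  let w := totalExp E μ
  let w' := totalExp E ν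
  have hform : ∀ i, expForm E c i = w i - w' i := fun i => by
    simp only [w, w', totalExp_apply, expForm, hμν]
    push_cast
    rw [← Finset.sum_sub_distrib]
    exact Finset.sum_congr rfl fun j _ => by ring
  have h1 : toCoeffs (monomials E) (C (monomial (w' - w) 1) * monomial ν (monomial w 1)) ∈
      hull (opGens (monomials E)) (Set.range fun k => tOp (monomials E) k 1) := by
    rw [hull_opGens_eq_map]
    exact ⟨_, C_mul_mem_hull _ hmem, rfl⟩
  have h2 : (∏ j, C (((genUnit (monomials E) j)⁻¹ : (Loc (monomials E))ˣ) : Loc (monomials E)) ^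
      ν j) * C (algebraMap (MvPolynomial (Fin n) ℂ) (Loc (monomials E)) (monomial w' 1)) =
        (1 : Coeffs (monomials E)) := by
    have h3 : monomial w' (1 : ℂ) = ∏ j, monomials E j ^ ν j := by
      simp only [w', totalExp, monomials, monomial_pow, one_pow]
      rw [monomial_sum_one]
    rw [h3, map_prod, map_prod, ← Finset.prod_mul_distrib]
    refine Finset.prod_eq_one fun j _ => ?_
    rw [map_pow, ← genUnit_val, C_pow, ← mul_pow, ← C_mul, Units.inv_mul, C_1, one_pow]
  have h4 : toCoeffs (monomials E) (C (monomial (w' - w) 1) * monomial ν (monomial w 1)) =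
      C (algebraMap (MvPolynomial (Fin n) ℂ) (Loc (monomials E)) (monomial (w - w') 1)) * inclS _
        (∏ j, ∏ l ∈ Finset.range (-c j).toNat, (X j - (l : MvPolynomial (Fin r) ℂ))) := by
    have h5 : w' - w + w = w - w' + w' := by
      ext i
      simp only [Finsupp.add_apply, Finsupp.tsub_apply]
      omega
    have h6 : (monomial (w' - w + w) (1 : ℂ)) = monomial (w - w') 1 * monomial w' 1 := by
      rw [h5, monomial_mul, one_mul]
    rw [C_mul_monomial, monomial_mul, one_mul, h6, toCoeffs_monomial, map_mul, C_mul]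
    simp only [toCoeffsFactor, Finset.prod_mul_distrib]
    have h7 : inclS (monomials E) (∏ j, ∏ l ∈ Finset.range (-c j).toNat,
        (X j - (l : MvPolynomial (Fin r) ℂ))) =
        ∏ j, ∏ l ∈ Finset.range (ν j), (X j - (l : Coeffs (monomials E))) := by
      simp [inclS, ν, map_prod]
    rw [h7]
    linear_combination (C (algebraMap (MvPolynomial (Fin n) ℂ) (Loc (monomials E))
      (monomial (w - w') 1)) *
      ∏ j, ∏ l ∈ Finset.range (ν j), (X j - (l : Coeffs (monomials E)))) * h2
  rw [h4] at h1
  have h8 := inclS_mul_prod_mem_opHull _ _ h1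
  have h9 : ∀ i, (w - w') i = (expForm E c i).toNat := fun i => by
    rw [hform, Finsupp.tsub_apply]
    omega
  rw [criticalPoly]
  simpa only [h9] using h8

/-- The functional equation holds for `b` if `b(∑ sⱼ)` is in the ideal of the critical
polynomials. -/
theorem satisfiesFunctionalEquation_of_mem_span (b : Polynomial ℂ)
    (hb : Polynomial.aeval (∑ j, (X j : MvPolynomial (Fin r) ℂ)) b ∈
      Ideal.span {p | ∃ c : Fin r → ℤ, ∑ j, c j = 1 ∧ p = criticalPoly E c}) :
    SatisfiesFunctionalEquation (monomials E) b := by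
  rw [satisfiesFunctionalEquation_iff]
  have h1 : Polynomial.aeval (∑ j, (X j : Coeffs (monomials E))) b =
      inclS _ (Polynomial.aeval (∑ j, (X j : MvPolynomial (Fin r) ℂ)) b) := by
    rw [← Polynomial.aeval_algHom_apply]
    simp [inclS]
  rw [h1]
  generalize Polynomial.aeval (∑ j, (X j : MvPolynomial (Fin r) ℂ)) b = q at hb ⊢
  induction hb using Submodule.span_induction with
  | mem x hx =>
    obtain ⟨c, hc, rfl⟩ := hx
    exact inclS_criticalPoly_mem_opHull c hc
  | zero => simp
  | add x y _ _ hx hy =>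
    rw [map_add]
    exact add_mem hx hy
  | smul q x _ hx =>
    rw [smul_eq_mul, map_mul]
    exact inclS_mul_mem_opHull q hx

end MonomialCoeffs

/-! ### Farkas' lemma and strict complementarity -/

section Farkas

variable {K V ι : Type*} [Field K] [LinearOrder K] [IsStrictOrderedRing K] [AddCommGroup V]
  [Module K V]

/-- Farkas' lemma. If a form `a₀` of the family is needed to bound `b`, there is `x` with
`a₀ x = 1`, `b x > 0` and all other forms nonpositive at `x`; the induction hypothesis is applied
to the forms composed with the projection along `x` to the kernel of `a₀`. -/
theorem exists_nonneg_combination (s : Finset ι) (a : ι → Module.Dual K V) (b : Module.Dual K V)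
    (h : ∀ x, (∀ i ∈ s, a i x ≤ 0) → b x ≤ 0) :
    ∃ t : ι → K, (∀ i, 0 ≤ t i) ∧ b = ∑ i ∈ s, t i • a i := by
  classical
  induction s using Finset.induction_on generalizing a b with
  | empty =>
    refine ⟨0, fun _ => le_rfl, ?_⟩
    ext x
    have h1 := h x (by simp)
    have h2 := h (-x) (by simp)
    rw [map_neg, neg_nonpos] at h2
    simpa using le_antisymm h1 h2
  | insert i₀ s hi₀ ih =>
    by_cases hs : ∀ x, (∀ i ∈ s, a i x ≤ 0) → b x ≤ 0
    · obtain ⟨t, ht, hb⟩ := ih a b hs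
      refine ⟨Function.update t i₀ 0, fun i => ?_, ?_⟩
      · by_cases hi : i = i₀
        · simp [hi]
        · simpa [hi] using ht i
      · rw [Finset.sum_insert hi₀, Function.update_self, zero_smul, zero_add, hb]
        refine Finset.sum_congr rfl fun i hi => ?_
        rw [Function.update_of_ne (ne_of_mem_of_not_mem hi hi₀)]
    · push Not at hs
      obtain ⟨y, hy, hby⟩ := hs
      have hay : 0 < a i₀ y := by
        by_contra! hle
        exact absurd (h y fun i hi => (Finset.mem_insert.1 hi).elim (fun e => e ▸ hle) (hy i))
          (not_le.2 hby)
      let x := (a i₀ y)⁻¹ • y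
      have hx0 : a i₀ x = 1 := by simp [x, hay.ne']
      have hx : ∀ i ∈ s, a i x ≤ 0 := fun i hi => by
        simpa [x] using mul_nonpos_of_nonneg_of_nonpos (inv_nonneg.2 hay.le) (hy i hi)
      have hbx : 0 < b x := by
        simpa [x] using mul_pos (inv_pos.2 hay) hby
      obtain ⟨t, ht, hb⟩ := ih (fun i => a i - a i x • a i₀) (b - b x • a i₀) (fun z hz => by
        have h1 := h (z - a i₀ z • x) (fun i hi => by
          rcases Finset.mem_insert.1 hi with rfl | hi
          · simp [hx0]
          · have := hz i hi
            simp only [LinearMap.sub_apply, LinearMap.smul_apply, smul_eq_mul, map_sub,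
              map_smul] at this ⊢
            linarith)
        simp only [LinearMap.sub_apply, LinearMap.smul_apply, smul_eq_mul, map_sub,
          map_smul] at h1 ⊢
        linarith)
      refine ⟨Function.update t i₀ (b x - ∑ i ∈ s, t i * a i x), fun i => ?_, ?_⟩
      · by_cases hi : i = i₀
        · subst hi
          rw [Function.update_self, sub_nonneg]
          exact (Finset.sum_nonpos fun i hi =>
            mul_nonpos_of_nonneg_of_nonpos (ht i) (hx i hi)).trans hbx.le
        · simpa [hi] using ht i
      · have h2 : ∑ i ∈ s, Function.update t i₀ (b x - ∑ i ∈ s, t i * a i x) i • a i =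
            ∑ i ∈ s, t i • a i := Finset.sum_congr rfl fun i hi => by
          rw [Function.update_of_ne (ne_of_mem_of_not_mem hi hi₀)]
        have h3 : ∑ i ∈ s, t i • (a i - a i x • a i₀) =
            ∑ i ∈ s, t i • a i - (∑ i ∈ s, t i * a i x) • a i₀ := by
          simp only [smul_sub, Finset.sum_sub_distrib, smul_smul, Finset.sum_smul]
        have h4 : (b x - ∑ i ∈ s, t i * a i x) • a i₀ =
            b x • a i₀ - (∑ i ∈ s, t i * a i x) • a i₀ := by
          ext z
          simp [sub_mul]
        rw [Finset.sum_insert hi₀, Function.update_self, h2, h4]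
        rw [h3, sub_eq_iff_eq_add] at hb
        nth_rw 1 [hb]
        abel

/-- A strictly complementary pair of a nonnegative combination `b = ∑ tᵢ aᵢ` and a point of the
cone `{x | aᵢ x ≤ 0}` with `b x = 0`. -/
theorem exists_strictly_complementary [Fintype ι] (a : ι → Module.Dual K V) (b : Module.Dual K V)
    (h : ∀ x, (∀ i, a i x ≤ 0) → b x ≤ 0) :
    ∃ t : ι → K, (∀ i, 0 ≤ t i) ∧ b = ∑ i, t i • a i ∧
      ∃ x, (∀ i, a i x ≤ 0) ∧ b x = 0 ∧ ∀ i, t i = 0 → a i x < 0 := by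
  classical
  obtain ⟨t₀, ht₀, hb₀⟩ := exists_nonneg_combination Finset.univ a b (by simpa using h)
  -- It suffices to treat one index `k` at a time and to average the solutions. If no point of the
  -- cone with `b x = 0` has `aₖ x < 0`, then `-aₖ` is a nonnegative combination of `-b` and the
  -- `aᵢ`, and this relation is used to make the coefficient of `aₖ` positive.
  have key : ∀ k, ∃ t : ι → K, (∀ i, 0 ≤ t i) ∧ b = ∑ i, t i • a i ∧
      ∃ x, (∀ i, a i x ≤ 0) ∧ b x = 0 ∧ (t k = 0 → a k x < 0) := by
    intro k
    by_cases hk : ∀ x, (∀ i, a i x ≤ 0) → 0 ≤ b x → 0 ≤ a k x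
    · obtain ⟨w, hw, hak⟩ := exists_nonneg_combination Finset.univ
        (fun o : Option ι => o.elim (-b) a) (-a k) (fun x hx => by
          have h1 := hx none (Finset.mem_univ _)
          have h2 := hk x (fun i => hx (some i) (Finset.mem_univ _)) (by simpa using h1)
          simpa using h2)
      rw [Fintype.sum_option] at hak
      simp only [Option.elim_none, Option.elim_some, smul_neg] at hak
      have hpos : 0 < 1 + w none := by linarith [hw none]
      have hk1 : ∀ i, 0 ≤ (if i = k then (1 : K) else 0) := fun i => by split_ifs <;> simp
      have hsum : a k + ∑ i, w (some i) • a i = w none • b := by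
        rw [neg_eq_iff_eq_neg] at hak
        rw [hak]
        abel
      refine ⟨fun i => (1 + w none)⁻¹ * (t₀ i + (if i = k then 1 else 0) + w (some i)),
        fun i => ?_, ?_, 0, by simp, by simp, fun h0 => ?_⟩
      · have := hk1 i
        have := ht₀ i
        have := hw (some i)
        positivity
      · simp only [mul_smul, ← Finset.smul_sum, add_smul, Finset.sum_add_distrib, ite_smul,
          one_smul, zero_smul, Finset.sum_ite_eq', Finset.mem_univ, if_true]
        rw [← hb₀, add_assoc, hsum, eq_inv_smul_iff₀ hpos.ne', add_smul, one_smul]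
      · exfalso
        simp only [if_true, mul_eq_zero, inv_eq_zero, hpos.ne', false_or] at h0
        linarith [ht₀ k, hw (some k)]
    · push Not at hk
      obtain ⟨x, hx, hbx, hak⟩ := hk
      exact ⟨t₀, ht₀, hb₀, x, hx, le_antisymm (h x hx) hbx, fun _ => hak⟩
  choose t ht hb x hx hbx hstrict using key
  have hN : (0 : K) < 1 + Fintype.card ι := by positivity
  refine ⟨fun i => (1 + Fintype.card ι : K)⁻¹ * (t₀ i + ∑ k, t k i), fun i => ?_, ?_,
    ∑ k, x k, fun i => ?_, ?_, fun i hi => ?_⟩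
  · exact mul_nonneg (inv_nonneg.2 hN.le) (add_nonneg (ht₀ i) (Finset.sum_nonneg fun k _ => ht k i))
  · simp only [mul_smul, ← Finset.smul_sum, add_smul, Finset.sum_add_distrib, Finset.sum_smul]
    rw [Finset.sum_comm, ← hb₀, eq_inv_smul_iff₀ hN.ne', add_smul, one_smul]
    congr 1
    simp only [← hb]
    simp [Nat.cast_smul_eq_nsmul]
  · rw [map_sum]
    exact Finset.sum_nonpos fun k _ => hx k i
  · rw [map_sum]
    exact Finset.sum_eq_zero fun k _ => hbx k
  · simp only [mul_eq_zero, inv_eq_zero, hN.ne', false_or] at hi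
    have h1 := Finset.sum_nonneg fun k (_ : k ∈ Finset.univ) => ht k i
    have h2 : t i i ≤ ∑ k, t k i :=
      Finset.single_le_sum (f := fun k => t k i) (fun k _ => ht k i) (Finset.mem_univ i)
    have h3 : t i i = 0 := by linarith [ht₀ i, ht i i]
    rw [map_sum]
    exact Finset.sum_neg' (fun k _ => hx k i) ⟨i, Finset.mem_univ i, hstrict i h3⟩

end Farkas

/-! ### Certificates for critical points -/

section Certificate

variable {ι : Type*} [Fintype ι] {n : ℕ} {E : ι → Fin n →₀ ℕ} {s : ι → ℂ}

/-- If `s` is critical, then `s` has the largest coordinate sum among the points of `s + ℤ^r` that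
do not cross a zero of a critical polynomial: from a point with a larger sum, positive coordinates
of `c` can be lowered until the sum is `1`. -/
theorem IsCritical.sum_nonpos (hs : IsCritical E s) (c : ι → ℤ)
    (hJ : ∀ j, ∀ k : ℕ, s j = k → -(k : ℤ) ≤ c j)
    (hI : ∀ i, ∀ k : ℕ, expForm E s i = -(k + 1) → expForm E c i ≤ k) : ∑ j, c j ≤ 0 := by
  classical
  have key : ∀ N : ℕ, ∀ c : ι → ℤ, (∀ j, ∀ k : ℕ, s j = k → -(k : ℤ) ≤ c j) →
      (∀ i, ∀ k : ℕ, expForm E s i = -(k + 1) → expForm E c i ≤ k) → ∑ j, c j ≠ N + 1 := by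
    intro N
    induction N with
    | zero =>
      intro c hJ hI hsum
      rcases hs c (by simpa using hsum) with ⟨j, k, hk, hlt⟩ | ⟨i, k, hk, hlt⟩
      · have := hJ j k hk
        omega
      · have := hI i k hk
        omega
    | succ N ih =>
      intro c hJ hI hsum
      obtain ⟨j, -, hj⟩ : ∃ j ∈ Finset.univ, 0 < c j := by
        by_contra! hle
        have := Finset.sum_nonpos hle
        omega
      refine ih (c - Pi.single j 1) (fun l k hk => ?_) (fun i k hk => ?_) ?_
      · by_cases hl : l = j
        · subst hl
          simp only [Pi.sub_apply, Pi.single_eq_same]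
          omega
        · simpa [hl] using hJ l k hk
      · rw [expForm_sub, expForm_single]
        have := hI i k hk
        omega
      · simp only [Pi.sub_apply, Finset.sum_sub_distrib, hsum, Finset.sum_pi_single',
          Finset.mem_univ, if_true]
        push_cast
        ring
  by_contra! hpos
  obtain ⟨N, hN⟩ := Int.eq_ofNat_of_zero_le (show 0 ≤ ∑ j, c j - 1 by omega)
  exact key N c hJ hI (by omega)

theorem exists_int_multiple (x : ι → ℚ) :
    ∃ D : ℕ, 0 < D ∧ ∃ c : ι → ℤ, ∀ j, (c j : ℚ) = D * x j := by
  refine ⟨∏ j, (x j).den, Finset.prod_pos fun j _ => (x j).den_pos, ?_⟩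
  have h : ∀ j, ∃ c : ℤ, (c : ℚ) = ((∏ j, (x j).den : ℕ) : ℚ) * x j := by
    intro j
    obtain ⟨d, hd⟩ := Finset.dvd_prod_of_mem (fun j => (x j).den) (Finset.mem_univ j)
    refine ⟨d * (x j).num, ?_⟩
    rw [hd]
    push_cast
    nth_rw 3 [← Rat.num_div_den (x j)]
    have := (x j).den_pos.ne'
    field_simp
  choose c hc using h
  exact ⟨c, hc⟩

/-- A critical point `s` is certified by a rational form `∑ tᵢ xᵢ` that is at least `1` on the
exponents, with coefficients supported on the `i` for which `ℓᵢ(s)` is a negative integer, and equal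
to `1` on the exponents `aⱼ` for which `sⱼ` is not a natural number. The vector `c` witnesses that
the supports of `t` and of `m` are as large as possible. -/
theorem IsCritical.exists_certificate (hs : IsCritical E s) :
    ∃ (t : Fin n → ℚ) (m : ι → ℚ) (c : ι → ℤ), (∀ i, 0 ≤ t i) ∧ (∀ j, 0 ≤ m j) ∧
      (∀ i, t i ≠ 0 → ∃ k : ℕ, expForm E s i = -(k + 1)) ∧
      (∀ j, m j ≠ 0 → ∃ k : ℕ, s j = k) ∧ (∀ j, ∑ i, t i * E j i = 1 + m j) ∧ ∑ j, c j = 0 ∧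
      (∀ j, (∃ k : ℕ, s j = k) → 0 ≤ c j ∧ (m j = 0 → 0 < c j)) ∧
      ∀ i, (∃ k : ℕ, expForm E s i = -(k + 1)) →
        expForm E c i ≤ 0 ∧ (t i = 0 → expForm E c i < 0) := by
  classical
  let J : ι → Prop := fun j => ∃ k : ℕ, s j = k
  let I : Fin n → Prop := fun i => ∃ k : ℕ, expForm E s i = -(k + 1)
  let φ : Fin n → Module.Dual ℚ (ι → ℚ) := fun i => ∑ j, (E j i : ℚ) • LinearMap.proj j
  have hφ : ∀ i x, φ i x = expForm E x i := fun i x => by simp [φ, expForm]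
  let σ : Module.Dual ℚ (ι → ℚ) := ∑ j, LinearMap.proj j
  have hσ : ∀ x, σ x = ∑ j, x j := fun x => by simp [σ]
  -- The cone `sⱼ ≥ 0` for `j ∈ J` and `ℓᵢ ≤ 0` for `i ∈ I` lies in the half-space `∑ sⱼ ≤ 0`.
  let A : {j // J j} ⊕ {i // I i} → Module.Dual ℚ (ι → ℚ) :=
    Sum.elim (fun j => -LinearMap.proj j.1) fun i => φ i.1
  obtain ⟨t, ht, hsum, x, hx, hx0, hstrict⟩ := exists_strictly_complementary A σ (by
    intro x hx
    obtain ⟨D, hD, c, hc⟩ := exists_int_multiple x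
    have hD' : (0 : ℚ) < D := by exact_mod_cast hD
    have h1 := hs.sum_nonpos c (fun j k hk => by
      have h2 : 0 ≤ x j := by simpa [A] using hx (Sum.inl ⟨j, k, hk⟩)
      have h3 : (0 : ℚ) ≤ c j := by rw [hc]; positivity
      have h4 : 0 ≤ c j := by exact_mod_cast h3
      omega) (fun i k hk => by
      have h2 : expForm E x i ≤ 0 := by simpa [A, hφ] using hx (Sum.inr ⟨i, k, hk⟩)
      have h3 : ((expForm E c i : ℤ) : ℚ) = D * expForm E x i := by
        rw [intCast_expForm, ← expForm_smul]
        congr 1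
        ext j
        simp [hc]
      have h4 : ((expForm E c i : ℤ) : ℚ) ≤ 0 := by
        rw [h3]
        exact mul_nonpos_of_nonneg_of_nonpos hD'.le h2
      have h5 : expForm E c i ≤ 0 := by exact_mod_cast h4
      omega)
    have h2 : ((∑ j, c j : ℤ) : ℚ) = D * σ x := by
      rw [hσ, Finset.mul_sum]
      push_cast
      exact Finset.sum_congr rfl fun j _ => hc j
    have h3 : (D : ℚ) * σ x ≤ 0 := by
      rw [← h2]
      exact_mod_cast h1
    exact nonpos_of_mul_nonpos_right h3 hD')
  obtain ⟨D, hD, c, hc⟩ := exists_int_multiple x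
  have hD' : (0 : ℚ) < D := by exact_mod_cast hD
  have hcform : ∀ i, ((expForm E c i : ℤ) : ℚ) = D * expForm E x i := fun i => by
    rw [intCast_expForm, ← expForm_smul]
    congr 1
    ext j
    simp [hc]
  refine ⟨fun i => if h : I i then t (Sum.inr ⟨i, h⟩) else 0,
    fun j => if h : J j then t (Sum.inl ⟨j, h⟩) else 0, c, fun i => ?_, fun j => ?_, fun i hi => ?_,
    fun j hj => ?_, fun j => ?_, ?_, fun j hj => ?_, fun i hi => ?_⟩
  · beta_reduce
    split_ifs
    · exact ht _
    · exact le_rfl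
  · beta_reduce
    split_ifs
    · exact ht _
    · exact le_rfl
  · by_contra h
    exact hi (dif_neg h)
  · by_contra h
    exact hj (dif_neg h)
  · have h1 := LinearMap.congr_fun hsum (Pi.single j 1)
    simp only [hσ, Fintype.sum_sum_type, LinearMap.add_apply, LinearMap.sum_apply,
      LinearMap.smul_apply, A, Sum.elim_inl, Sum.elim_inr, hφ, expForm_single, LinearMap.neg_apply,
      LinearMap.proj_apply, smul_eq_mul, mul_one, Finset.sum_pi_single', Finset.mem_univ,
      if_true] at h1
    have h2 : ∑ i, (if h : I i then t (Sum.inr ⟨i, h⟩) else 0) * (E j i : ℚ) =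
        ∑ i : {i // I i}, t (Sum.inr i) * (E j i : ℚ) := by
      simp only [dite_mul, zero_mul]
      have h4 : ∑ i : {i // ¬ I i}, (if h : I i then t (Sum.inr ⟨i, h⟩) * (E j i : ℚ) else 0) = 0 :=
        Finset.sum_eq_zero fun i _ => dif_neg i.2
      rw [← Fintype.sum_subtype_add_sum_subtype I, h4, add_zero]
      exact Finset.sum_congr rfl fun i _ => dif_pos i.2
    have h3 : ∑ k : {j // J j}, t (Sum.inl k) * -(Pi.single j 1 : ι → ℚ) k =
        -(if h : J j then t (Sum.inl ⟨j, h⟩) else 0) := by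
      split_ifs with h
      · rw [Fintype.sum_eq_single ⟨j, h⟩]
        · simp
        · intro k hk
          have : k.1 ≠ j := fun e => hk (Subtype.ext e)
          simp [this]
      · rw [neg_zero]
        refine Finset.sum_eq_zero fun k _ => ?_
        have : k.1 ≠ j := fun e => h (e ▸ k.2)
        simp [this]
    rw [h2]
    rw [h3] at h1
    linarith
  · have h1 : ((∑ j, c j : ℤ) : ℚ) = D * σ x := by
      rw [hσ, Finset.mul_sum]
      push_cast
      exact Finset.sum_congr rfl fun j _ => hc j
    rw [hx0, mul_zero] at h1
    exact_mod_cast h1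
  · have h1 : 0 ≤ x j := by simpa [A] using hx (Sum.inl ⟨j, hj⟩)
    constructor
    · have : (0 : ℚ) ≤ c j := by rw [hc]; positivity
      exact_mod_cast this
    · intro h0
      beta_reduce at h0
      rw [dif_pos (show J j from hj)] at h0
      have h2 : 0 < x j := by simpa [A] using hstrict _ h0
      have : (0 : ℚ) < c j := by rw [hc]; positivity
      exact_mod_cast this
  · have h1 : expForm E x i ≤ 0 := by simpa [A, hφ] using hx (Sum.inr ⟨i, hi⟩)
    constructor
    · have : ((expForm E c i : ℤ) : ℚ) ≤ 0 := by
        rw [hcform]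
        exact mul_nonpos_of_nonneg_of_nonpos hD'.le h1
      exact_mod_cast this
    · intro h0
      beta_reduce at h0
      rw [dif_pos (show I i from hi)] at h0
      have h2 : expForm E x i < 0 := by simpa [A, hφ] using hstrict _ h0
      have : ((expForm E c i : ℤ) : ℚ) < 0 := by
        rw [hcform]
        exact mul_neg_of_pos_of_neg hD' h2
      exact_mod_cast this

end Certificate

/-! ### Faces of the Newton polyhedron and critical points -/

section Faces

variable {n : ℕ} {a : Ideal (MvPolynomial (Fin n) ℂ)} {Q : Set (Fin n → ℝ)}

theorem mem_expSet_of_le {u v : Fin n → ℤ} (hu : u ∈ expSet a) (huv : u ≤ v) : v ∈ expSet a := by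
  obtain ⟨m, hm, hum⟩ := hu
  let d : Fin n →₀ ℕ := Finsupp.equivFunOnFinite.symm fun i => (v i - u i).toNat
  refine ⟨d + m, ?_, fun i => ?_⟩
  · have : monomial (d + m) (1 : ℂ) = monomial d 1 * monomial m 1 := by
      rw [monomial_mul, one_mul]
    rw [this]
    exact a.mul_mem_left _ hm
  · have h1 := hum i
    have h2 : u i ≤ v i := huv i
    simp only [d, Finsupp.add_apply, Finsupp.equivFunOnFinite_symm_apply_apply]
    push_cast
    omega

theorem toReal_mem_newtonPolyhedron {u : Fin n → ℤ} (hu : u ∈ expSet a) :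
    toReal u ∈ newtonPolyhedron a := subset_convexHull _ _ ⟨u, hu, rfl⟩

/-- The generators `u - v` of the semigroup `S_Q`. -/
abbrev faceDiffs (a : Ideal (MvPolynomial (Fin n) ℂ)) (Q : Set (Fin n → ℝ)) : Set (Fin n → ℤ) :=
  {d | ∃ u ∈ expSet a, ∃ v ∈ expSetOn a Q, d = u - v}

/-- An integral combination of exponents belongs to `S_Q`, up to a multiple of `v₀` and a vector of
natural numbers, if only exponents on the face have negative coefficients. -/
theorem sum_smul_mem_closure {κ : Type*} (T : Finset κ) (p : κ → Fin n → ℤ)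
    (hp : ∀ j ∈ T, p j ∈ expSet a) (c : κ → ℤ) (hc : ∀ j ∈ T, c j < 0 → toReal (p j) ∈ Q)
    {v₀ : Fin n → ℤ} (hv₀ : v₀ ∈ expSetOn a Q) {w : Fin n → ℤ} (hw : 0 ≤ w) :
    ∑ j ∈ T, c j • (p j - v₀) + w ∈ AddSubsemigroup.closure (faceDiffs a Q) := by
  classical
  have hzero : (0 : Fin n → ℤ) ∈ AddSubsemigroup.closure (faceDiffs a Q) :=
    AddSubsemigroup.subset_closure ⟨v₀, hv₀.1, v₀, hv₀, (sub_self v₀).symm⟩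
  have hnsmul : ∀ (k : ℕ) (x : Fin n → ℤ), x ∈ AddSubsemigroup.closure (faceDiffs a Q) →
      (k : ℤ) • x ∈ AddSubsemigroup.closure (faceDiffs a Q) := by
    intro k x hx
    induction k with
    | zero => simpa using hzero
    | succ k ih =>
      push_cast
      rw [add_smul, one_smul]
      exact add_mem ih hx
  induction T using Finset.induction_on with
  | empty =>
    rw [Finset.sum_empty, zero_add]
    refine AddSubsemigroup.subset_closure ⟨v₀ + w, mem_expSet_of_le hv₀.1 ?_, v₀, hv₀, by simp⟩
    exact le_add_of_nonneg_right hw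
  | insert j T hj ih =>
    rw [Finset.sum_insert hj, add_assoc]
    refine add_mem ?_ (ih (fun k hk => hp k (Finset.mem_insert_of_mem hk))
      fun k hk => hc k (Finset.mem_insert_of_mem hk))
    have hpj := hp j (Finset.mem_insert_self _ _)
    rcases le_or_gt 0 (c j) with h0 | h0
    · obtain ⟨k, hk⟩ := Int.eq_ofNat_of_zero_le h0
      rw [hk]
      exact hnsmul k _ (AddSubsemigroup.subset_closure ⟨p j, hpj, v₀, hv₀, rfl⟩)
    · obtain ⟨k, hk⟩ := Int.eq_ofNat_of_zero_le (show 0 ≤ -c j by omega)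
      have h1 : c j • (p j - v₀) = (k : ℤ) • (v₀ - p j) := by
        rw [← neg_sub (p j) v₀, smul_neg, ← neg_smul, ← hk, neg_neg]
      rw [h1]
      exact hnsmul k _ (AddSubsemigroup.subset_closure ⟨v₀, hv₀.1, p j,
        ⟨hpj, hc j (Finset.mem_insert_self _ _) h0⟩, rfl⟩)

/-- The exponent `m`, as a vector of integers. -/
def intVec (m : Fin n →₀ ℕ) : Fin n → ℤ := fun i => m i

theorem intVec_mem_expSet {m : Fin n →₀ ℕ} : intVec m ∈ expSet a ↔ monomial m (1 : ℂ) ∈ a := by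
  constructor
  · rintro ⟨k, hk, h⟩
    have : m = k := by
      ext i
      have := h i
      simpa [intVec] using this
    rwa [this]
  · intro h
    exact ⟨m, h, fun _ => rfl⟩

/-- A face is spanned by the exponents that it contains. -/
theorem IsProperFace.span_le (hQ : IsProperFace (newtonPolyhedron a) Q) :
    Submodule.span ℝ Q ≤ Submodule.span ℝ
      ((fun m => toReal (intVec m)) '' {m | monomial m (1 : ℂ) ∈ a ∧ toReal (intVec m) ∈ Q}) := by
  rw [Submodule.span_le]
  intro x hx
  obtain ⟨hne, -, hexp⟩ := hQ
  obtain ⟨l, hl⟩ := hexp hne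
  rw [hl] at hx
  obtain ⟨hxP, hmax⟩ := hx
  obtain ⟨κ, _, w, z, hw, hw1, hz, hzx⟩ := mem_convexHull_iff_exists_fintype.1 hxP
  have hle : ∀ i, l (z i) ≤ l x := fun i => hmax _ (subset_convexHull ℝ _ (hz i))
  have hsum : ∑ i, w i * (l x - l (z i)) = 0 := by
    simp only [mul_sub, Finset.sum_sub_distrib, ← Finset.sum_mul, hw1, one_mul]
    rw [← hzx, map_sum]
    simp
  have hzero := (Finset.sum_eq_zero_iff_of_nonneg fun i _ =>
    mul_nonneg (hw i) (sub_nonneg.2 (hle i))).1 hsum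
  rw [← hzx]
  refine Submodule.sum_mem _ fun i _ => ?_
  rcases eq_or_ne (w i) 0 with h0 | h0
  · simp [h0]
  · refine Submodule.smul_mem _ _ (Submodule.subset_span ?_)
    obtain ⟨u, ⟨m, hm, hum⟩, hui⟩ := hz i
    have hu : u = intVec m := funext hum
    subst hu
    refine ⟨m, ⟨hm, ?_⟩, hui⟩
    have h1 : l x = l (z i) := by
      have := (mul_eq_zero.1 (hzero i (Finset.mem_univ i))).resolve_left h0
      linarith
    change toReal (intVec m) ∈ Q
    rw [hui, hl]
    exact ⟨subset_convexHull ℝ _ (hz i), fun y hy => h1 ▸ hmax y hy⟩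

/-- The elements of `S_Q`, as integral combinations of exponents with total weight zero. -/
theorem exists_combination_of_mem_closure {m : Fin n → ℤ}
    (hm : m ∈ AddSubsemigroup.closure (faceDiffs a Q)) :
    (∃ v, v ∈ expSetOn a Q) ∧ ∃ c : (Fin n →₀ ℕ) →₀ ℤ, (∀ k, c k ≠ 0 → monomial k (1 : ℂ) ∈ a) ∧
      (∀ k, c k < 0 → toReal (intVec k) ∈ Q) ∧ (c.sum fun _ z => z) = 0 ∧
        (c.sum fun k z => z • intVec k) = m := by
  classical
  induction hm using AddSubsemigroup.closure_induction with
  | mem x hx =>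
    obtain ⟨u, ⟨k, hk, huk⟩, v, hv, rfl⟩ := hx
    refine ⟨⟨v, hv⟩, ?_⟩
    obtain ⟨⟨k', hk', hvk⟩, hvQ⟩ := hv
    obtain rfl : u = intVec k := funext huk
    obtain rfl : v = intVec k' := funext hvk
    refine ⟨Finsupp.single k 1 - Finsupp.single k' 1, fun l hl => ?_, fun l hl => ?_, ?_, ?_⟩
    · by_cases h1 : l = k
      · rwa [h1]
      · by_cases h2 : l = k'
        · rwa [h2]
        · simp [h1, h2] at hl
    · by_contra h3
      have h2 : l ≠ k' := fun h2 => h3 (h2 ▸ hvQ)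
      rw [Finsupp.sub_apply, Finsupp.single_eq_of_ne h2, sub_zero, Finsupp.single_apply] at hl
      split_ifs at hl <;> omega
    · rw [Finsupp.sum_sub_index] <;> simp
    · rw [Finsupp.sum_sub_index] <;> simp [sub_smul]
  | add x y _ _ hx hy =>
    obtain ⟨hv, c, hc1, hc2, hc3, hc4⟩ := hx
    obtain ⟨-, d, hd1, hd2, hd3, hd4⟩ := hy
    refine ⟨hv, c + d, fun l hl => ?_, fun l hl => ?_, ?_, ?_⟩
    · by_cases h1 : c l = 0
      · exact hd1 l (fun h2 => hl (by simp [h1, h2]))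
      · exact hc1 l h1
    · rw [Finsupp.add_apply] at hl
      rcases lt_or_ge (c l) 0 with h1 | h1
      · exact hc2 l h1
      · exact hd2 l (by omega)
    · rw [Finsupp.sum_add_index'] <;> simp [hc3, hd3]
    · rw [Finsupp.sum_add_index' (h := fun k z => z • intVec k) (fun _ => zero_smul _ _)
        (fun _ _ _ => add_smul _ _ _), hc4, hd4]

theorem exists_finset_span_eq (hmon : IsMonomialIdeal a) : ∃ G : Finset (Fin n →₀ ℕ),
    a = Ideal.span ((fun u => monomial u (1 : ℂ)) '' (G : Set (Fin n →₀ ℕ))) := by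
  classical
  obtain ⟨S, hS⟩ := hmon
  have hfg : (Submodule.span (MvPolynomial (Fin n) ℂ)
      ((fun u => monomial u (1 : ℂ)) '' S)).FG := IsNoetherian.noetherian _
  obtain ⟨s', hs', hspan⟩ := Submodule.fg_span_iff_fg_span_finset_subset _ |>.1 hfg
  obtain ⟨G, hG, rfl⟩ := Finset.subset_set_image_iff.1 hs'
  refine ⟨G, ?_⟩
  rw [hS]
  exact hspan.trans (by rw [Finset.coe_image])

theorem span_monomials_eq_of_subset {G T : Finset (Fin n →₀ ℕ)}
    (hG : a = Ideal.span ((fun u => monomial u (1 : ℂ)) '' (G : Set (Fin n →₀ ℕ)))) (hGT : G ⊆ T)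
    (hT : ∀ m ∈ T, monomial m (1 : ℂ) ∈ a) :
    a = Ideal.span (Set.range fun j : T => monomial j.1 (1 : ℂ)) := by
  apply le_antisymm
  · rw [hG, Ideal.span_le]
    rintro _ ⟨m, hm, rfl⟩
    exact Ideal.subset_span ⟨⟨m, hGT hm⟩, rfl⟩
  · rw [Ideal.span_le]
    rintro _ ⟨j, rfl⟩
    exact hT j.1 j.2

/-- Every element of `R_Q` is the coordinate sum of a critical point of some monomial system of
generators. If `u = ∑ βⱼ aⱼ` with the `aⱼ` on the face and `u = e + ∑ c₀ⱼ aⱼ` with `∑ c₀ⱼ = 0`, the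
critical point is `s = c₀ - β`, at which all forms `ℓᵢ` are equal to `-1`; a vector `c` that
violates the criticality of `s` would show that `u ∈ M_Q'`. -/
theorem exists_isCritical_of_mem_faceRoots (hmon : IsMonomialIdeal a)
    (hQ : IsProperFace (newtonPolyhedron a) Q) {z : ℂ} (hz : z ∈ faceRoots a Q) :
    ∃ T : Finset (Fin n →₀ ℕ), a = Ideal.span (Set.range fun j : T => monomial j.1 (1 : ℂ)) ∧
      ∃ s : T → ℂ, IsCritical (fun j : T => j.1) s ∧ ∑ j, s j = z := by
  classical
  obtain ⟨l, hl, u, ⟨m, hm, hum⟩, huM', hspan, rfl⟩ := hz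
  obtain ⟨⟨v₀, hv₀⟩, c₀, hc1, hc2, hc3, hc4⟩ := exists_combination_of_mem_closure hm
  obtain ⟨G, hG⟩ := exists_finset_span_eq hmon
  obtain ⟨β, hβ, hβu⟩ := (Finsupp.mem_span_image_iff_linearCombination ℝ).1 (hQ.span_le hspan)
  have hβ' : ∀ k, β k ≠ 0 → monomial k (1 : ℂ) ∈ a ∧ toReal (intVec k) ∈ Q := fun k hk =>
    hβ (Finsupp.mem_support_iff.2 hk)
  let T := G ∪ β.support ∪ c₀.support
  have hT : ∀ k ∈ T, monomial k (1 : ℂ) ∈ a := by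
    intro k hk
    rcases Finset.mem_union.1 hk with hk | hk
    · rcases Finset.mem_union.1 hk with hk | hk
      · rw [hG]
        exact Ideal.subset_span ⟨k, hk, rfl⟩
      · exact (hβ' k (Finsupp.mem_support_iff.1 hk)).1
    · exact hc1 k (Finsupp.mem_support_iff.1 hk)
  have hGT : G ⊆ T := fun k hk => Finset.mem_union_left _ (Finset.mem_union_left _ hk)
  have hβT : β.support ⊆ T := fun k hk => Finset.mem_union_left _ (Finset.mem_union_right _ hk)
  have hcT : c₀.support ⊆ T := fun k hk => Finset.mem_union_right _ hk
  have hcsum : ∑ j : T, c₀ j = 0 := by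
    rw [Finset.sum_coe_sort T (fun k => c₀ k), ← hc3, Finsupp.sum_of_support_subset c₀ hcT]
    simp
  have hcform : expForm (fun j : T => j.1) (fun j => c₀ j) = m := by
    ext i
    rw [← hc4, Finsupp.sum_of_support_subset c₀ hcT _ (by simp), Finset.sum_apply]
    simp only [expForm, intVec, Pi.smul_apply, smul_eq_mul]
    rw [Finset.sum_coe_sort T (fun k => (k i : ℤ) * c₀ k)]
    exact Finset.sum_congr rfl fun k _ => mul_comm _ _
  have hβform : ∀ i, ∑ j : T, (j.1 i : ℝ) * β j = u i := by
    intro i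
    have := congrFun hβu i
    rw [Finsupp.linearCombination_apply, Finsupp.sum_of_support_subset β hβT _ (by simp),
      Finset.sum_apply] at this
    rw [Finset.sum_coe_sort T (fun k => (k i : ℝ) * β k)]
    refine Eq.trans (Finset.sum_congr rfl fun k _ => ?_) this
    simp [toReal, intVec, mul_comm]
  refine ⟨T, span_monomials_eq_of_subset hG hGT hT,
    fun j => ((-β j + c₀ j : ℝ) : ℂ), ?_, ?_⟩
  · have hform : ∀ i, expForm (fun j : T => j.1) (fun j => ((-β j + c₀ j : ℝ) : ℂ)) i =
        -((0 : ℕ) + 1) := by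
      intro i
      have h1 : expForm (fun j : T => j.1) (fun j => ((-β j + c₀ j : ℝ) : ℂ)) i =
          ((-(∑ j : T, (j.1 i : ℝ) * β j) +
            (expForm (fun j : T => j.1) (fun j => c₀ j) i : ℤ) : ℝ) : ℂ) := by
        simp only [expForm]
        push_cast
        rw [← Finset.sum_neg_distrib, ← Finset.sum_add_distrib]
        exact Finset.sum_congr rfl fun j _ => by ring
      rw [h1, hβform, hcform, hum]
      push_cast [Pi.add_apply, Pi.one_apply]
      ring
    intro c hc
    by_contra! hcon
    obtain ⟨hJ, hI⟩ := hcon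
    apply huM'
    refine ⟨v₀, hv₀, u - v₀, ⟨u - v₀ - 1, ?_, by abel⟩, by abel⟩
    have h1 := sum_smul_mem_closure (a := a) (Q := Q) (Finset.univ : Finset T)
      (fun j => intVec j.1) (fun j _ => intVec_mem_expSet.2 (hT j.1 j.2)) (fun j => c j + c₀ j)
      (fun j _ hj => by
        by_contra hjQ
        have hβ0 : β j = 0 := by
          by_contra h
          exact hjQ (hβ' _ h).2
        have hc0 : 0 ≤ c₀ j := by
          by_contra! h
          exact hjQ (hc2 _ h)
        obtain ⟨k, hk⟩ := Int.eq_ofNat_of_zero_le hc0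
        have := hJ j k (by simp [hβ0, hk])
        omega) hv₀ (w := fun i => -expForm (fun j : T => j.1) c i) (fun i => by
        have := hI i 0 (hform i)
        simpa using this)
    convert h1 using 1
    have h2 : ∑ j : T, (c j + c₀ j) • (intVec j.1 - v₀) =
        expForm (fun j : T => j.1) c + expForm (fun j : T => j.1) (fun j => c₀ j) - v₀ := by
      ext i
      have h3 : v₀ i = (∑ j : T, (c j + c₀ j)) * v₀ i := by
        rw [Finset.sum_add_distrib, hc, hcsum]
        simp
      simp only [Finset.sum_apply, Pi.smul_apply, Pi.sub_apply, Pi.add_apply, smul_eq_mul, mul_sub,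
        Finset.sum_sub_distrib, ← Finset.sum_mul]
      rw [← h3]
      simp only [expForm, ← Finset.sum_add_distrib, intVec]
      congr 1
      exact Finset.sum_congr rfl fun j _ => by ring
    rw [h2, hcform, hum]
    ext i
    simp
    ring
  · have h1 : (∑ i, (l i : ℝ) * u i) = ∑ j : T, β j := by
      simp only [← hβform, Finset.mul_sum]
      rw [Finset.sum_comm]
      refine Finset.sum_congr rfl fun j _ => ?_
      rcases eq_or_ne (β j) 0 with h0 | h0
      · simp [h0]
      · have h2 := hl _ (hβ' _ h0).2
        simp only [toReal, intVec, Int.cast_natCast] at h2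
        simp only [← mul_assoc, ← Finset.sum_mul, h2, one_mul]
    have h3 : ((∑ i, l i * (u i : ℚ) : ℚ) : ℂ) = ((∑ i, (l i : ℝ) * u i : ℝ) : ℂ) := by
      push_cast
      rfl
    rw [h3, h1]
    push_cast
    rw [Finset.sum_add_distrib, Finset.sum_neg_distrib]
    have h4 : ∑ j : T, ((c₀ j : ℤ) : ℂ) = 0 := by exact_mod_cast congrArg (Int.cast (R := ℂ)) hcsum
    rw [h4, add_zero]

end Faces

/-! ### The face attached to a critical point -/

section CriticalFace

variable {ι : Type*} {n : ℕ} {a : Ideal (MvPolynomial (Fin n) ℂ)}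
  {E : ι → Fin n →₀ ℕ} {t : Fin n → ℚ} {m : ι → ℚ}

theorem exists_le_of_monomial_mem (hE : a = Ideal.span (Set.range fun j => monomial (E j) (1 : ℂ)))
    {k : Fin n →₀ ℕ} (hk : monomial k (1 : ℂ) ∈ a) : ∃ j, E j ≤ k := by
  have h : (Set.range fun j => monomial (E j) (1 : ℂ)) =
      (fun u => monomial u (1 : ℂ)) '' Set.range E := by
    rw [← Set.range_comp]
    rfl
  rw [hE, h, mem_ideal_span_monomial_image] at hk
  obtain ⟨_, ⟨j, rfl⟩, hj⟩ := hk k (by simp [support_monomial])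
  exact ⟨j, hj⟩

/-- The part of the Newton polyhedron on which the form `∑ tᵢ xᵢ` takes the value `1`. -/
def formFace (a : Ideal (MvPolynomial (Fin n) ℂ)) (t : Fin n → ℚ) : Set (Fin n → ℝ) :=
  {x | x ∈ newtonPolyhedron a ∧ ∑ i, (t i : ℝ) * x i = 1}

theorem toReal_mem_formFace {u : Fin n → ℤ} (hu : u ∈ expSet a) :
    toReal u ∈ formFace a t ↔ ∑ i, t i * u i = 1 := by
  rw [formFace, Set.mem_ofPred_eq, and_iff_right (toReal_mem_newtonPolyhedron hu)]
  simp only [toReal]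
  norm_cast

/-- The form `∑ tᵢ xᵢ` is at least `1` on the Newton polyhedron if it is so on the generators. -/
theorem one_le_of_mem_newtonPolyhedron
    (hE : a = Ideal.span (Set.range fun j => monomial (E j) (1 : ℂ)))
    (ht : ∀ i, 0 ≤ t i) (hm : ∀ j, 0 ≤ m j) (htm : ∀ j, ∑ i, t i * E j i = 1 + m j)
    {x : Fin n → ℝ} (hx : x ∈ newtonPolyhedron a) : 1 ≤ ∑ i, (t i : ℝ) * x i := by
  let l : (Fin n → ℝ) →ₗ[ℝ] ℝ := ∑ i, (t i : ℝ) • LinearMap.proj i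
  have hl : ∀ y, l y = ∑ i, (t i : ℝ) * y i := fun y => by simp [l]
  have hconv : Convex ℝ {y | 1 ≤ l y} := convex_halfSpace_ge l.isLinear 1
  have hsub : toReal '' expSet a ⊆ {y | 1 ≤ l y} := by
    rintro _ ⟨u, ⟨k, hk, huk⟩, rfl⟩
    obtain ⟨j, hj⟩ := exists_le_of_monomial_mem hE hk
    rw [Set.mem_ofPred_eq, hl]
    have h1 : (1 : ℚ) ≤ ∑ i, t i * u i := by
      calc (1 : ℚ) ≤ ∑ i, t i * E j i := by rw [htm]; linarith [hm j]
        _ ≤ ∑ i, t i * u i := Finset.sum_le_sum fun i _ => by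
          refine mul_le_mul_of_nonneg_left ?_ (ht i)
          rw [huk]
          exact_mod_cast hj i
    simp only [toReal]
    exact_mod_cast h1
  rw [← hl]
  exact convexHull_min hsub hconv hx

/-- A form that is at least `1` on the exponents, with equality at some exponent, cuts out a proper
face of the Newton polyhedron. -/
theorem isProperFace_formFace
    (hE : a = Ideal.span (Set.range fun j => monomial (E j) (1 : ℂ)))
    (ht : ∀ i, 0 ≤ t i) (hm : ∀ j, 0 ≤ m j) (htm : ∀ j, ∑ i, t i * E j i = 1 + m j) {k₀ : ι}
    (hk₀ : m k₀ = 0) : IsProperFace (newtonPolyhedron a) (formFace a t) := by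
  have hmem : intVec (E k₀) ∈ expSet a := intVec_mem_expSet.2 (hE ▸ Ideal.subset_span ⟨k₀, rfl⟩)
  have hx₀ : toReal (intVec (E k₀)) ∈ formFace a t := by
    rw [toReal_mem_formFace hmem]
    simpa [intVec, hk₀] using htm k₀
  refine ⟨⟨_, hx₀⟩, fun h => ?_, fun _ => ?_⟩
  · obtain ⟨i, hi⟩ : ∃ i, t i ≠ 0 := by
      by_contra! h0
      have := htm k₀
      simp [h0, hk₀] at this
    have hmem' : intVec (E k₀) + Pi.single i 1 ∈ expSet a :=
      mem_expSet_of_le hmem (le_add_of_nonneg_right (Pi.single_nonneg.2 zero_le_one))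
    have h1 := toReal_mem_newtonPolyhedron hmem'
    rw [← h, toReal_mem_formFace hmem'] at h1
    have h2 := htm k₀
    simp only [Pi.add_apply, intVec, Int.cast_add, Int.cast_natCast, mul_add,
      Finset.sum_add_distrib, h2, hk₀, add_zero, Pi.single_apply] at h1
    simp [hi] at h1
  · let l : StrongDual ℝ (Fin n → ℝ) := -∑ i, (t i : ℝ) • ContinuousLinearMap.proj i
    have hl : ∀ y, l y = -∑ i, (t i : ℝ) * y i := fun y => by simp [l]
    refine ⟨l, ?_⟩
    ext x
    refine and_congr_right fun hx => ⟨fun h y hy => ?_, fun h => ?_⟩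
    · rw [hl, hl, h]
      linarith [one_le_of_mem_newtonPolyhedron hE ht hm htm hy]
    · have h1 := h _ hx₀.1
      rw [hl, hl, hx₀.2] at h1
      exact le_antisymm (by linarith) (one_le_of_mem_newtonPolyhedron hE ht hm htm hx)

/-- Elements of the semigroup of `formFace a t` are bounded from below, in the coordinates `i` with
`tᵢ ≠ 0`, by combinations of the generators. -/
theorem exists_le_of_mem_closure [Fintype ι]
    (hE : a = Ideal.span (Set.range fun j => monomial (E j) (1 : ℂ)))
    (ht : ∀ i, 0 ≤ t i) (hm : ∀ j, 0 ≤ m j) (htm : ∀ j, ∑ i, t i * E j i = 1 + m j)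
    {w : Fin n → ℤ} (hw : w ∈ AddSubsemigroup.closure (faceDiffs a (formFace a t))) :
    ∃ c : ι → ℤ, ∑ j, c j = 0 ∧ (∀ j, m j ≠ 0 → 0 ≤ c j) ∧
      ∀ i, t i ≠ 0 → expForm E c i ≤ w i := by
  classical
  induction hw using AddSubsemigroup.closure_induction with
  | mem x hx =>
    obtain ⟨u, ⟨k, hk, huk⟩, v, ⟨hv, hvQ⟩, rfl⟩ := hx
    rw [toReal_mem_formFace hv] at hvQ
    obtain ⟨k', hk', hvk⟩ := hv
    obtain ⟨j, hj⟩ := exists_le_of_monomial_mem hE hk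
    obtain ⟨j', hj'⟩ := exists_le_of_monomial_mem hE hk'
    have hterm : ∀ i, 0 ≤ t i * ((v i : ℚ) - E j' i) := fun i => by
      refine mul_nonneg (ht i) (sub_nonneg.2 ?_)
      rw [hvk]
      exact_mod_cast hj' i
    have hsum : ∑ i, t i * ((v i : ℚ) - E j' i) = -m j' := by
      simp only [mul_sub, Finset.sum_sub_distrib, hvQ, htm]
      ring
    have hmj' : m j' = 0 := by
      have := Finset.sum_nonneg fun i (_ : i ∈ Finset.univ) => hterm i
      linarith [hm j']
    rw [hmj', neg_zero] at hsum
    have hzero := (Finset.sum_eq_zero_iff_of_nonneg fun i _ => hterm i).1 hsum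
    refine ⟨Pi.single j 1 - Pi.single j' 1, by simp, fun l hl => ?_, fun i hi => ?_⟩
    · have : l ≠ j' := fun h => hl (h ▸ hmj')
      rw [Pi.sub_apply, Pi.single_eq_of_ne this, sub_zero]
      exact (Pi.single_nonneg.2 zero_le_one : (0 : ι → ℤ) ≤ Pi.single j 1) l
    · rw [expForm_sub, expForm_single, expForm_single, Pi.sub_apply, huk i]
      have h1 := (mul_eq_zero.1 (hzero i (Finset.mem_univ i))).resolve_left hi
      have h2 : v i = E j' i := by
        have : (v i : ℚ) = E j' i := sub_eq_zero.1 h1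
        exact_mod_cast this
      have h3 := hj i
      simp only [mul_one]
      omega
  | add x y _ _ hx hy =>
    obtain ⟨c, hc1, hc2, hc3⟩ := hx
    obtain ⟨d, hd1, hd2, hd3⟩ := hy
    refine ⟨c + d, by simp [Finset.sum_add_distrib, hc1, hd1], fun j hj => ?_, fun i hi => ?_⟩
    · exact add_nonneg (hc2 j hj) (hd2 j hj)
    · rw [expForm_add]
      exact add_le_add (hc3 i hi) (hd3 i hi)

variable [Fintype ι] {s : ι → ℂ}

/-- The coordinate sum of a critical point of a monomial system of generators belongs to `R_Q` for
some proper face `Q` that is contained in no coordinate hyperplane. -/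
theorem IsCritical.exists_sum_mem_faceRoots (ha : a ≠ ⊥)
    (hE : a = Ideal.span (Set.range fun j => monomial (E j) (1 : ℂ))) (hs : IsCritical E s) :
    ∃ Q, IsProperFace (newtonPolyhedron a) Q ∧ ¬ InCoordinateHyperplane Q ∧
      ∑ j, s j ∈ faceRoots a Q := by
  classical
  obtain ⟨t, m, cs, ht, hm, htI, hmJ, htm, hcs, hcsJ, hcsI⟩ := hs.exists_certificate
  have hI : ∀ i, ∃ k : ℕ, t i ≠ 0 → expForm E s i = -(k + 1) := fun i => by
    by_cases h : t i = 0
    · exact ⟨0, fun h' => absurd h h'⟩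
    · obtain ⟨k, hk⟩ := htI i h
      exact ⟨k, fun _ => hk⟩
  choose kI hkI using hI
  have hJ : ∀ j, ∃ k : ℕ, m j ≠ 0 → s j = k := fun j => by
    by_cases h : m j = 0
    · exact ⟨0, fun h' => absurd h h'⟩
    · obtain ⟨k, hk⟩ := hmJ j h
      exact ⟨k, fun _ => hk⟩
  choose kJ hkJ using hJ
  -- `ℓᵢ(s)` cannot be a negative integer if it only involves natural numbers `sⱼ`.
  have hnat : ∀ i, (∀ j, m j = 0 → E j i = 0) → t i = 0 := by
    intro i hi
    by_contra hti
    have h1 : expForm E s i = ((∑ j, E j i * kJ j : ℕ) : ℂ) := by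
      rw [expForm]
      push_cast
      refine Finset.sum_congr rfl fun j _ => ?_
      by_cases hj : m j = 0
      · simp [hi j hj]
      · rw [hkJ j hj]
    rw [hkI i hti] at h1
    have h2 : ((∑ j, E j i * kJ j + kI i + 1 : ℕ) : ℂ) = 0 := by
      push_cast at h1 ⊢
      rw [← h1]
      ring
    exact absurd (Nat.cast_eq_zero.1 h2) (Nat.succ_ne_zero _)
  obtain ⟨k₀, hk₀⟩ : ∃ k₀, m k₀ = 0 := by
    by_contra! h
    have ht0 : ∀ i, t i = 0 := fun i => hnat i fun j hj => absurd hj (h j)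
    obtain ⟨j⟩ : Nonempty ι := by
      by_contra hι
      rw [not_nonempty_iff] at hι
      exact ha (by rw [hE, Set.range_eq_empty, Ideal.span_empty])
    have h1 := htm j
    simp only [ht0, zero_mul, Finset.sum_const_zero] at h1
    linarith [hm j]
  have hmem : ∀ j, intVec (E j) ∈ expSet a := fun j =>
    intVec_mem_expSet.2 (hE ▸ Ideal.subset_span ⟨j, rfl⟩)
  have hmemQ : ∀ j, m j = 0 → toReal (intVec (E j)) ∈ formFace a t := fun j hj => by
    rw [toReal_mem_formFace (hmem j)]
    simpa [intVec, hj] using htm j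
  have hv₀ : intVec (E k₀) ∈ expSetOn a (formFace a t) := ⟨hmem k₀, hmemQ k₀ hk₀⟩
  have hmem' : ∀ i, intVec (E k₀) + Pi.single i 1 ∈ expSet a := fun i =>
    mem_expSet_of_le (hmem k₀) (le_add_of_nonneg_right (Pi.single_nonneg.2 zero_le_one))
  have hmemQ' : ∀ i, t i = 0 → toReal (intVec (E k₀) + Pi.single i 1) ∈ formFace a t := by
    intro i hi
    rw [toReal_mem_formFace (hmem' i)]
    have h2 := htm k₀
    simp only [Pi.add_apply, intVec, Int.cast_add, Int.cast_natCast, mul_add,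
      Finset.sum_add_distrib, h2, hk₀, add_zero, Pi.single_apply]
    simp [hi]
  refine ⟨formFace a t, isProperFace_formFace hE ht hm htm hk₀, ?_, ?_⟩
  · rintro ⟨i, hi⟩
    have hti : t i = 0 := hnat i fun j hj => by
      simpa [toReal, intVec] using hi _ (hmemQ j hj)
    have h1 := hi _ (hmemQ' i hti)
    simp only [toReal, intVec, Pi.add_apply, Pi.single_eq_same, Int.cast_add, Int.cast_natCast,
      Int.cast_one] at h1
    have h2 : (0 : ℝ) ≤ E k₀ i := Nat.cast_nonneg _
    linarith
  -- `c₀` agrees with `s` on the support of `m`, and its sum is corrected to zero at `k₀`, which is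
  -- an exponent on the face. On the support of `t`, the vector `u` is the image of `c₀ - s`.
  let c₁ : ι → ℤ := fun j => if m j = 0 then 0 else kJ j
  let c₀ : ι → ℤ := c₁ - Pi.single k₀ (∑ j, c₁ j)
  have hc₀ : ∑ j, c₀ j = 0 := by simp [c₀]
  have hc₀J : ∀ j, m j ≠ 0 → c₀ j = kJ j := fun j hj => by
    have : j ≠ k₀ := fun h => hj (h ▸ hk₀)
    simp [c₀, c₁, hj, this]
  let u : Fin n → ℤ := fun i => kI i + 1 + expForm E c₀ i
  have hu : ∀ i, t i ≠ 0 → (u i : ℂ) = expForm E (fun j => (c₀ j : ℂ) - s j) i := by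
    intro i hi
    have h1 := expForm_sub E (fun j => (c₀ j : ℂ)) s i
    have h2 := intCast_expForm (K := ℂ) E c₀ i
    simp only [u, Int.cast_add, Int.cast_natCast, Int.cast_one, h2]
    change _ = expForm E ((fun j => (c₀ j : ℂ)) - s) i
    rw [h1, hkI i hi]
    ring
  have hdiff : ∀ j, m j ≠ 0 → (c₀ j : ℂ) - s j = 0 := fun j hj => by
    rw [hc₀J j hj, hkJ j hj]
    simp
  refine ⟨t, fun x hx => hx.2, u, ⟨u - 1, ?_, by abel⟩, ?_, ?_, ?_⟩
  · -- `u` belongs to `M_Q`.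
    have h1 := sum_smul_mem_closure (a := a) (Q := formFace a t) Finset.univ
      (fun j => intVec (E j)) (fun j _ => hmem j) c₀ (fun j _ hj => by
        refine hmemQ j ?_
        by_contra h
        rw [hc₀J j h] at hj
        omega) hv₀ (w := fun i => (kI i : ℤ)) (fun i => by simp)
    convert h1 using 1
    ext i
    simp only [u, Pi.sub_apply, Pi.one_apply, Pi.add_apply, Finset.sum_apply, Pi.smul_apply,
      smul_eq_mul, mul_sub, Finset.sum_sub_distrib, ← Finset.sum_mul, hc₀, expForm, intVec]
    simp only [mul_comm (c₀ _)]
    ring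
  · -- `u` does not belong to `M_Q'`.
    rw [semigroupM'_eq a _ hv₀]
    rintro ⟨_, ⟨w, hw, rfl⟩, hwu⟩
    obtain ⟨c, hc1, hc2, hc3⟩ := exists_le_of_mem_closure hE ht hm htm hw
    let c₂ : ι → ℤ := c + Pi.single k₀ 1
    have hc₂ : ∑ j, c₂ j = 1 := by simp [c₂, Finset.sum_add_distrib, hc1]
    have hc₂J : ∀ j, m j ≠ 0 → 0 ≤ c₂ j := fun j hj => by
      have : j ≠ k₀ := fun h => hj (h ▸ hk₀)
      simpa [c₂, this] using hc2 j hj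
    have hc₂I : ∀ i, t i ≠ 0 → expForm E c₂ i ≤ kI i + expForm E c₀ i := fun i hi => by
      have h1 := congrFun hwu i
      simp only [u, Pi.add_apply, Pi.one_apply, intVec] at h1
      have h2 := hc3 i hi
      simp only [c₂]
      rw [expForm_add, expForm_single, mul_one]
      linarith
    let N : ℤ := ∑ j, |c₂ j - c₀ j| + ∑ i, |expForm E (c₂ - c₀) i|
    have hN1 : ∀ j, |c₂ j - c₀ j| ≤ N := fun j =>
      le_add_of_le_of_nonneg (Finset.single_le_sum (f := fun j => |c₂ j - c₀ j|)
        (fun _ _ => abs_nonneg _) (Finset.mem_univ j)) (Finset.sum_nonneg fun _ _ => abs_nonneg _)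
    have hN2 : ∀ i, |expForm E (c₂ - c₀) i| ≤ N := fun i =>
      le_add_of_nonneg_of_le (Finset.sum_nonneg fun _ _ => abs_nonneg _)
        (Finset.single_le_sum (f := fun i => |expForm E (c₂ - c₀) i|)
          (fun _ _ => abs_nonneg _) (Finset.mem_univ i))
    have hN0 : 0 ≤ N := add_nonneg (Finset.sum_nonneg fun _ _ => abs_nonneg _)
      (Finset.sum_nonneg fun _ _ => abs_nonneg _)
    -- A large multiple of `cs` takes care of the coordinates outside the supports of `t` and `m`
    have hd : ∑ j, (c₂ - c₀ + N • cs) j = 1 := by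
      simp [Finset.sum_add_distrib, hc₂, hc₀, ← Finset.mul_sum, hcs]
    rcases hs _ hd with ⟨j, k, hk, hlt⟩ | ⟨i, k, hk, hlt⟩
    · obtain ⟨h1, h2⟩ := hcsJ j ⟨k, hk⟩
      simp only [Pi.add_apply, Pi.sub_apply, Pi.smul_apply, smul_eq_mul] at hlt
      by_cases hj : m j = 0
      · have h3 := h2 hj
        have h4 := neg_abs_le (c₂ j - c₀ j)
        have h5 := hN1 j
        nlinarith
      · have h3 := hc₂J j hj
        have h4 : (kJ j : ℤ) = k := by
          have := (hkJ j hj).symm.trans hk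
          exact_mod_cast this
        rw [hc₀J j hj, h4] at hlt
        nlinarith
    · obtain ⟨h1, h2⟩ := hcsI i ⟨k, hk⟩
      rw [expForm_add, expForm_smul] at hlt
      by_cases hi : t i = 0
      · have h3 := h2 hi
        have h4 := le_abs_self (expForm E (c₂ - c₀) i)
        have h5 := hN2 i
        nlinarith
      · have h3 := hc₂I i hi
        have h4 : (kI i : ℤ) = k := by
          have h5 := (hkI i hi).symm.trans hk
          have h6 : (kI i : ℂ) = k := by linear_combination -h5
          exact_mod_cast h6
        rw [expForm_sub] at hlt
        nlinarith
  · -- `u` lies in the linear span of the face.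
    let β : ι → ℝ := fun j => ((c₀ j : ℂ) - s j).re
    have hβ : ∀ i, t i ≠ 0 → (u i : ℝ) = ∑ j, (E j i : ℝ) * β j := fun i hi => by
      have h1 := congrArg Complex.re (hu i hi)
      rw [Complex.intCast_re, expForm, Complex.re_sum] at h1
      rw [h1]
      refine Finset.sum_congr rfl fun j _ => ?_
      rw [← Complex.ofReal_natCast, Complex.re_ofReal_mul]
    have hdec : toReal u = ∑ j, β j • toReal (intVec (E j)) +
        ∑ i, ((u i : ℝ) - ∑ j, (E j i : ℝ) * β j) •
          (toReal (intVec (E k₀) + Pi.single i 1) - toReal (intVec (E k₀))) := by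
      ext i
      have h1 : ∀ l : Fin n, toReal (intVec (E k₀) + Pi.single l 1) i - toReal (intVec (E k₀)) i =
          if i = l then 1 else 0 := fun l => by
        simp [toReal, Pi.single_apply]
      simp only [Pi.add_apply, Finset.sum_apply, Pi.smul_apply, Pi.sub_apply, h1, smul_eq_mul,
        mul_ite, mul_one, mul_zero, Finset.sum_ite_eq, Finset.mem_univ, if_true]
      simp only [toReal, intVec, Int.cast_natCast, mul_comm (β _)]
      ring
    rw [hdec]
    refine add_mem (Submodule.sum_mem _ fun j _ => ?_) (Submodule.sum_mem _ fun i _ => ?_)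
    · by_cases hj : m j = 0
      · exact Submodule.smul_mem _ _ (Submodule.subset_span (hmemQ j hj))
      · have h1 : β j = 0 := by simp only [β, hdiff j hj, Complex.zero_re]
        rw [h1, zero_smul]
        exact zero_mem _
    · by_cases hi : t i = 0
      · exact Submodule.smul_mem _ _ (Submodule.sub_mem _ (Submodule.subset_span (hmemQ' i hi))
          (Submodule.subset_span (hmemQ k₀ hk₀)))
      · rw [hβ i hi, sub_self, zero_smul]
        exact zero_mem _
  · have h1 : ∀ i, (t i : ℂ) * u i = ∑ j, (t i * E j i : ℂ) * (c₀ j - s j) := fun i => by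
      by_cases hi : t i = 0
      · simp [hi]
      · rw [hu i hi, expForm, Finset.mul_sum]
        exact Finset.sum_congr rfl fun j _ => by ring
    push_cast
    simp only [h1]
    rw [Finset.sum_comm]
    have h2 : ∀ j, ∑ i, (t i * E j i : ℂ) * (c₀ j - s j) = c₀ j - s j := fun j => by
      have h3 : ∑ i, (t i * E j i : ℂ) = 1 + m j := by exact_mod_cast htm j
      rw [← Finset.sum_mul, h3]
      by_cases hj : m j = 0
      · simp [hj]
      · simp [hdiff j hj]
    have h4 : ∑ j, (c₀ j : ℂ) = 0 := by exact_mod_cast congrArg (Int.cast (R := ℂ)) hc₀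
    simp only [h2, Finset.sum_sub_distrib, h4]
    ring

end CriticalFace

/-! ### Finiteness of the set of sums of critical points -/

section Finiteness

variable {ι : Type*} [Fintype ι] {n : ℕ} {a : Ideal (MvPolynomial (Fin n) ℂ)}
  {E : ι → Fin n →₀ ℕ}

/-- The ideal of the polynomials `criticalPoly E c` with `∑ cⱼ = 1`. -/
noncomputable def criticalIdeal (E : ι → Fin n →₀ ℕ) : Ideal (MvPolynomial ι ℂ) :=
  Ideal.span {p | ∃ c : ι → ℤ, ∑ j, c j = 1 ∧ p = criticalPoly E c}

theorem mem_zeroLocus_criticalIdeal_iff {s : ι → ℂ} :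
    s ∈ zeroLocus ℂ (criticalIdeal E) ↔ IsCritical E s := by
  rw [isCritical_iff, criticalIdeal, zeroLocus_span]
  simp only [Set.mem_ofPred_eq, forall_exists_index, and_imp]
  exact ⟨fun h c hc => h _ c hc rfl, fun h _ c hc hp => hp ▸ h c hc⟩

/-- Being critical is decided by finitely many affine equations `sⱼ = k` and `ℓᵢ(s) = -(k + 1)`. -/
theorem exists_bound_isCritical (E : ι → Fin n →₀ ℕ) : ∃ B : ℕ, ∀ s s' : ι → ℂ, IsCritical E s →
    (∀ j, ∀ k < B, s j = k → s' j = k) →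
    (∀ i, ∀ k < B, expForm E s i = -(k + 1) → expForm E s' i = -(k + 1)) → IsCritical E s' := by
  classical
  have hfg : (criticalIdeal E).FG := IsNoetherian.noetherian _
  obtain ⟨T, hT, hspan⟩ := (Submodule.fg_span_iff_fg_span_finset_subset _).1 hfg
  have hT' : ∀ p ∈ T, ∃ c : ι → ℤ, ∑ j, c j = 1 ∧ p = criticalPoly E c := fun p hp => hT hp
  choose! c hc hcp using hT'
  obtain ⟨B, hB⟩ := Finset.exists_le (T.biUnion fun p =>
    (Finset.univ.image fun j => (-c p j).toNat) ∪
      Finset.univ.image fun i => (expForm E (c p) i).toNat)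
  refine ⟨B, fun s s' hs hJ hI => ?_⟩
  have hspan' : criticalIdeal E = Ideal.span (T : Set (MvPolynomial ι ℂ)) := hspan
  rw [← mem_zeroLocus_criticalIdeal_iff, hspan', zeroLocus_span]
  intro p hp
  have h1 := (isCritical_iff E s).1 hs (c p) (hc p hp)
  change eval s' p = 0
  rw [hcp p hp, eval_criticalPoly_eq_zero_iff]
  rcases (eval_criticalPoly_eq_zero_iff E (c p) s).1 h1 with ⟨j, k, hk, hlt⟩ | ⟨i, k, hk, hlt⟩
  · refine Or.inl ⟨j, k, hJ j k ?_ hk, hlt⟩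
    have := hB (-c p j).toNat (Finset.mem_biUnion.2 ⟨p, hp, Finset.mem_union_left _
      (Finset.mem_image_of_mem _ (Finset.mem_univ j))⟩)
    omega
  · refine Or.inr ⟨i, k, hI i k ?_ hk, hlt⟩
    have := hB (expForm E (c p) i).toNat (Finset.mem_biUnion.2 ⟨p, hp, Finset.mem_union_right _
      (Finset.mem_image_of_mem _ (Finset.mem_univ i))⟩)
    omega

/-- The set of critical points is a finite union of affine subspaces, and the coordinate sum only
takes rational values on it. -/
theorem finite_sum_isCritical (ha : a ≠ ⊥)
    (hE : a = Ideal.span (Set.range fun j => monomial (E j) (1 : ℂ))) :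
    {z : ℂ | ∃ s, IsCritical E s ∧ ∑ j, s j = z}.Finite := by
  classical
  obtain ⟨B, hB⟩ := exists_bound_isCritical E
  let sig : (ι → ℂ) → Set ((ι ⊕ Fin n) × Fin B) := fun s =>
    {p | Sum.elim (fun j => s j = (p.2 : ℕ)) (fun i => expForm E s i = -((p.2 : ℕ) + 1)) p.1}
  have hrat : ∀ s, IsCritical E s → ∃ q : ℚ, ∑ j, s j = q := by
    intro s hs
    obtain ⟨Q, -, -, l, -, u, -, -, -, hz⟩ := hs.exists_sum_mem_faceRoots ha hE
    exact ⟨-∑ i, l i * (u i : ℚ), by rw [hz]; push_cast; rfl⟩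
  have hsig : ∀ s s', IsCritical E s → IsCritical E s' → sig s = sig s' →
      ∑ j, s j = ∑ j, s' j := by
    intro s s' hs hs' h
    by_contra hne
    -- The line through `s` and `s'` consists of critical points, and `∑ sⱼ` is not constant on it.
    have hline : ∀ τ : ℂ, IsCritical E (s + τ • (s' - s)) := by
      intro τ
      refine hB s _ hs (fun j k hk hj => ?_) fun i k hk hi => ?_
      · have h1 : ((Sum.inl j, ⟨k, hk⟩) : (ι ⊕ Fin n) × Fin B) ∈ sig s := hj
        rw [h] at h1
        have h2 : s' j = k := h1
        simp [hj, h2]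
      · have h1 : ((Sum.inr i, ⟨k, hk⟩) : (ι ⊕ Fin n) × Fin B) ∈ sig s := hi
        rw [h] at h1
        have h2 : expForm E s' i = -(k + 1) := h1
        rw [expForm_add, expForm_smul, expForm_sub, hi, h2]
        ring
    obtain ⟨q, hq⟩ := hrat _ (hline ((Complex.I - ∑ j, s j) / (∑ j, s' j - ∑ j, s j)))
    have hne' : ∑ j, s' j - ∑ j, s j ≠ 0 := sub_ne_zero.2 (Ne.symm hne)
    simp only [Pi.add_apply, Pi.smul_apply, Pi.sub_apply, smul_eq_mul, Finset.sum_add_distrib,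
      ← Finset.mul_sum, Finset.sum_sub_distrib, div_mul_cancel₀ _ hne'] at hq
    have h3 := congrArg Complex.im hq
    simp at h3
  choose! s hs hsum using fun (z : ℂ) (hz : z ∈ {z : ℂ | ∃ s, IsCritical E s ∧ ∑ j, s j = z}) => hz
  refine Set.Finite.of_finite_image (f := fun z => sig (s z)) (Set.toFinite _) ?_
  intro z hz z' hz' h
  rw [← hsum z hz, ← hsum z' hz']
  exact hsig _ _ (hs z hz) (hs z' hz') h

end Finiteness

/-- A monomial system satisfies a functional equation all of whose roots are coordinate sums of
critical points. -/
theorem exists_satisfiesFunctionalEquation_monomials {n r : ℕ}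
    {a : Ideal (MvPolynomial (Fin n) ℂ)} {E : Fin r → Fin n →₀ ℕ} (ha : a ≠ ⊥)
    (hE : a = Ideal.span (Set.range (monomials E))) :
    ∃ b : Polynomial ℂ, b.Monic ∧ SatisfiesFunctionalEquation (monomials E) b ∧
      ∀ z, b.IsRoot z → ∃ s, IsCritical E s ∧ ∑ j, s j = z := by
  have hfin := finite_sum_isCritical ha hE
  let b : Polynomial ℂ := ∏ z ∈ hfin.toFinset, (Polynomial.X - Polynomial.C z)
  have hb : b.Monic := Polynomial.monic_prod_X_sub_C _ _
  have hroot : ∀ z, b.eval z = 0 ↔ ∃ s, IsCritical E s ∧ ∑ j, s j = z := fun z => by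
    simp [b, Polynomial.eval_prod, Finset.prod_eq_zero_iff, sub_eq_zero]
  have hrad : Polynomial.aeval (∑ j, (X j : MvPolynomial (Fin r) ℂ)) b ∈
      (criticalIdeal E).radical := by
    rw [← vanishingIdeal_zeroLocus_eq_radical (K := ℂ), mem_vanishingIdeal_iff]
    intro s hs
    rw [← Polynomial.aeval_algHom_apply, map_sum]
    simp only [aeval_X, Polynomial.coe_aeval_eq_eval]
    exact (hroot _).2 ⟨s, mem_zeroLocus_criticalIdeal_iff.1 hs, rfl⟩
  -- By the Nullstellensatz, a power of `b` satisfies the functional equation.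
  obtain ⟨N, hN⟩ := hrad
  rw [← map_pow] at hN
  refine ⟨b ^ N, hb.pow N, satisfiesFunctionalEquation_of_mem_span _ hN, fun z hz => ?_⟩
  rw [Polynomial.IsRoot, Polynomial.eval_pow] at hz
  exact (hroot z).1 (eq_zero_of_pow_eq_zero hz)

/-! ### The Bernstein–Sato polynomial -/

section BernsteinSatoPolynomial

variable {n r : ℕ}

/-- The polynomials that satisfy a functional equation for `f`. -/
noncomputable def functionalEquationIdeal (f : Fin r → MvPolynomial (Fin n) ℂ) :
    Ideal (Polynomial ℂ) where
  carrier := {b | SatisfiesFunctionalEquation f b}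
  zero_mem' := by
    rw [Set.mem_ofPred_eq, satisfiesFunctionalEquation_iff, map_zero]
    exact zero_mem _
  add_mem' {b c} hb hc := by
    rw [Set.mem_ofPred_eq, satisfiesFunctionalEquation_iff] at hb hc ⊢
    rw [map_add]
    exact add_mem hb hc
  smul_mem' c b hb := by
    rw [Set.mem_ofPred_eq, satisfiesFunctionalEquation_iff] at hb ⊢
    rw [smul_eq_mul, map_mul]
    have h1 : Polynomial.aeval (∑ j, (X j : Coeffs f)) c =
        inclS f (Polynomial.aeval (∑ j, (X j : MvPolynomial (Fin r) ℂ)) c) := by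
      rw [← Polynomial.aeval_algHom_apply]
      simp [inclS]
    rw [h1]
    exact inclS_mul_mem_opHull _ hb

theorem mem_functionalEquationIdeal {f : Fin r → MvPolynomial (Fin n) ℂ} {b : Polynomial ℂ} :
    b ∈ functionalEquationIdeal f ↔ SatisfiesFunctionalEquation f b := Iff.rfl

variable {f : Fin r → MvPolynomial (Fin n) ℂ}

/-- The remainder of `c` modulo `b` satisfies the functional equation and has smaller degree. -/
theorem IsBernsteinSatoPolynomial.dvd {b c : Polynomial ℂ} (hb : IsBernsteinSatoPolynomial f b)
    (hc : SatisfiesFunctionalEquation f c) : b ∣ c := by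
  rw [← Polynomial.modByMonic_eq_zero_iff_dvd hb.1]
  by_contra h0
  have hmod : c %ₘ b ∈ functionalEquationIdeal f := by
    rw [Polynomial.modByMonic_eq_sub_mul_div]
    exact sub_mem (mem_functionalEquationIdeal.2 hc)
      (Ideal.mul_mem_right _ _ (mem_functionalEquationIdeal.2 hb.2.1))
  have hlead : (c %ₘ b).leadingCoeff ≠ 0 := Polynomial.leadingCoeff_ne_zero.2 h0
  have h1 := hb.2.2 (Polynomial.C (c %ₘ b).leadingCoeff⁻¹ * (c %ₘ b))
    (Polynomial.monic_C_mul_of_mul_leadingCoeff_eq_one (inv_mul_cancel₀ hlead))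
    (Ideal.mul_mem_left _ _ hmod)
  rw [Polynomial.natDegree_C_mul (inv_ne_zero hlead)] at h1
  have h2 := Polynomial.degree_modByMonic_lt c hb.1
  exact absurd (Polynomial.natDegree_lt_natDegree h0 h2) (not_lt.2 h1)

theorem existsUnique_isBernsteinSatoPolynomial {c : Polynomial ℂ} (hc : c.Monic)
    (hfc : SatisfiesFunctionalEquation f c) : ∃! b, IsBernsteinSatoPolynomial f b := by
  have hex : ∃ d, ∃ b : Polynomial ℂ, b.Monic ∧ SatisfiesFunctionalEquation f b ∧
      b.natDegree = d := ⟨_, c, hc, hfc, rfl⟩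
  classical
  obtain ⟨b, hb, hfb, hbd⟩ := Nat.find_spec hex
  have hB : IsBernsteinSatoPolynomial f b :=
    ⟨hb, hfb, fun c hc hfc => hbd ▸ Nat.find_min' hex ⟨c, hc, hfc, rfl⟩⟩
  exact ⟨b, hB, fun b' hB' => Polynomial.eq_of_monic_of_associated hB'.1 hB.1
    (associated_of_dvd_dvd (hB'.dvd hB.2.1) (hB.dvd hB'.2.1))⟩

end BernsteinSatoPolynomial

end BernsteinSato

open BernsteinSato in
/-- For every finite system of nonzero generators `f` of a nonzero monomial ideal `a`, the
Bernstein–Sato polynomial exists and is unique, and its set of roots is the union of the `R_Q`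
over the faces `Q` of the Newton polyhedron contained in no coordinate hyperplane. -/
theorem theorem1p1 (n : ℕ) (a : Ideal (MvPolynomial (Fin n) ℂ)) (ha : a ≠ ⊥)
    (hmon : BernsteinSato.IsMonomialIdeal a)
    (r : ℕ) (f : Fin r → MvPolynomial (Fin n) ℂ) (hf : ∀ j, f j ≠ 0)
    (hfa : Ideal.span (Set.range f) = a) :
    (∃! b : Polynomial ℂ, BernsteinSato.IsBernsteinSatoPolynomial f b) ∧
    ∀ b : Polynomial ℂ, BernsteinSato.IsBernsteinSatoPolynomial f b →
      {z : ℂ | b.IsRoot z} =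
        ⋃ Q ∈ {Q : Set (Fin n → ℝ) |
            BernsteinSato.IsProperFace (BernsteinSato.newtonPolyhedron a) Q ∧
              ¬ BernsteinSato.InCoordinateHyperplane Q},
          BernsteinSato.faceRoots a Q := by
  obtain ⟨G, hG⟩ := exists_finset_span_eq hmon
  let e := G.equivFin.symm
  let E : Fin G.card → Fin n →₀ ℕ := fun j => (e j).1
  have hE : a = Ideal.span (Set.range (monomials E)) := by
    rw [hG]
    congr 1
    ext p
    simp only [Set.mem_image, Set.mem_range, monomials, E]
    exact ⟨fun ⟨u, hu, hp⟩ => ⟨e.symm ⟨u, hu⟩, by simpa using hp⟩, fun ⟨j, hj⟩ => ⟨_, (e j).2, hj⟩⟩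
  have hE0 : ∀ j, monomials E j ≠ 0 := fun j => by simp [monomials]
  obtain ⟨c, hc, hEc, hroot⟩ := exists_satisfiesFunctionalEquation_monomials ha hE
  have hfc : SatisfiesFunctionalEquation f c := by
    rw [satisfiesFunctionalEquation_iff_weyl hE0, ← hE] at hEc
    rw [satisfiesFunctionalEquation_iff_weyl hf, hfa]
    exact hEc.of_span_eq (hE.symm.trans hfa.symm)
  refine ⟨existsUnique_isBernsteinSatoPolynomial hc hfc, fun b hb => Set.Subset.antisymm ?_ ?_⟩
  · intro z hz
    obtain ⟨s, hs, rfl⟩ := hroot z (Polynomial.IsRoot.dvd hz (hb.dvd hfc))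
    obtain ⟨Q, hQ, hQ', hz⟩ := hs.exists_sum_mem_faceRoots ha hE
    exact Set.mem_biUnion (x := Q) ⟨hQ, hQ'⟩ hz
  · refine Set.iUnion₂_subset fun Q hQ z hz => ?_
    obtain ⟨T, hT, s, hs, rfl⟩ := exists_isCritical_of_mem_faceRoots hmon hQ.1 hz
    have h1 := (satisfiesFunctionalEquation_iff_weyl hf b).1 hb.2.1
    rw [hfa] at h1
    exact (h1.of_span_eq (hfa.trans hT)).eval_eq_zero hT hs
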